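/- Let $\Bbbk$ be an algebraically closed field of characteristic zero, and let $m\ge 0$, $n\ge 1$ be integers with $m+n\ge 2$. Let $\mathfrak g=B(m,n)=\mathfrak{osp}(2m+1|2n)$, with weights $\epsilon_1,\dots,\epsilon_m,\delta_1,\dots,\delta_n$ and the bilinear form $(\epsilon_i,\epsilon_{i'})=\delta_{ii'}$, $(\delta_j,\delta_{j'})=-\delta_{jj'}$, $(\epsilon_i,\delta_j)=0$. Fix any Borel subalgebra of $\mathfrak g$ containing the Cartan subalgebra; equivalently, fix an ordering $v_1,\dots,v_{m+n}$ of the vectors $\pm\epsilon_1,\dots,\pm\epsilon_m,\pm\delta_1,\dots,\pm\delta_n$ (one sign for each), with simple roots $\alpha_i=v_i-v_{i+1}$ for $i<m+n$ and $\alpha_{m+n}=v_{m+n}$. Put $I=\{1,\dots,m+n\}$, $c_{ij}=(\alpha_i,\alpha_j)$, and let $|i|\in\mathbb Z/2$ be the parity of $\alpha_i$ (the number of $\delta$'s in it modulo 2). For homogeneous elements of a superalgebra let $[x,y]=xy-(-1)^{|x||y|}yx$ and $\{x,y\}=xy+(-1)^{|x||y|}yx$. Let $Y_\hbar(\mathfrak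 g)$ be the Drinfeld super Yangian: the unital associative $\Bbbk[[\hbar]]$-superalgebra generated by $h_{i,r}$, $x^\pm_{i,r}$ ($i\in I$, $r\in\mathbb Z_{\ge 0}$) with parities $|h_{i,r}|=\bar 0$, $|x^{\pm}_{i,r}|=|i|$ and the following defining relations, for all $r,s,t,r_1,r_2,r_3\ge 0$ and $i,j\in I$: - (Y1) $[h_{i,r},h_{j,s}]=0$; - (Y2) $[h_{i,0},x^\pm_{j,s}]=\pm c_{ij}x^\pm_{j,s}$; - (Y3) $[x^+_{i,r},x^-_{j,s}]=\delta_{ij}h_{i,r+s}$; - (Y4) $[h_{i,r+1},x^\pm_{j,s}]-[h_{i,r},x^\pm_{j,s+1}]=\pm\frac{c_{ij}\hbar}{2}\{h_{i,r},x^\pm_{j,s}\}$, where for $i=j$ one requires $|i|=\bar 0$, or $|i|=\bar 1$, $c_{ii}\ne 0$ and $r=0$; - (Y5) $[x^\pm_{i,r+1},x^\pm_{j,s}]-[x^\pm_{i,r},x^\pm_{j,s+1}]=\pm\frac{c_{ij}\hbar}{2}\{x^\pm_{i,r},x^\pm_{j,s}\}$, unless $i=j$ and $|i|=\bar 1$;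 - (Y6) $[h_{i,r},x^\pm_{i,s}]=0$ if $c_{ii}=0$; - (Y7) $[x^\pm_{i,r},x^\pm_{j,s}]=0$ if $c_{ij}=0$; - (Y8) $[x^\pm_{i,r},[x^\pm_{i,s},x^\pm_{j,t}]]+[x^\pm_{i,s},[x^\pm_{i,r},x^\pm_{j,t}]]=0$ if $c_{ii}\ne 0$, $i\ne m+n$ and $j\in\{i-1,i+1\}$; - (Y9) $\sum_{\sigma\in S_3}[x^\pm_{m+n,r_{\sigma(1)}},[x^\pm_{m+n,r_{\sigma(2)}},[x^\pm_{m+n,r_{\sigma(3)}},x^\pm_{m+n-1,t}]]]=0$; - (Y10) $[[x^\pm_{j-1,r},x^\pm_{j,0}],[x^\pm_{j,0},x^\pm_{j+1,s}]]=0$ if $j-1,j,j+1\in I$ and $c_{jj}=0$. Then $Y_\hbar(\mathfrak g)$ is isomorphic, as a $\Bbbk[[\hbar]]$-superalgebra and by an isomorphism that matches the generators of the same name, to the superalgebra generated by $h_{i,r}$, $x^\pm_{i,r}$ with $i\in I$, $r\in\{0,1\}$ (same parities) subject only to the following relations, for $i,j\in I$, where $\widetilde h_{i,1}=h_{i,1}-\frac{\hbar}{2}h_{i,0}^2$: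 - (MY1) $[h_{i,r},h_{j,s}]=0$ for $0\le r,s\le 1$; - (MY2) $[h_{i,0},x^\pm_{j,s}]=\pm c_{ij}x^\pm_{j,s}$ for $0\le s\le 1$; - (MY3) $[x^+_{i,r},x^-_{j,s}]=\delta_{ij}h_{i,r+s}$ for $0\le r+s\le 1$; - (MY4) $[\widetilde h_{i,1},x^\pm_{j,0}]=\pm c_{ij}x^\pm_{j,1}$, unless $i=j$ and $c_{ii}=0$; - (MY5) $[x^\pm_{i,1},x^\pm_{j,0}]-[x^\pm_{i,0},x^\pm_{j,1}]=\pm\frac{c_{ij}\hbar}{2}\{x^\pm_{i,0},x^\pm_{j,0}\}$, unless $i=j$ and $|i|=\bar 1$; - (MY6) $[h_{i,1},x^\pm_{i,s}]=0$ for $0\le s\le 1$ if $c_{ii}=0$; - (MY7) $[x^\pm_{i,0},x^\pm_{j,0}]=0$ if $c_{ij}=0$; - (MY8) $[x^\pm_{i,0},[x^\pm_{i,0},x^\pm_{j,0}]]=0$ if $c_{ii}\ne 0$, $i\ne m+n$ and $j\in\{i-1,i+1\}$; - (MY9) $[x^\pm_{m+n,0},[x^\pm_{m+n,0},[x^\pm_{m+n,0},x^\pm_{m+n-1,0}]]]=0$;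 - (MY10) $[[x^\pm_{j-1,0},x^\pm_{j,0}],[x^\pm_{j,0},x^\pm_{j+1,0}]]=0$ if $j-1,j,j+1\in I$ and $c_{jj}=0$. -/

import Mathlib

open scoped PowerSeries DirectSum

namespace SuperYangian

/-! ## Simple root systems of `B(m,n) = osp(2m+1|2n)` -/

/-- The weight lattice of `osp(2m+1|2n)`: integer combinations of `ε_1, …, ε_m` (left summand)
and `δ_1, …, δ_n` (right summand). -/
abbrev Weight (m n : ℕ) : Type := Fin m ⊕ Fin n → ℤ

/-- The bilinear form with `(ε_i, ε_i') = δ_{ii'}`, `(δ_j, δ_j') = -δ_{jj'}`, `(ε_i, δ_j) = 0`. -/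
def form {m n : ℕ} (a b : Weight m n) : ℤ :=
  (∑ i : Fin m, a (Sum.inl i) * b (Sum.inl i)) - ∑ j : Fin n, a (Sum.inr j) * b (Sum.inr j)

/-- The parity of a weight of `osp(2m+1|2n)`: the number of `δ`'s modulo 2. -/
def weightParity {m n : ℕ} (a : Weight m n) : ZMod 2 :=
  ((∑ j : Fin n, a (Sum.inr j) : ℤ) : ZMod 2)

/-- The choice of a Borel subalgebra of `osp(2m+1|2n)` containing the Cartan subalgebra, i.e. of a
simple root system. These are obtained from the orderings `v_1, …, v_{m+n}` of
`±ε_1, …, ±ε_m, ±δ_1, …, ±δ_n` (one sign for each): see `simpleRoot`. -/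
structure BorelChoice (m n : ℕ) where
  /-- the order in which the `ε`'s and the `δ`'s occur -/
  order : Fin (m + n) ≃ Fin m ⊕ Fin n
  /-- the signs -/
  sign : Fin (m + n) → ℤˣ

namespace BorelChoice

variable {m n : ℕ} (b : BorelChoice m n)

/-- The vector `v_i`, one of `±ε_1, …, ±ε_m, ±δ_1, …, ±δ_n`. -/
def vec (i : Fin (m + n)) : Weight m n := Pi.single (b.order i) (b.sign i : ℤ)

/-- The simple roots `α_i = v_i - v_{i+1}` for `i < m + n`, and `α_{m+n} = v_{m+n}`. The nodes
`1, …, m+n` are the elements `0, …, m+n-1` of `Fin (m + n)`. -/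
def simpleRoot (i : Fin (m + n)) : Weight m n :=
  if h : i.val + 1 < m + n then b.vec i - b.vec ⟨i.val + 1, h⟩ else b.vec i

/-- The symmetric Cartan matrix `c_{ij} = (α_i, α_j)`. -/
def cartan (i j : Fin (m + n)) : ℤ := form (b.simpleRoot i) (b.simpleRoot j)

/-- The parity `|i|` of a node. -/
def parity (i : Fin (m + n)) : ZMod 2 := weightParity (b.simpleRoot i)

end BorelChoice

/-! ## Superalgebras given by generators and relations -/

section Super

variable {R : Type*} [CommRing R] {X : Type*} (par : X → ZMod 2)

/-- For a map `g` from a set of generators with prescribed parities to an algebra, the span of the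
monomials in the generators whose total parity is `d`. -/
def parityPart {A : Type*} [Ring A] [Algebra R A] (g : X → A) (d : ZMod 2) : Submodule R A :=
  Submodule.span R {a | ∃ w : List X, (w.map par).sum = d ∧ (w.map g).prod = a}

variable (R) in
/-- A homogeneous element of the free superalgebra on generators of given parities, together with
its parity. -/
structure Homog where
  /-- the element -/
  val : FreeAlgebra R X
  /-- its parity -/
  deg : ZMod 2
  mem : val ∈ parityPart (R := R) par (FreeAlgebra.ι R) deg

theorem parityPart_one_mem {A : Type*} [Ring A] [Algebra R A] (g : X → A) :
    (1 : A) ∈ parityPart (R := R) par g 0 :=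
  Submodule.subset_span ⟨[], by simp, by simp⟩

theorem parityPart_mul_mem {A : Type*} [Ring A] [Algebra R A] (g : X → A) {d e : ZMod 2} {a b : A}
    (ha : a ∈ parityPart (R := R) par g d) (hb : b ∈ parityPart (R := R) par g e) :
    a * b ∈ parityPart (R := R) par g (d + e) := by
  have h := Submodule.mul_mem_mul ha hb
  unfold parityPart at h
  rw [Submodule.span_mul_span] at h
  refine Submodule.span_mono ?_ h
  rintro _ ⟨_, ⟨w, hw, rfl⟩, _, ⟨w', hw', rfl⟩, rfl⟩
  exact ⟨w ++ w', by simp [hw, hw'], by simp⟩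

theorem parityPart_gen_mem {A : Type*} [Ring A] [Algebra R A] (g : X → A) (x : X) :
    g x ∈ parityPart (R := R) par g (par x) :=
  Submodule.subset_span ⟨[x], by simp, by simp⟩

theorem neg_one_pow_mul_mem {A : Type*} [Ring A] [Algebra R A] {S : Submodule R A} (k : ℕ) {a : A}
    (ha : a ∈ S) : (-1 : A) ^ k * a ∈ S := by
  rcases neg_one_pow_eq_or A k with h | h <;> simp [h, ha]

variable {par}

/-- The Lie superbracket `[x, y] = x y - (-1)^{|x||y|} y x` of homogeneous elements. -/
def Homog.bracket (x y : Homog R par) : Homog R par where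
  val := x.val * y.val - (-1) ^ (x.deg.val * y.deg.val) * (y.val * x.val)
  deg := x.deg + y.deg
  mem := Submodule.sub_mem _ (parityPart_mul_mem par _ x.mem y.mem)
    (neg_one_pow_mul_mem _ (add_comm y.deg x.deg ▸ parityPart_mul_mem par _ y.mem x.mem))

/-- The anticommutator `{x, y} = x y + (-1)^{|x||y|} y x` of homogeneous elements. -/
def Homog.anti (x y : Homog R par) : Homog R par where
  val := x.val * y.val + (-1) ^ (x.deg.val * y.deg.val) * (y.val * x.val)
  deg := x.deg + y.deg
  mem := Submodule.add_mem _ (parityPart_mul_mem par _ x.mem y.mem)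
    (neg_one_pow_mul_mem _ (add_comm y.deg x.deg ▸ parityPart_mul_mem par _ y.mem x.mem))

variable (R par) in
/-- A generator as a homogeneous element. -/
def Homog.gen (x : X) : Homog R par where
  val := FreeAlgebra.ι R x
  deg := par x
  mem := parityPart_gen_mem par _ x

theorem Homog.mem_of_deg (x : Homog R par) {d : ZMod 2} (h : x.deg = d) :
    x.val ∈ parityPart (R := R) par (FreeAlgebra.ι R) d := h ▸ x.mem

/-- For homogeneous relations, the parity parts make the quotient a superalgebra. -/
theorem graded_of_homogeneous {R : Type*} [CommRing R] {X : Type*} (par : X → ZMod 2)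
    (rel : FreeAlgebra R X → FreeAlgebra R X → Prop)
    (hrel : ∀ a c, rel a c → ∃ d, a ∈ parityPart (R := R) par (FreeAlgebra.ι R) d ∧
      c ∈ parityPart (R := R) par (FreeAlgebra.ι R) d) :
    Nonempty (GradedAlgebra (A := RingQuot rel) (parityPart (R := R) par
      fun x => RingQuot.mkAlgHom R rel (FreeAlgebra.ι R x))) := by
  classical
  set g : X → RingQuot rel := fun x => RingQuot.mkAlgHom R rel (FreeAlgebra.ι R x) with hg
  set P : ZMod 2 → Submodule R (RingQuot rel) := parityPart (R := R) par g with hP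
  have : SetLike.GradedMonoid P :=
    { one_mem := parityPart_one_mem par g
      mul_mem := fun _ _ _ _ ha hb => parityPart_mul_mem par g ha hb }
  let f₀ : FreeAlgebra R X →ₐ[R] ⨁ d, P d :=
    FreeAlgebra.lift R fun x => DirectSum.of (fun d => P d) (par x) ⟨g x, parityPart_gen_mem par g x⟩
  have hword : ∀ w : List X, ∃ h : (w.map g).prod ∈ P (w.map par).sum,
      f₀ ((w.map (FreeAlgebra.ι R)).prod) = DirectSum.of (fun d => P d) _ ⟨_, h⟩ := by
    intro w
    induction w with
    | nil => exact ⟨parityPart_one_mem par g, by simp; rfl⟩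
    | cons x w ih =>
      obtain ⟨h, ih⟩ := ih
      refine ⟨by simpa using parityPart_mul_mem par g (parityPart_gen_mem par g x) h, ?_⟩
      simp only [List.map_cons, List.prod_cons, map_mul, ih]
      simp only [f₀, FreeAlgebra.lift_ι_apply, DirectSum.of_mul_of]
      rfl
  have hmk : ∀ w : List X, RingQuot.mkAlgHom R rel ((w.map (FreeAlgebra.ι R)).prod)
      = (w.map g).prod := by
    intro w; simp [map_list_prod, hg, Function.comp_def]
  have hhom : ∀ d a, a ∈ parityPart (R := R) par (FreeAlgebra.ι R) d →
      ∃ h : RingQuot.mkAlgHom R rel a ∈ P d, f₀ a = DirectSum.of (fun d => P d) d ⟨_, h⟩ := by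
    intro d a ha
    induction ha using Submodule.span_induction with
    | mem a ha =>
      obtain ⟨w, rfl, rfl⟩ := ha
      obtain ⟨h, e⟩ := hword w
      refine ⟨hmk w ▸ h, ?_⟩
      rw [e]
      congr 1
      exact Subtype.ext (hmk w).symm
    | zero =>
      refine ⟨by simp, ?_⟩
      rw [map_zero, eq_comm]
      convert map_zero (DirectSum.of (fun d => P d) d)
      simp
    | add a c _ _ iha ihc =>
      obtain ⟨h, e⟩ := iha
      obtain ⟨h', e'⟩ := ihc
      refine ⟨by simpa using Submodule.add_mem _ h h', ?_⟩
      rw [map_add, e, e', ← map_add]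
      congr 1
      exact Subtype.ext (map_add _ _ _).symm
    | smul t a _ iha =>
      obtain ⟨h, e⟩ := iha
      refine ⟨by simpa using Submodule.smul_mem _ t h, ?_⟩
      rw [map_smul, e]
      change t • DirectSum.lof R _ (fun d => P d) d _ = DirectSum.lof R _ (fun d => P d) d _
      rw [← map_smul]
      congr 1
      exact Subtype.ext (map_smul _ _ _).symm
  let f : RingQuot rel →ₐ[R] ⨁ d, P d := RingQuot.liftAlgHom R ⟨f₀, by
    intro a c hac
    obtain ⟨d, ha, hc⟩ := hrel a c hac
    obtain ⟨h, e⟩ := hhom d a ha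
    obtain ⟨h', e'⟩ := hhom d c hc
    rw [e, e']
    congr 1
    exact Subtype.ext (RingQuot.mkAlgHom_rel R hac)⟩
  have hf : ∀ a, f (RingQuot.mkAlgHom R rel a) = f₀ a := fun a =>
    RingQuot.liftAlgHom_mkAlgHom_apply R f₀ _ a
  refine ⟨GradedAlgebra.ofAlgHom P f ?_ ?_⟩
  · refine RingQuot.ringQuot_ext' R _ _ (FreeAlgebra.hom_ext (funext fun x => ?_))
    simp [hf, f₀, hg]
  · rintro d ⟨a, ha⟩
    have key : ∃ c, c ∈ parityPart (R := R) par (FreeAlgebra.ι R) d ∧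
        RingQuot.mkAlgHom R rel c = a := by
      clear hf
      induction ha using Submodule.span_induction with
      | mem a ha =>
        obtain ⟨w, hw, rfl⟩ := ha
        exact ⟨_, Submodule.subset_span ⟨w, hw, rfl⟩, hmk w⟩
      | zero => exact ⟨0, Submodule.zero_mem _, map_zero _⟩
      | add a c _ _ iha ihc =>
        obtain ⟨u, hu, rfl⟩ := iha
        obtain ⟨v, hv, rfl⟩ := ihc
        exact ⟨u + v, Submodule.add_mem _ hu hv, map_add _ _ _⟩
      | smul t a _ iha =>
        obtain ⟨u, hu, rfl⟩ := iha
        exact ⟨t • u, Submodule.smul_mem _ t hu, map_smul _ _ _⟩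
    obtain ⟨c, hc, rfl⟩ := key
    obtain ⟨h, e⟩ := hhom d c hc
    rw [hf, e]

end Super

/-- Generators `h_{i,r}` and `x^±_{i,r}` with `i` in `I` and `r` in `D`. The sign `±` is given by an
element `e = ±1` of `ℤˣ`. -/
inductive Gen (I D : Type) : Type
  | h (i : I) (r : D)
  | x (e : ℤˣ) (i : I) (r : D)

/-- The parities `|h_{i,r}| = 0`, `|x^±_{i,r}| = |i|`. -/
def Gen.par {I D : Type} (p : I → ZMod 2) : Gen I D → ZMod 2
  | .h _ _ => 0
  | .x _ i _ => p i

noncomputable section Relations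

variable (k : Type*) [Field k] {m n : ℕ} (b : BorelChoice m n)

/-- Homogeneous elements of the free `k⟦ħ⟧`-superalgebra on the `h_{i,r}`, `x^±_{i,r}`, `r ∈ D`. -/
abbrev El (D : Type) : Type _ :=
  Homog (k⟦X⟧) (Gen.par (D := D) b.parity)

/-- The free generator `h_{i,r}`. -/
def gh {D : Type} (i : Fin (m + n)) (r : D) : El k b D := Homog.gen _ _ (.h i r)

/-- The free generator `x^±_{i,r}`. -/
def gx {D : Type} (e : ℤˣ) (i : Fin (m + n)) (r : D) : El k b D := Homog.gen _ _ (.x e i r)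

/-- The scalar `± c_{ij}`. -/
def coef (e : ℤˣ) (i j : Fin (m + n)) : k⟦X⟧ := (((e : ℤ) * b.cartan i j : ℤ) : k⟦X⟧)

/-- The scalar `± c_{ij} ħ / 2`, where `ħ` is the variable of `k⟦X⟧`. -/
def coefHbar (e : ℤˣ) (i j : Fin (m + n)) : k⟦X⟧ :=
  PowerSeries.C ((((e : ℤ) * b.cartan i j : ℤ) : k) / 2) * PowerSeries.X

/-- The defining relations of the Drinfeld super Yangian of `B(m,n)`, for the simple root system
`b`. In `quartic`, the condition `c_{jj} = 0` on a node `j` with two neighbours says that the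
middle node is isotropic odd. -/
inductive YRel :
    FreeAlgebra (k⟦X⟧) (Gen (Fin (m + n)) ℕ) → FreeAlgebra (k⟦X⟧) (Gen (Fin (m + n)) ℕ) → Prop
  | hh (i j : Fin (m + n)) (r s : ℕ) :
      YRel ((gh k b i r).bracket (gh k b j s)).val 0
  | h0x (e : ℤˣ) (i j : Fin (m + n)) (s : ℕ) :
      YRel ((gh k b i 0).bracket (gx k b e j s)).val (coef k b e i j • (gx k b e j s).val)
  | xx (i j : Fin (m + n)) (r s : ℕ) :
      YRel ((gx k b 1 i r).bracket (gx k b (-1) j s)).val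
        (if i = j then (gh k b i (r + s)).val else 0)
  | hx (e : ℤˣ) (i j : Fin (m + n)) (r s : ℕ)
      (hij : i = j → b.parity i = 0 ∨ (b.parity i = 1 ∧ b.cartan i i ≠ 0 ∧ r = 0)) :
      YRel (((gh k b i (r + 1)).bracket (gx k b e j s)).val
          - ((gh k b i r).bracket (gx k b e j (s + 1))).val)
        (coefHbar k b e i j • ((gh k b i r).anti (gx k b e j s)).val)
  | xxShift (e : ℤˣ) (i j : Fin (m + n)) (r s : ℕ) (hij : ¬ (i = j ∧ b.parity i = 1)) :
      YRel (((gx k b e i (r + 1)).bracket (gx k b e j s)).val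
          - ((gx k b e i r).bracket (gx k b e j (s + 1))).val)
        (coefHbar k b e i j • ((gx k b e i r).anti (gx k b e j s)).val)
  | hxIsotropic (e : ℤˣ) (i : Fin (m + n)) (r s : ℕ) (hi : b.cartan i i = 0) :
      YRel ((gh k b i r).bracket (gx k b e i s)).val 0
  | xxZero (e : ℤˣ) (i j : Fin (m + n)) (r s : ℕ) (hij : b.cartan i j = 0) :
      YRel ((gx k b e i r).bracket (gx k b e j s)).val 0
  | cubic (e : ℤˣ) (i j : Fin (m + n)) (r s t : ℕ) (hlast : i.val + 1 ≠ m + n)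
      (hij : j.val + 1 = i.val ∨ j.val = i.val + 1) (hi : b.cartan i i ≠ 0) :
      YRel (((gx k b e i r).bracket ((gx k b e i s).bracket (gx k b e j t))).val
        + ((gx k b e i s).bracket ((gx k b e i r).bracket (gx k b e j t))).val) 0
  | lastCubic (e : ℤˣ) (i j : Fin (m + n)) (r : Fin 3 → ℕ) (t : ℕ) (hlast : i.val + 1 = m + n)
      (hij : j.val + 1 = i.val) :
      YRel (∑ σ : Equiv.Perm (Fin 3),
        ((gx k b e i (r (σ 0))).bracket ((gx k b e i (r (σ 1))).bracket
          ((gx k b e i (r (σ 2))).bracket (gx k b e j t)))).val) 0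
  | quartic (e : ℤˣ) (j' j j'' : Fin (m + n)) (r s : ℕ) (h1 : j'.val + 1 = j.val)
      (h2 : j.val + 1 = j''.val) (hj : b.cartan j j = 0) :
      YRel (((gx k b e j' r).bracket (gx k b e j 0)).bracket
        ((gx k b e j 0).bracket (gx k b e j'' s))).val 0

/-- The element `h̃_{i,1} = h_{i,1} - (ħ/2) h_{i,0}²`, which is even. -/
def htilde (i : Fin (m + n)) : El k b (Fin 2) where
  val := (gh k b i 1).val
    - (PowerSeries.C (1 / 2 : k) * PowerSeries.X) • ((gh k b i 0).val * (gh k b i 0).val)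
  deg := 0
  mem := by
    have h : ∀ r : Fin 2, (gh k b i r).val ∈
        parityPart (R := k⟦X⟧) (Gen.par (D := Fin 2) b.parity) (FreeAlgebra.ι (k⟦X⟧)) 0 := fun r =>
      parityPart_gen_mem (Gen.par b.parity) _ (Gen.h i r)
    have h2 := parityPart_mul_mem _ _ (h 0) (h 0)
    rw [add_zero] at h2
    exact Submodule.sub_mem _ (h 1) (Submodule.smul_mem _ _ h2)

/-- The relations of the minimalistic presentation, in the generators with `r ∈ {0, 1}`. -/
inductive MYRel :
    FreeAlgebra (k⟦X⟧) (Gen (Fin (m + n)) (Fin 2)) →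
    FreeAlgebra (k⟦X⟧) (Gen (Fin (m + n)) (Fin 2)) → Prop
  | hh (i j : Fin (m + n)) (r s : Fin 2) :
      MYRel ((gh k b i r).bracket (gh k b j s)).val 0
  | h0x (e : ℤˣ) (i j : Fin (m + n)) (s : Fin 2) :
      MYRel ((gh k b i (0 : Fin 2)).bracket (gx k b e j s)).val
        (coef k b e i j • (gx k b e j s).val)
  | xx (i j : Fin (m + n)) (r s t : Fin 2) (ht : r.val + s.val = t.val) :
      MYRel ((gx k b 1 i r).bracket (gx k b (-1) j s)).val
        (if i = j then (gh k b i t).val else 0)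
  | hx (e : ℤˣ) (i j : Fin (m + n)) (hij : ¬ (i = j ∧ b.cartan i i = 0)) :
      MYRel ((htilde k b i).bracket (gx k b e j 0)).val (coef k b e i j • (gx k b e j 1).val)
  | xxShift (e : ℤˣ) (i j : Fin (m + n)) (hij : ¬ (i = j ∧ b.parity i = 1)) :
      MYRel (((gx k b e i 1).bracket (gx k b e j 0)).val
          - ((gx k b e i 0).bracket (gx k b e j 1)).val)
        (coefHbar k b e i j • ((gx k b e i 0).anti (gx k b e j 0)).val)
  | hxIsotropic (e : ℤˣ) (i : Fin (m + n)) (s : Fin 2) (hi : b.cartan i i = 0) :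
      MYRel ((gh k b i 1).bracket (gx k b e i s)).val 0
  | xxZero (e : ℤˣ) (i j : Fin (m + n)) (hij : b.cartan i j = 0) :
      MYRel ((gx k b e i 0).bracket (gx k b e j 0)).val 0
  | cubic (e : ℤˣ) (i j : Fin (m + n)) (hlast : i.val + 1 ≠ m + n)
      (hij : j.val + 1 = i.val ∨ j.val = i.val + 1) (hi : b.cartan i i ≠ 0) :
      MYRel ((gx k b e i 0).bracket ((gx k b e i 0).bracket (gx k b e j 0))).val 0
  | lastCubic (e : ℤˣ) (i j : Fin (m + n)) (hlast : i.val + 1 = m + n)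
      (hij : j.val + 1 = i.val) :
      MYRel ((gx k b e i 0).bracket ((gx k b e i 0).bracket
          ((gx k b e i 0).bracket (gx k b e j 0)))).val 0
  | quartic (e : ℤˣ) (j' j j'' : Fin (m + n)) (h1 : j'.val + 1 = j.val)
      (h2 : j.val + 1 = j''.val) (hj : b.cartan j j = 0) :
      MYRel (((gx k b e j' 0).bracket (gx k b e j 0)).bracket
        ((gx k b e j 0).bracket (gx k b e j'' 0))).val 0

/-- The Drinfeld super Yangian `Y_ħ(B(m,n))` as a `k⟦ħ⟧`-algebra. -/
abbrev Yangian : Type _ := RingQuot (YRel k b)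

/-- The generators of the Drinfeld super Yangian. -/
def Yangian.gen (g : Gen (Fin (m + n)) ℕ) : Yangian k b :=
  RingQuot.mkAlgHom (k⟦X⟧) (YRel k b) (FreeAlgebra.ι (k⟦X⟧) g)

/-- The `ZMod 2`-grading of the Drinfeld super Yangian. -/
def Yangian.grading (d : ZMod 2) : Submodule (k⟦X⟧) (Yangian k b) :=
  parityPart (Gen.par b.parity) (Yangian.gen k b) d

/-- The algebra of the minimalistic presentation. -/
abbrev MinYangian : Type _ := RingQuot (MYRel k b)

/-- The generators of the algebra of the minimalistic presentation. -/
def MinYangian.gen (g : Gen (Fin (m + n)) (Fin 2)) : MinYangian k b :=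
  RingQuot.mkAlgHom (k⟦X⟧) (MYRel k b) (FreeAlgebra.ι (k⟦X⟧) g)

/-- The `ZMod 2`-grading of the algebra of the minimalistic presentation. -/
def MinYangian.grading (d : ZMod 2) : Submodule (k⟦X⟧) (MinYangian k b) :=
  parityPart (Gen.par b.parity) (MinYangian.gen k b) d

theorem gh_deg {D : Type} (i : Fin (m + n)) (r : D) : (gh k b i r).deg = 0 := rfl

theorem gx_deg {D : Type} (e : ℤˣ) (i : Fin (m + n)) (r : D) :
    (gx k b e i r).deg = b.parity i := rfl

theorem Yangian.graded : Nonempty (GradedAlgebra (Yangian.grading k b)) := by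
  refine graded_of_homogeneous _ _ fun a c h => ?_
  cases h with
  | hh | hxIsotropic | xxZero | quartic => exact ⟨_, Homog.mem _, Submodule.zero_mem _⟩
  | h0x e i j s =>
    exact ⟨_, Homog.mem _, Submodule.smul_mem _ _ (Homog.mem_of_deg _
      (by simp [Homog.bracket, gx_deg, gh_deg]))⟩
  | xx i j r s =>
    refine ⟨_, Homog.mem _, ?_⟩
    split_ifs with hij
    · subst hij
      exact Homog.mem_of_deg _ (by simp [Homog.bracket, gx_deg, gh_deg, CharTwo.add_self_eq_zero])
    · exact Submodule.zero_mem _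
  | hx e i j r s | xxShift e i j r s =>
    exact ⟨_, Submodule.sub_mem _ (Homog.mem _) (Homog.mem_of_deg _ rfl),
      Submodule.smul_mem _ _ (Homog.mem_of_deg _ rfl)⟩
  | cubic e i j r s t =>
    exact ⟨_, Submodule.add_mem _ (Homog.mem _) (Homog.mem_of_deg _ rfl), Submodule.zero_mem _⟩
  | lastCubic e i j r t =>
    exact ⟨b.parity i + (b.parity i + (b.parity i + b.parity j)),
      Submodule.sum_mem _ fun σ _ => Homog.mem_of_deg _ rfl, Submodule.zero_mem _⟩

theorem MinYangian.graded : Nonempty (GradedAlgebra (MinYangian.grading k b)) := by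
  refine graded_of_homogeneous _ _ fun a c h => ?_
  cases h with
  | hh | hxIsotropic | xxZero | cubic | lastCubic | quartic =>
    exact ⟨_, Homog.mem _, Submodule.zero_mem _⟩
  | h0x e i j s =>
    exact ⟨_, Homog.mem _, Submodule.smul_mem _ _ (Homog.mem_of_deg _
      (by simp [Homog.bracket, gx_deg, gh_deg]))⟩
  | xx i j r s t =>
    refine ⟨_, Homog.mem _, ?_⟩
    split_ifs with hij
    · subst hij
      exact Homog.mem_of_deg _ (by simp [Homog.bracket, gx_deg, gh_deg, CharTwo.add_self_eq_zero])
    · exact Submodule.zero_mem _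
  | hx e i j =>
    exact ⟨_, Homog.mem _, Submodule.smul_mem _ _ (Homog.mem_of_deg _
      (by simp [Homog.bracket, gx_deg, htilde]))⟩
  | xxShift e i j =>
    exact ⟨_, Submodule.sub_mem _ (Homog.mem _) (Homog.mem_of_deg _ rfl),
      Submodule.smul_mem _ _ (Homog.mem_of_deg _ rfl)⟩

end Relations

end SuperYangian

/-! Write η = ħ/2 and let z be a formal variable. That the Drinfeld relations imply the minimalistic
ones is direct: specialise the indices, and divide (Y8) and (Y9) by 2 and 6. The work is to build
all generators in the minimalistic algebra and to verify the Drinfeld relations there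
(`MinRep.extendMap_rel`).

The simple roots form a ℤ-basis of a unimodular lattice (`exists_dual`). Hence an integral
combination T_i of the h̃_{l,1} satisfies [T_i, x^±_{j,0}] = ±δ_{ij} x^±_{j,1}. Put x^±_{i,r} = (±ad
T_i)^r x^±_{i,0} and h_{i,r} = [x^+_{i,r}, x^-_{i,0}], and treat the family x^±_{i,r} as a linear
map on R[X] in which multiplication by X is the shift. For two different nodes, T_i and T_j shift
the two arguments independently, so relations in index 0 spread to all indices.

The tool for Cartan elements is the series U = 1 + ħz ∑ h_{i,r} z^r. Conjugation by U is
multiplicative, and this can be expressed without dividing by ħ (`ActsBy`). On x^±_j with j ≠ i it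
acts by the factor (1-(X-b)z)/(1-(X+b)z), where b = ±c_{ij}η. The factors for the two signs are
inverse to each other, so U fixes [x^+_j(f), x^-_j(g)] as soon as this bracket depends on fg only.

That dependence is `levelUpTo`, proved by induction on the degree. The obstruction in degree s is
D_i = [T_i, h_{i,s}]. Computing [h_{l,s}, h_{i,1}] in two ways for a neighbour l gives D_l = -s D_i,
and exchanging i and l gives (s²-1)D_i = 0. The case s = 1 comes from the relation [h_{i,1},
h_{j,1}] = 0.

Relations with repeated nodes, the Serre relations included, say that symmetric multilinear
expressions in the x^±_i vanish. Coefficients of log U act as derivations that shift by power sums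
(`G₂`, `G₃`), and over a base where nonzero integers are invertible these reduce everything to index
0 (`eq_zero_of_symm_shift`, `eq_zero_of_symm_shift₃`).

An odd non-isotropic last node obeys no such first-order rule. Its Serre relation forces a quadratic
relation among x_{i,0}, x_{i,1}, x_{i,2} (`last_quadratic`), hence a second-order recurrence for the
action of h_{i,r}. The resulting factors for the two signs are again inverse (`oddCoeff_inverse`),
so all h_{i,r} commute (`h_h`). Finally, a homomorphism to the Yangian that respects the T_i carries
the constructed generators to the given ones (`map_x_pow`), so the two homomorphisms are mutually
inverse. -/

namespace SuperYangian

/-! ### Superbrackets and inner derivations. -/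

section SuperBracket

variable {R A : Type*} [CommRing R] [Ring A] [Algebra R A]

/-- The sign `(-1)^{pq}` of the super commutation rule. -/
def superSign (R : Type*) [CommRing R] (p q : ZMod 2) : R := (-1) ^ (p.val * q.val)

theorem superSign_cases (p q : ZMod 2) :
    superSign R p q = 1 ∨ superSign R p q = -1 := neg_one_pow_eq_or R _

theorem superSign_comm (p q : ZMod 2) : superSign R p q = superSign R q p := by
  rw [superSign, mul_comm, superSign]

theorem superSign_zero_left (p : ZMod 2) : superSign R 0 p = 1 := by simp [superSign]

theorem superSign_one_one : superSign R 1 1 = -1 := by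
  simp [superSign, ZMod.val_one]

theorem superSign_mul_self (p q : ZMod 2) : superSign R p q * superSign R p q = 1 := by
  rcases superSign_cases (R := R) p q with h | h <;> simp [h]

theorem superSign_add_right (p q r : ZMod 2) :
    superSign R p (q + r) = superSign R p q * superSign R p r := by
  have key : ∀ a : ZMod 2, a = 0 ∨ a = 1 := by decide
  have h11 : (1 : ZMod 2) + 1 = 0 := by decide
  rcases key p with rfl | rfl <;> rcases key q with rfl | rfl <;> rcases key r with rfl | rfl <;>
    simp [superSign, ZMod.val_one, h11]

variable (R) in
/-- The superbracket of elements of parities `p` and `q`. -/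
def sbr (p q : ZMod 2) (x y : A) : A := x * y - superSign R p q • (y * x)

theorem sbr_add_left (p q : ZMod 2) (x x' y : A) :
    sbr R p q (x + x') y = sbr R p q x y + sbr R p q x' y := by
  simp only [sbr, add_mul, mul_add, smul_add]; abel

theorem sbr_add_right (p q : ZMod 2) (x y y' : A) :
    sbr R p q x (y + y') = sbr R p q x y + sbr R p q x y' := by
  simp only [sbr, add_mul, mul_add, smul_add]; abel

theorem sbr_smul_left (p q : ZMod 2) (t : R) (x y : A) :
    sbr R p q (t • x) y = t • sbr R p q x y := by
  simp only [sbr, smul_mul_assoc, mul_smul_comm, smul_sub, smul_comm t]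

theorem sbr_smul_right (p q : ZMod 2) (t : R) (x y : A) :
    sbr R p q x (t • y) = t • sbr R p q x y := by
  simp only [sbr, smul_mul_assoc, mul_smul_comm, smul_sub, smul_comm t]

@[simp] theorem sbr_zero_right (p q : ZMod 2) (x : A) : sbr R p q x 0 = 0 := by simp [sbr]

@[simp] theorem sbr_zero_left (p q : ZMod 2) (x : A) : sbr R p q 0 x = 0 := by simp [sbr]

@[simp] theorem sbr_neg_right (p q : ZMod 2) (x y : A) : sbr R p q x (-y) = -sbr R p q x y := by
  simp only [sbr, mul_neg, neg_mul, smul_neg]; abel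

theorem sbr_even_left (q : ZMod 2) (x y : A) : sbr R 0 q x y = x * y - y * x := by
  simp [sbr, superSign_zero_left]

theorem sbr_swap (p q : ZMod 2) (x y : A) :
    sbr R p q x y = -(superSign R p q • sbr R q p y x) := by
  simp only [sbr, smul_sub, smul_smul, superSign_comm q p, superSign_mul_self, one_smul]; abel

variable (R A) in
/-- The inner derivation `z ↦ u z - z u`, as an `R`-linear map. -/
def innerDer (u : A) : A →ₗ[R] A := LinearMap.mulLeft R u - LinearMap.mulRight R u

theorem innerDer_apply (u z : A) : innerDer R A u z = u * z - z * u := rfl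

theorem innerDer_mul (u y z : A) :
    innerDer R A u (y * z) = innerDer R A u y * z + y * innerDer R A u z := by
  simp only [innerDer_apply]; noncomm_ring

theorem innerDer_sbr (u : A) (p q : ZMod 2) (y z : A) :
    innerDer R A u (sbr R p q y z)
      = sbr R p q (innerDer R A u y) z + sbr R p q y (innerDer R A u z) := by
  simp only [sbr, map_sub, map_smul, innerDer_mul, smul_add]; abel

theorem innerDer_comm {u v : A} (h : u * v = v * u) :
    Commute (innerDer R A u) (innerDer R A v) := by
  ext z
  simp only [Module.End.mul_apply, innerDer_apply]
  linear_combination (norm := noncomm_ring) h * z - z * h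

end SuperBracket

/-! ### Elements acting in a group-like way -/

section GroupLike

open PowerSeries

variable {R A : Type*} [CommRing R] [Ring A] [Algebra R A]

/-- `H` acts on `p` through `P`, up to order `M`: writing `U = 1 + ħ X H`, one has
`H p = p H + P U` modulo `X ^ M`. -/
def ActsBy (ħ : R) (M : ℕ) (H p P : A⟦X⟧) : Prop :=
  ∃ e : A⟦X⟧, H * p = p * H + P * (1 + ħ • (X * H)) + X ^ M * e

/-- The condition says U p = (p + ħXP) U up to order, for U = 1 + ħXH. The formula is the product (p
+ ħXP)(q + ħXQ) with pq removed and one factor ħX cancelled; the argument never divides by ħ. -/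
theorem ActsBy.mul {ħ : R} {M : ℕ} {H p P q Q : A⟦X⟧} (hp : ActsBy ħ M H p P)
    (hq : ActsBy ħ M H q Q) : ActsBy ħ M H (p * q) (p * Q + P * q + ħ • (X * (P * Q))) := by
  obtain ⟨e, he⟩ := hp
  obtain ⟨d, hd⟩ := hq
  refine ⟨p * d + ħ • (P * (X * d)) + e * q, ?_⟩
  have h1 : P * (X * H) = X * (P * H) := by rw [← mul_assoc, ← X_mul, mul_assoc]
  have h2 : ∀ a : A⟦X⟧, a * (X ^ M * d) = X ^ M * (a * d) := fun a => by
    rw [← mul_assoc, ← X_pow_mul, mul_assoc]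
  have h3 : ∀ a b : A⟦X⟧, a * (X * b) = X * (a * b) := fun a b => by
    rw [← mul_assoc, ← X_mul, mul_assoc]
  calc H * (p * q) = (H * p) * q := by rw [mul_assoc]
    _ = p * (H * q) + P * q + ħ • (X * (P * (H * q))) + X ^ M * (e * q) := by
      rw [he]
      simp only [add_mul, mul_add, mul_one, smul_mul_assoc, mul_smul_comm, mul_assoc, h3, add_assoc]
    _ = _ := by
      rw [hd]
      simp only [add_mul, mul_add, mul_one, smul_mul_assoc, mul_smul_comm, mul_assoc, h3,
        h2, smul_add]
      abel

theorem ActsBy.sub_smul {ħ : R} {M : ℕ} {H p P q Q : A⟦X⟧} (hp : ActsBy ħ M H p P)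
    (hq : ActsBy ħ M H q Q) (s : R) : ActsBy ħ M H (p - s • q) (P - s • Q) := by
  obtain ⟨e, he⟩ := hp
  obtain ⟨d, hd⟩ := hq
  refine ⟨e - s • d, ?_⟩
  rw [mul_sub, mul_smul_comm, he, hd]
  simp only [sub_mul, mul_sub, smul_mul_assoc, mul_smul_comm, smul_add]
  abel

/-- Comparison of coefficients when the lower coefficients of the action vanish. -/
theorem ActsBy.coeff_eq {ħ : R} {M : ℕ} {H P : A⟦X⟧} {y : A} (hy : ActsBy ħ M H (C y) P) {r : ℕ}
    (hr : r < M) (hP : ∀ k < r, coeff k P = 0) :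
    coeff r H * y - y * coeff r H = coeff r P := by
  obtain ⟨e, he⟩ := hy
  have h := congrArg (coeff r) he
  have h0 : coeff r (P * (X * H)) = 0 := by
    rw [← mul_assoc, ← X_mul, mul_assoc]
    cases r with
    | zero => simp
    | succ r =>
      rw [coeff_succ_X_mul, coeff_mul]
      refine Finset.sum_eq_zero fun x hx => ?_
      rw [hP _ (by have := Finset.HasAntidiagonal.mem_antidiagonal.mp hx; omega), zero_mul]
  have h1 : coeff r (X ^ M * e) = 0 := by
    rw [coeff_X_pow_mul', if_neg (by omega)]
  rw [map_add, map_add, h1, mul_add, mul_one, mul_smul_comm, map_add, coeff_smul, h0,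
    coeff_mul_C, coeff_C_mul] at h
  rw [h]; simp

end GroupLike

end SuperYangian

/-! ### Abstract minimalistic data and the higher generators. -/

namespace SuperYangian

open Polynomial

/-- Generators and relations of the minimalistic presentation, in an abstract algebra. The
element `T i` shifts the nodes: `[T i, x^±_{j,r}] = ± δ_{ij} x^±_{j,r+1}`. -/
structure MinData (R A : Type*) [CommRing R] [Ring A] [Algebra R A] (N : ℕ) where
  η : R
  isUnit_intCast : ∀ n : ℤ, n ≠ 0 → IsUnit (n : R)
  c : Fin N → Fin N → ℤ
  p : Fin N → ZMod 2
  two_le : 2 ≤ N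
  c_symm : ∀ i j, c i j = c j i
  c_succ : ∀ i j : Fin N, i.val + 1 = j.val → c i j ≠ 0
  c_last : ∀ i j : Fin N, j.val + 1 = i.val → i.val + 1 = N → c j i = -c i i
  c_last_ne : ∀ i : Fin N, i.val + 1 = N → c i i ≠ 0
  p_eq_zero : ∀ i : Fin N, c i i ≠ 0 → i.val + 1 ≠ N → p i = 0
  p_eq_one : ∀ i : Fin N, c i i = 0 → p i = 1
  T : Fin N → A
  h₀ : Fin N → A
  h₁ : Fin N → A
  x₀ : ℤˣ → Fin N → A
  x₁ : ℤˣ → Fin N → A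
  T_T : ∀ i j, T i * T j = T j * T i
  T_h₀ : ∀ i j, T i * h₀ j = h₀ j * T i
  T_h₁ : ∀ i j, T i * h₁ j = h₁ j * T i
  h₀_h₁ : ∀ i j, h₀ i * h₁ j = h₁ j * h₀ i
  T_x₀ : ∀ e i j, i ≠ j → T i * x₀ e j = x₀ e j * T i
  T_x₀_self : ∀ e i, T i * x₀ e i - x₀ e i * T i = ((e : ℤ) : R) • x₁ e i
  h₀_x₀ : ∀ e i j, h₀ i * x₀ e j - x₀ e j * h₀ i = (((e : ℤ) * c i j : ℤ) : R) • x₀ e j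
  h₁_x₀ : ∀ e i j, h₁ i * x₀ e j - x₀ e j * h₁ i = (((e : ℤ) * c i j : ℤ) : R) •
    (x₁ e j + η • (h₀ i * x₀ e j + x₀ e j * h₀ i))
  x_x : ∀ i j, sbr R (p i) (p j) (x₀ 1 i) (x₀ (-1) j) = if i = j then h₀ i else 0
  x₁_x : ∀ i, sbr R (p i) (p i) (x₁ 1 i) (x₀ (-1) i) = h₁ i
  x_x₁ : ∀ i, sbr R (p i) (p i) (x₀ 1 i) (x₁ (-1) i) = h₁ i
  x_shift : ∀ e i j, i ≠ j ∨ p i = 0 →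
    sbr R (p i) (p j) (x₁ e i) (x₀ e j) - sbr R (p i) (p j) (x₀ e i) (x₁ e j) =
      ((((e : ℤ) * c i j : ℤ) : R) * η) •
        (x₀ e i * x₀ e j + superSign R (p i) (p j) • (x₀ e j * x₀ e i))
  x_x_zero : ∀ e i j, c i j = 0 → sbr R (p i) (p j) (x₀ e i) (x₀ e j) = 0
  cubic : ∀ e (i j : Fin N), i.val + 1 ≠ N → (j.val + 1 = i.val ∨ j.val = i.val + 1) →
    c i i ≠ 0 → sbr R (p i) (p i + p j) (x₀ e i) (sbr R (p i) (p j) (x₀ e i) (x₀ e j)) = 0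
  lastCubic : ∀ e (i j : Fin N), i.val + 1 = N → j.val + 1 = i.val →
    sbr R (p i) (p i + (p i + p j)) (x₀ e i) (sbr R (p i) (p i + p j) (x₀ e i)
      (sbr R (p i) (p j) (x₀ e i) (x₀ e j))) = 0
  quartic : ∀ e (j' j j'' : Fin N), j'.val + 1 = j.val → j.val + 1 = j''.val → c j j = 0 →
    sbr R (p j' + p j) (p j + p j'') (sbr R (p j') (p j) (x₀ e j') (x₀ e j))
      (sbr R (p j) (p j'') (x₀ e j) (x₀ e j'')) = 0

theorem eq_zero_of_shift {R A : Type*} [CommRing R] [AddCommGroup A] [Module R A] {F : R[X] → A}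
    (hadd : ∀ f g, F (f + g) = F f + F g) (hsmul : ∀ (t : R) f, F (t • f) = t • F f)
    (h1 : F 1 = 0) (hX : ∀ f, F f = 0 → F (X * f) = 0) (f : R[X]) : F f = 0 := by
  have hpow : ∀ n : ℕ, F (X ^ n) = 0 := fun n => by
    induction n with
    | zero => simpa using h1
    | succ n ih => rw [pow_succ']; exact hX _ ih
  induction f using Polynomial.induction_on' with
  | add f g hf hg => rw [hadd, hf, hg, add_zero]
  | monomial n t => rw [← C_mul_X_pow_eq_monomial, ← smul_eq_C_mul, hsmul, hpow, smul_zero]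

namespace MinData

variable {R A : Type*} [CommRing R] [Ring A] [Algebra R A] {N : ℕ} (S : MinData R A N)

/-- The sign `e = ±1` as a scalar. -/
def sgn (R : Type*) [CommRing R] (e : ℤˣ) : R := ((e : ℤ) : R)

theorem sgn_mul_self (e : ℤˣ) : sgn R e * sgn R e = 1 := by
  rcases Int.units_eq_one_or e with rfl | rfl <;> simp [sgn]

@[simp] theorem sgn_one : sgn R 1 = 1 := by simp [sgn]

@[simp] theorem sgn_neg_one : sgn R (-1) = -1 := by simp [sgn]

/-- The scalar `± c_{ij}`. -/
def k (e : ℤˣ) (i j : Fin N) : R := (((e : ℤ) * S.c i j : ℤ) : R)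

theorem k_eq (e : ℤˣ) (i j : Fin N) : S.k e i j = sgn R e * (S.c i j : R) := by
  simp [k, sgn]

include S in
theorem smul_cancel {n : ℤ} (hn : n ≠ 0) {a : A} (h : (n : R) • a = 0) : a = 0 := by
  obtain ⟨u, hu⟩ := S.isUnit_intCast n hn
  rw [← hu] at h
  simpa using congrArg (fun z => (↑u⁻¹ : R) • z) h

/-- The derivation of `A` whose iterates define `x^±_{i,r}`. -/
noncomputable def shift (e : ℤˣ) (i : Fin N) : Module.End R A := sgn R e • innerDer R A (S.T i)

/-- The linear map with `X ^ r ↦ x^±_{i,r}`. -/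
noncomputable def x (e : ℤˣ) (i : Fin N) : R[X] →ₗ[R] A :=
  (LinearMap.applyₗ (S.x₀ e i)) ∘ₗ (aeval (S.shift e i)).toLinearMap

theorem x_apply (e : ℤˣ) (i : Fin N) (f : R[X]) :
    S.x e i f = aeval (S.shift e i) f (S.x₀ e i) := rfl

@[simp] theorem x_one (e : ℤˣ) (i : Fin N) : S.x e i 1 = S.x₀ e i := by simp [x_apply]

theorem x_X_mul (e : ℤˣ) (i : Fin N) (f : R[X]) :
    S.x e i (X * f) = sgn R e • innerDer R A (S.T i) (S.x e i f) := by
  simp [x_apply, shift]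

theorem innerDer_T_x (e : ℤˣ) (i : Fin N) (f : R[X]) :
    innerDer R A (S.T i) (S.x e i f) = sgn R e • S.x e i (X * f) := by
  rw [x_X_mul, smul_smul, sgn_mul_self, one_smul]

theorem x_X (e : ℤˣ) (i : Fin N) : S.x e i X = S.x₁ e i := by
  have h := S.x_X_mul e i 1
  rw [mul_one, x_one, innerDer_apply, S.T_x₀_self, ← sgn, smul_smul, sgn_mul_self, one_smul] at h
  exact h

/-- True on x^±_{j,0}, and preserved by the shift because ad T_i commutes with ad T_j. The next
lemmas on h₀ and g spread from index 0 for the same reason. -/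
theorem innerDer_T_x_of_ne (e : ℤˣ) {i j : Fin N} (hij : i ≠ j) (f : R[X]) :
    innerDer R A (S.T i) (S.x e j f) = 0 := by
  refine eq_zero_of_shift (F := fun f => innerDer R A (S.T i) (S.x e j f))
    (by intros; simp) (by intros; simp) ?_ (fun f hf => ?_) f
  · rw [x_one, innerDer_apply, S.T_x₀ e i j hij, sub_self]
  · rw [x_X_mul, map_smul, ← Module.End.mul_apply, (innerDer_comm (S.T_T i j)).eq,
      Module.End.mul_apply, hf, map_zero, smul_zero]

theorem innerDer_h₀_x (e : ℤˣ) (i j : Fin N) (f : R[X]) :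
    innerDer R A (S.h₀ i) (S.x e j f) = S.k e i j • S.x e j f := by
  refine sub_eq_zero.mp (eq_zero_of_shift
    (F := fun f => innerDer R A (S.h₀ i) (S.x e j f) - S.k e i j • S.x e j f)
    (by intros; simp only [map_add, smul_add]; abel)
    (by intro t f; rw [map_smul, map_smul, smul_sub, smul_comm t]) ?_ (fun f hf => ?_) f)
  · rw [x_one, innerDer_apply, S.h₀_x₀, k, sub_self]
  · rw [sub_eq_zero] at hf ⊢
    rw [x_X_mul, map_smul, ← Module.End.mul_apply, (innerDer_comm (S.T_h₀ j i).symm).eq,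
      Module.End.mul_apply, hf, map_smul, smul_comm]

/-- The element `h̃_{i,1}`. -/
def g (i : Fin N) : A := S.h₁ i - S.η • (S.h₀ i * S.h₀ i)

theorem g_T (i j : Fin N) : S.g i * S.T j = S.T j * S.g i := by
  have h0 := S.T_h₀ j i
  simp only [g, sub_mul, mul_sub, S.T_h₁, smul_mul_assoc, mul_smul_comm]
  rw [mul_assoc, ← h0, ← mul_assoc, ← h0, mul_assoc]

/-- Subtracting η h₀² cancels the anticommutator in the action of h₁ and leaves a pure shift. -/
theorem innerDer_g_x (e : ℤˣ) (i j : Fin N) (f : R[X]) :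
    innerDer R A (S.g i) (S.x e j f) = S.k e i j • S.x e j (X * f) := by
  refine sub_eq_zero.mp (eq_zero_of_shift
    (F := fun f => innerDer R A (S.g i) (S.x e j f) - S.k e i j • S.x e j (X * f))
    (by intros; simp only [map_add, smul_add, mul_add]; abel)
    (by intro t f; rw [mul_smul_comm, map_smul, map_smul, map_smul, smul_sub, smul_comm t]) ?_ (fun f hf => ?_) f)
  · have h1 := S.h₁_x₀ e i j
    have h0 := S.h₀_x₀ e i j
    rw [mul_one, x_one, x_X, innerDer_apply, g]
    simp only [sub_mul, mul_sub, smul_mul_assoc, mul_smul_comm]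
    rw [← k] at h0 h1
    have h2 : S.h₀ i * S.h₀ i * S.x₀ e j - S.x₀ e j * (S.h₀ i * S.h₀ i)
        = S.k e i j • (S.h₀ i * S.x₀ e j + S.x₀ e j * S.h₀ i) := by
      have e1 := congrArg (S.h₀ i * ·) h0
      have e2 := congrArg (· * S.h₀ i) h0
      simp only [mul_smul_comm, smul_mul_assoc] at e1 e2
      rw [smul_add, ← e1, ← e2]; noncomm_ring
    linear_combination (norm := module) h1 - S.η • h2
  · rw [sub_eq_zero] at hf ⊢
    rw [x_X_mul, map_smul, ← Module.End.mul_apply, (innerDer_comm (S.g_T i j)).eq,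
      Module.End.mul_apply, hf, map_smul, smul_comm, ← x_X_mul]

end MinData

end SuperYangian

/-! ### Linear actions of Cartan series on families x(f) and on their brackets. -/

namespace SuperYangian

open Polynomial

section GroupLikeLinear

variable {R A : Type*} [CommRing R] [Ring A] [Algebra R A]

theorem actsBy_of_coeff {ħ : R} {M : ℕ} {h : ℕ → A} {y : A} {P : ℕ → A}
    (h0 : 0 < M → h 0 * y = y * h 0 + P 0)
    (hs : ∀ r, r + 1 < M → h (r + 1) * y = y * h (r + 1) + P (r + 1)
      + ħ • ∑ x ∈ Finset.HasAntidiagonal.antidiagonal r, P x.1 * h x.2) :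
    ActsBy ħ M (PowerSeries.mk h) (PowerSeries.C y) (PowerSeries.mk P) := by
  set H := PowerSeries.mk h
  set Q := PowerSeries.mk P
  obtain ⟨e, he⟩ := (PowerSeries.X_pow_dvd_iff (n := M)
    (φ := H * PowerSeries.C y - (PowerSeries.C y * H + Q * (1 + ħ • (PowerSeries.X * H))))).mpr
    (fun r hr => by
      have hX : Q * (PowerSeries.X * H) = PowerSeries.X * (Q * H) := by
        rw [← mul_assoc, ← PowerSeries.X_mul, mul_assoc]
      rw [mul_add, mul_one, mul_smul_comm, hX, map_sub, map_add, map_add,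
        PowerSeries.coeff_mul_C, PowerSeries.coeff_C_mul, PowerSeries.coeff_smul]
      cases r with
      | zero => simp [H, Q, h0 hr]
      | succ r =>
        rw [PowerSeries.coeff_succ_X_mul, PowerSeries.coeff_mul]
        simp only [H, Q, PowerSeries.coeff_mk, hs r hr]
        abel)
  exact ⟨e, by rw [← he]; abel⟩

/-- `h` acts on the values of `u` through multiplication by the coefficients `κ`. -/
def LinActs (ħ : R) (M : ℕ) (h : ℕ → A) (u : R[X] →ₗ[R] A) (κ : ℕ → R[X]) : Prop :=
  ∀ f, ActsBy ħ M (PowerSeries.mk h) (PowerSeries.C (u f))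
    (PowerSeries.mk fun r => u (κ r * f))

/-- The coefficients of the action on the superbracket `[u f, v g]`. -/
noncomputable def actCoeff (ħ : R) (p q : ZMod 2) (u v : R[X] →ₗ[R] A) (κ κ' : ℕ → R[X])
    (f g : R[X]) : ℕ → A
  | 0 => sbr R p q (u (κ 0 * f)) (v g) + sbr R p q (u f) (v (κ' 0 * g))
  | r + 1 => sbr R p q (u (κ (r + 1) * f)) (v g) + sbr R p q (u f) (v (κ' (r + 1) * g))
      + ħ • ∑ x ∈ Finset.HasAntidiagonal.antidiagonal r,
        sbr R p q (u (κ x.1 * f)) (v (κ' x.2 * g))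

/-- Multiplicativity gives the action on both products in the superbracket, and `actCoeff` lists its
coefficients. If those below r vanish, the correction terms involving lower h_j disappear and the
r-th one is an honest commutator. -/
theorem LinActs.sbr_comm {ħ : R} {M : ℕ} {h : ℕ → A} {u v : R[X] →ₗ[R] A} {κ κ' : ℕ → R[X]}
    (hu : LinActs ħ M h u κ) (hv : LinActs ħ M h v κ') (p q : ZMod 2) (f g : R[X]) {r : ℕ}
    (hr : r < M) (h0 : ∀ j < r, actCoeff ħ p q u v κ κ' f g j = 0) :
    innerDer R A (h r) (sbr R p q (u f) (v g)) = actCoeff ħ p q u v κ κ' f g r := by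
  have key := ((hu f).mul (hv g)).sub_smul ((hv g).mul (hu f)) (superSign R p q)
  have hC : PowerSeries.C (u f) * PowerSeries.C (v g)
      - superSign R p q • (PowerSeries.C (v g) * PowerSeries.C (u f))
      = PowerSeries.C (sbr R p q (u f) (v g)) := by
    rw [sbr, map_sub, ← map_mul, ← map_mul]
    congr 1
    ext n
    simp only [PowerSeries.coeff_smul, PowerSeries.coeff_C]
    split_ifs <;> simp
  rw [hC] at key
  have hcoeff : ∀ j, PowerSeries.coeff j
      (PowerSeries.C (u f) * PowerSeries.mk (fun r => v (κ' r * g))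
        + PowerSeries.mk (fun r => u (κ r * f)) * PowerSeries.C (v g)
        + ħ • (PowerSeries.X * (PowerSeries.mk (fun r => u (κ r * f))
          * PowerSeries.mk fun r => v (κ' r * g)))
      - superSign R p q • (PowerSeries.C (v g) * PowerSeries.mk (fun r => u (κ r * f))
        + PowerSeries.mk (fun r => v (κ' r * g)) * PowerSeries.C (u f)
        + ħ • (PowerSeries.X * (PowerSeries.mk (fun r => v (κ' r * g))
          * PowerSeries.mk fun r => u (κ r * f))))) = actCoeff ħ p q u v κ κ' f g j := by
    intro j
    simp only [map_sub, map_add, PowerSeries.coeff_smul, PowerSeries.coeff_C_mul,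
      PowerSeries.coeff_mul_C, PowerSeries.coeff_mk]
    cases j with
    | zero =>
      simp only [PowerSeries.coeff_zero_X_mul, smul_zero, actCoeff, sbr]
      module
    | succ j =>
      simp only [PowerSeries.coeff_succ_X_mul]
      simp only [PowerSeries.coeff_mul, PowerSeries.coeff_mk, actCoeff, sbr,
        Finset.sum_sub_distrib, ← Finset.smul_sum]
      -- The reversed product v u lists its coefficients in the opposite order; reindexing pairs
      -- them with those of u v.
      rw [← Finset.Nat.sum_antidiagonal_swap (f := fun x => v (κ' x.1 * g) * u (κ x.2 * f))]
      simp only [Prod.fst_swap, Prod.snd_swap]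
      module
  have := key.coeff_eq hr (fun j hj => by rw [hcoeff, h0 j hj])
  rw [hcoeff, PowerSeries.coeff_mk] at this
  exact this

/-- First-order recurrences are solved by powers of `τ`. -/
theorem linActs_of_recurrence {ħ c : R} {M : ℕ} {h : ℕ → A} {u : R[X] →ₗ[R] A} {τ : R[X]}
    (h0 : ∀ f, innerDer R A (h 0) (u f) = c • u f)
    (hs : ∀ r f, r + 1 < M → innerDer R A (h (r + 1)) (u f)
      = innerDer R A (h r) (u (τ * f)) + (c * ħ) • (u f * h r)) :
    LinActs ħ M h u (fun r => c • τ ^ r) := by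
  have key : ∀ r f, r + 1 < M → innerDer R A (h (r + 1)) (u f) = u (c • τ ^ (r + 1) * f)
      + ħ • ∑ x ∈ Finset.HasAntidiagonal.antidiagonal r, u (c • τ ^ x.1 * f) * h x.2 := by
    intro r
    induction r with
    | zero => intro f hr; simp [hs 0 f hr, h0, smul_smul, mul_comm ħ c]
    | succ r ih =>
      intro f hr
      rw [hs _ f hr, ih _ (by omega), Finset.Nat.sum_antidiagonal_succ, smul_add, ← add_assoc,
        add_right_comm]
      -- Each use of the recurrence feeds τf into the shorter convolution; its own correction term
      -- supplies the summand with exponent 0.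
      have e1 : ∀ j, τ ^ j * (τ * f) = τ ^ (j + 1) * f := fun j => by ring
      simp only [smul_mul_assoc, e1, pow_zero, one_mul, map_smul, smul_smul, mul_comm ħ c]
  intro f
  refine actsBy_of_coeff (fun _ => ?_) (fun r hr => ?_)
  · have := h0 f
    rw [innerDer_apply, sub_eq_iff_eq_add'] at this
    simpa using this
  · have := key r f hr
    rw [innerDer_apply, sub_eq_iff_eq_add'] at this
    rw [this, add_assoc]

end GroupLikeLinear

end SuperYangian

/-! ### Relations between different nodes. -/

namespace SuperYangian

open Polynomial

theorem eq_zero_of_shift₂ {R A : Type*} [CommRing R] [AddCommGroup A] [Module R A]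
    {F : R[X] → R[X] → A}
    (hadd : ∀ f f' g, F (f + f') g = F f g + F f' g) (hsmul : ∀ (t : R) f g, F (t • f) g = t • F f g)
    (hadd' : ∀ f g g', F f (g + g') = F f g + F f g') (hsmul' : ∀ (t : R) f g, F f (t • g) = t • F f g)
    (h1 : F 1 1 = 0) (hX : ∀ f g, F f g = 0 → F (X * f) g = 0)
    (hX' : ∀ f g, F f g = 0 → F f (X * g) = 0) (f g : R[X]) : F f g = 0 :=
  eq_zero_of_shift (F := fun f => F f g) (fun f f' => hadd f f' g) (fun t f => hsmul t f g)
    (eq_zero_of_shift (F := fun g => F 1 g) (hadd' 1) (fun t g => hsmul' t 1 g) h1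
      (fun g hg => hX' 1 g hg) g) (fun f hf => hX f g hf) f

section

variable {R A : Type*} [CommRing R] [Ring A] [Algebra R A]

/-- The bracket with `x y - ε y x` of an element `z` that supercommutes with `y`. -/
theorem bracket_of_commute {ε s : R} (hs : s = 1 ∨ s = -1) {x y z : A}
    (hyz : y * z = s • (z * y)) :
    (x * y - ε • (y * x)) * z - z * (x * y - ε • (y * x))
      = s • ((x * z - s • (z * x)) * y) - ε • (y * (x * z - s • (z * x))) := by
  have h1 : x * (y * z) = s • (x * (z * y)) := by rw [hyz, mul_smul_comm]
  have h2 : y * (z * x) = s • (z * (y * x)) := by rw [← mul_assoc, hyz, smul_mul_assoc, mul_assoc]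
  rcases hs with rfl | rfl <;>
    simp only [mul_sub, sub_mul, smul_mul_assoc, mul_smul_comm, mul_assoc, h1, h2] <;> module

theorem anti_of_commute {ε s : R} (hs : s = 1 ∨ s = -1) {x y z : A}
    (hyz : y * z = s • (z * y)) :
    (x * y - ε • (y * x)) * z + z * (x * y - ε • (y * x))
      = s • ((x * z + s • (z * x)) * y) - ε • (y * (x * z + s • (z * x))) := by
  have h1 : x * (y * z) = s • (x * (z * y)) := by rw [hyz, mul_smul_comm]
  have h2 : y * (z * x) = s • (z * (y * x)) := by rw [← mul_assoc, hyz, smul_mul_assoc, mul_assoc]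
  rcases hs with rfl | rfl <;>
    simp only [mul_add, add_mul, mul_sub, sub_mul, smul_mul_assoc, mul_smul_comm, mul_assoc, h1,
      h2] <;> module

/-- Take x, x' = x_{i,r}, x_{i,r+1}, z, z' = x_{j,s}, x_{j,s+1} and y an opposite generator at i.
Bracketing the x–x relation with y, which supercommutes with z and z', turns each x_i into a Cartan
element. -/
theorem hshift_of_shift {ε s t : R} (hs : s = 1 ∨ s = -1) {x x' y z z' : A}
    (hyz : y * z = s • (z * y)) (hyz' : y * z' = s • (z' * y))
    (hB : (x' * z - s • (z * x')) - (x * z' - s • (z' * x)) = t • (x * z + s • (z * x))) :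
    ((x' * y - ε • (y * x')) * z - z * (x' * y - ε • (y * x')))
      - ((x * y - ε • (y * x)) * z' - z' * (x * y - ε • (y * x)))
      = t • ((x * y - ε • (y * x)) * z + z * (x * y - ε • (y * x))) := by
  rw [bracket_of_commute hs hyz, bracket_of_commute hs hyz', anti_of_commute hs hyz]
  have e1 := congrArg (fun w => s • (w * y) - ε • (y * w)) hB
  simp only [sub_mul, mul_sub, smul_mul_assoc, mul_smul_comm] at e1 ⊢
  linear_combination (norm := module) e1

end

namespace MinData

variable {R A : Type*} [CommRing R] [Ring A] [Algebra R A] {N : ℕ} (S : MinData R A N)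

theorem sgn_smul_cancel {e : ℤˣ} {a b : A} (h : sgn R e • a = b) : a = sgn R e • b := by
  rw [← h, smul_smul, sgn_mul_self, one_smul]

theorem x_pos_x_neg_of_ne {i j : Fin N} (hij : i ≠ j) (f g : R[X]) :
    sbr R (S.p i) (S.p j) (S.x 1 i f) (S.x (-1) j g) = 0 := by
  refine eq_zero_of_shift₂ (F := fun f g => sbr R (S.p i) (S.p j) (S.x 1 i f) (S.x (-1) j g))
    (by intros; simp [sbr_add_left]) (by intros; simp [sbr_smul_left])
    (by intros; simp [sbr_add_right]) (by intros; simp [sbr_smul_right]) ?_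
    (fun f g h => ?_) (fun f g h => ?_) f g
  · simp [S.x_x, hij]
  · have := congrArg (innerDer R A (S.T i)) h
    simpa [innerDer_sbr, innerDer_T_x, S.innerDer_T_x_of_ne _ hij] using this
  · have := congrArg (innerDer R A (S.T j)) h
    simpa [innerDer_sbr, innerDer_T_x, S.innerDer_T_x_of_ne _ hij.symm, sbr_smul_right] using this

/-- The difference of the two sides of the relation between `x^±_{i,r}` and `x^±_{j,s}`. -/
noncomputable def shiftRel (e : ℤˣ) (i j : Fin N) (f g : R[X]) : A :=
  sbr R (S.p i) (S.p j) (S.x e i (X * f)) (S.x e j g)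
    - sbr R (S.p i) (S.p j) (S.x e i f) (S.x e j (X * g))
    - (S.k e i j * S.η) • (S.x e i f * S.x e j g
      + superSign R (S.p i) (S.p j) • (S.x e j g * S.x e i f))

theorem innerDer_shiftRel (e : ℤˣ) (i j : Fin N) (u : A) (q q' : R[X])
    (hf : ∀ f, innerDer R A u (S.x e i f) = S.x e i (q * f))
    (hg : ∀ g, innerDer R A u (S.x e j g) = S.x e j (q' * g)) (f g : R[X]) :
    innerDer R A u (S.shiftRel e i j f g)
      = S.shiftRel e i j (q * f) g + S.shiftRel e i j f (q' * g) := by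
  simp only [shiftRel, map_sub, map_add, map_smul, innerDer_sbr, innerDer_mul, hf, hg,
    mul_left_comm q, mul_left_comm q']
  module

theorem shiftRel_add_left (e : ℤˣ) (i j : Fin N) (f f' g : R[X]) :
    S.shiftRel e i j (f + f') g = S.shiftRel e i j f g + S.shiftRel e i j f' g := by
  simp only [shiftRel, map_add, mul_add, sbr_add_left, add_mul, smul_add]; abel

theorem shiftRel_add_right (e : ℤˣ) (i j : Fin N) (f g g' : R[X]) :
    S.shiftRel e i j f (g + g') = S.shiftRel e i j f g + S.shiftRel e i j f g' := by
  simp only [shiftRel, map_add, mul_add, sbr_add_right, add_mul, smul_add]; abel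

theorem shiftRel_smul_left (e : ℤˣ) (i j : Fin N) (t : R) (f g : R[X]) :
    S.shiftRel e i j (t • f) g = t • S.shiftRel e i j f g := by
  simp only [shiftRel, map_smul, mul_smul_comm, sbr_smul_left, smul_mul_assoc]; module

theorem shiftRel_smul_right (e : ℤˣ) (i j : Fin N) (t : R) (f g : R[X]) :
    S.shiftRel e i j f (t • g) = t • S.shiftRel e i j f g := by
  simp only [shiftRel, map_smul, mul_smul_comm, sbr_smul_right, smul_mul_assoc]; module

theorem shiftRel_zero_left (e : ℤˣ) (i j : Fin N) (g : R[X]) : S.shiftRel e i j 0 g = 0 := by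
  simp [shiftRel]

theorem shiftRel_zero_right (e : ℤˣ) (i j : Fin N) (f : R[X]) : S.shiftRel e i j f 0 = 0 := by
  simp [shiftRel]

theorem shiftRel_one_one (e : ℤˣ) {i j : Fin N} (hij : i ≠ j ∨ S.p i = 0) :
    S.shiftRel e i j 1 1 = 0 := by
  simp [shiftRel, x_X, S.x_shift e i j hij, k]

/-- ad T_i moves only the first argument and ad T_j only the second, so the minimalistic relation at
(1,1) reaches every pair. -/
theorem shiftRel_of_ne (e : ℤˣ) {i j : Fin N} (hij : i ≠ j) (f g : R[X]) :
    S.shiftRel e i j f g = 0 := by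
  refine eq_zero_of_shift₂ (F := S.shiftRel e i j) (S.shiftRel_add_left e i j)
    (S.shiftRel_smul_left e i j) (S.shiftRel_add_right e i j) (S.shiftRel_smul_right e i j)
    (S.shiftRel_one_one e (.inl hij)) (fun f g h => ?_) (fun f g h => ?_) f g
  · have := S.innerDer_shiftRel e i j (S.T i) (sgn R e • X) 0
      (by simp [innerDer_T_x]) (by simp [S.innerDer_T_x_of_ne _ hij]) f g
    rw [h, map_zero, zero_mul, smul_mul_assoc, shiftRel_smul_left,
      shiftRel_zero_right, add_zero] at this
    rw [sgn_smul_cancel this.symm, smul_zero]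
  · have := S.innerDer_shiftRel e i j (S.T j) 0 (sgn R e • X)
      (by simp [S.innerDer_T_x_of_ne _ hij.symm]) (by simp [innerDer_T_x]) f g
    rw [h, map_zero, zero_mul, smul_mul_assoc, shiftRel_smul_right,
      shiftRel_zero_left, zero_add] at this
    rw [sgn_smul_cancel this.symm, smul_zero]

theorem x_x_of_ne (e : ℤˣ) {i j : Fin N} (hij : i ≠ j) (hc : S.c i j = 0) (f g : R[X]) :
    sbr R (S.p i) (S.p j) (S.x e i f) (S.x e j g) = 0 := by
  refine eq_zero_of_shift₂ (F := fun f g => sbr R (S.p i) (S.p j) (S.x e i f) (S.x e j g))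
    (by intros; simp [sbr_add_left]) (by intros; simp [sbr_smul_left])
    (by intros; simp [sbr_add_right]) (by intros; simp [sbr_smul_right]) ?_
    (fun f g h => ?_) (fun f g h => ?_) f g
  · simp [S.x_x_zero e i j hc]
  · have := congrArg (innerDer R A (S.T i)) h
    rw [innerDer_sbr, innerDer_T_x, S.innerDer_T_x_of_ne _ hij, sbr_smul_left, sbr_zero_right,
      add_zero, map_zero] at this
    simpa using sgn_smul_cancel this
  · have := congrArg (innerDer R A (S.T j)) h
    rw [innerDer_sbr, innerDer_T_x, S.innerDer_T_x_of_ne _ hij.symm, sbr_smul_right, sbr_zero_left,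
      zero_add, map_zero] at this
    simpa using sgn_smul_cancel this

/-- The superbracket `[x^+_i(f), x^-_i(g)]`. -/
noncomputable def Y (i : Fin N) (f g : R[X]) : A :=
  sbr R (S.p i) (S.p i) (S.x 1 i f) (S.x (-1) i g)

/-- The element `h_{i,r} = [x^+_{i,r}, x^-_{i,0}]`. -/
noncomputable def h (i : Fin N) (r : ℕ) : A := S.Y i (X ^ r) 1

/-- The element `[x^+_{i,0}, x^-_{i,r}]`. -/
noncomputable def h' (i : Fin N) (r : ℕ) : A := S.Y i 1 (X ^ r)

theorem h_zero (i : Fin N) : S.h i 0 = S.h₀ i := by simp [h, Y, S.x_x]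

theorem h_one (i : Fin N) : S.h i 1 = S.h₁ i := by simp [h, Y, x_X, S.x₁_x]

theorem h'_one (i : Fin N) : S.h' i 1 = S.h₁ i := by simp [h', Y, x_X, S.x_x₁]

theorem innerDer_T_Y (i : Fin N) (f g : R[X]) :
    innerDer R A (S.T i) (S.Y i f g) = S.Y i (X * f) g - S.Y i f (X * g) := by
  simp [Y, innerDer_sbr, innerDer_T_x, sub_eq_add_neg]

theorem innerDer_T_Y_of_ne {i j : Fin N} (hij : i ≠ j) (f g : R[X]) :
    innerDer R A (S.T i) (S.Y j f g) = 0 := by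
  simp [Y, innerDer_sbr, S.innerDer_T_x_of_ne _ hij]

theorem innerDer_h₀_Y (i j : Fin N) (f g : R[X]) :
    innerDer R A (S.h₀ i) (S.Y j f g) = 0 := by
  simp [Y, innerDer_sbr, innerDer_h₀_x, sbr_smul_right, sbr_smul_left, k]

theorem innerDer_g_Y (i j : Fin N) (f g : R[X]) :
    innerDer R A (S.g i) (S.Y j f g) = (S.c i j : R) • innerDer R A (S.T j) (S.Y j f g) := by
  simp [Y, innerDer_sbr, innerDer_g_x, innerDer_T_x, sbr_smul_right, sbr_smul_left, k]

/-- The bracket has weight zero, so h₀ and h₀² commute with it; h₁ therefore acts as h̃₁, which is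
c_{ij} times ad T_j there. -/
theorem innerDer_h₁_Y (i j : Fin N) (f g : R[X]) :
    innerDer R A (S.h₁ i) (S.Y j f g) = (S.c i j : R) • innerDer R A (S.T j) (S.Y j f g) := by
  have h0 := S.innerDer_h₀_Y i j f g
  rw [← innerDer_g_Y, MinData.g]
  simp only [innerDer_apply, sub_mul, mul_sub, smul_mul_assoc, mul_smul_comm] at h0 ⊢
  rw [sub_eq_zero] at h0
  rw [mul_assoc (S.h₀ i), h0, ← mul_assoc, h0, mul_assoc]
  abel

theorem h_shift_pos {i j : Fin N} (hij : i ≠ j) (r : ℕ) (f : R[X]) :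
    innerDer R A (S.h i (r + 1)) (S.x 1 j f) - innerDer R A (S.h i r) (S.x 1 j (X * f))
      = (S.k 1 i j * S.η) • (S.h i r * S.x 1 j f + S.x 1 j f * S.h i r) := by
  have hy : ∀ f, S.x (-1) i 1 * S.x 1 j f
      = superSign R (S.p i) (S.p j) • (S.x 1 j f * S.x (-1) i 1) := fun f => by
    have := S.x_pos_x_neg_of_ne hij.symm f 1
    rw [sbr, sub_eq_zero] at this
    rw [this, superSign_comm (S.p j), smul_smul, superSign_mul_self, one_smul]
  have key := S.shiftRel_of_ne 1 hij (X ^ r) f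
  rw [shiftRel, sub_eq_zero, ← pow_succ'] at key
  exact hshift_of_shift (superSign_cases _ _) (hy _) (hy _) key

/-- On negative generators the bracketing argument produces [x^+_{i,0}, x^-_{i,r}], not h_{i,r}.
Until the two are identified, this is the rule for negative generators. -/
theorem h'_shift_neg {i j : Fin N} (hij : i ≠ j) (r : ℕ) (f : R[X]) :
    innerDer R A (S.h' i (r + 1)) (S.x (-1) j f) - innerDer R A (S.h' i r) (S.x (-1) j (X * f))
      = (S.k (-1) i j * S.η) • (S.h' i r * S.x (-1) j f + S.x (-1) j f * S.h' i r) := by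
  have hy : ∀ f, S.x 1 i 1 * S.x (-1) j f
      = superSign R (S.p i) (S.p j) • (S.x (-1) j f * S.x 1 i 1) := fun f => by
    have := S.x_pos_x_neg_of_ne hij 1 f
    rwa [sbr, sub_eq_zero] at this
  have key := S.shiftRel_of_ne (-1) hij (X ^ r) f
  rw [shiftRel, sub_eq_zero, ← pow_succ'] at key
  have := hshift_of_shift (ε := superSign R (S.p i) (S.p i)) (superSign_cases _ _) (hy f)
    (hy (X * f)) key
  have hh : ∀ r, S.h' i r = -(superSign R (S.p i) (S.p i) • (S.x (-1) i (X ^ r) * S.x 1 i 1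
      - superSign R (S.p i) (S.p i) • (S.x 1 i 1 * S.x (-1) i (X ^ r)))) := fun r => by
    rw [h', Y, sbr_swap]; rfl
  simp only [hh, innerDer_apply, neg_mul, mul_neg, smul_mul_assoc, mul_smul_comm]
  linear_combination (norm := module) -superSign R (S.p i) (S.p i) • this

end MinData

end SuperYangian

/-! ### Why the bracket of x^+_{i,a} and x^-_{i,b} depends only on a + b. -/

namespace SuperYangian

open Polynomial

section

variable {R A : Type*} [CommRing R] [Ring A] [Algebra R A]

/-- The factors (1-(X-cη)z)/(1-(X+cη)z) on u and (1-(X+cη)z)/(1-(X-cη)z) on v would cancel if X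
could be moved between the arguments of the bracket. The last summand measures the failure. -/
theorem actCoeff_succ_pow (c η : R) (p q : ZMod 2) (u v : R[X] →ₗ[R] A) (f g : R[X]) (r : ℕ) :
    actCoeff (2 * η) p q u v (fun r => c • (X + C (c * η)) ^ r)
        (fun r => (-c) • (X + C (-c * η)) ^ r) f g (r + 1)
      = actCoeff (2 * η) p q u v (fun r => c • (X + C (c * η)) ^ r)
        (fun r => (-c) • (X + C (-c * η)) ^ r) ((X + C (c * η)) * f) g r
      + c • (sbr R p q (u (X * f)) (v ((X + C (-c * η)) ^ r * g))
        - sbr R p q (u f) (v (X * ((X + C (-c * η)) ^ r * g)))) := by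
  set τ : R[X] := X + C (c * η) with hτ
  set θ : R[X] := X + C (-c * η) with hθ
  have hτX : ∀ f, u (τ * f) = u (X * f) + (c * η) • u f := fun f => by
    rw [hτ, add_mul, map_add, ← smul_eq_C_mul, map_smul]
  have hθX : ∀ f, v (θ * f) = v (X * f) + (-c * η) • v f := fun f => by
    rw [hθ, add_mul, map_add, ← smul_eq_C_mul, map_smul]
  have e1 : ∀ j, τ ^ (j + 1) * f = τ ^ j * (τ * f) := fun j => by ring
  have e2 : ∀ j, θ ^ (j + 1) * g = θ * (θ ^ j * g) := fun j => by ring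
  cases r with
  | zero =>
    simp only [actCoeff, Finset.Nat.antidiagonal_zero, Finset.sum_singleton, pow_zero, smul_mul_assoc,
      map_smul, sbr_smul_left, sbr_smul_right, e1, e2, one_mul]
    simp only [hτX, hθX, sbr_add_left, sbr_add_right, sbr_smul_left, sbr_smul_right]
    module
  | succ r =>
    simp only [actCoeff, Finset.Nat.sum_antidiagonal_succ, smul_mul_assoc, map_smul, sbr_smul_left,
      sbr_smul_right, e1 (r + 1), e1, e2 (r + 1), pow_zero, one_mul]
    rw [hθX, hτX f]
    simp only [sbr_add_left, sbr_add_right, sbr_smul_left, sbr_smul_right]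
    module

/-- Iterating the recurrence collects r defects, each equal to d and weighted by c. With d = 0 it
shows that the action is trivial. -/
theorem actCoeff_pow (c η : R) (p q : ZMod 2) (u v : R[X] →ₗ[R] A) (g : R[X]) (d : A) (r : ℕ) :
    ∀ f : R[X], (∀ j t, j + t + 1 = r →
      sbr R p q (u (X * ((X + C (c * η)) ^ j * f))) (v ((X + C (-c * η)) ^ t * g))
        - sbr R p q (u ((X + C (c * η)) ^ j * f)) (v (X * ((X + C (-c * η)) ^ t * g))) = d) →
    actCoeff (2 * η) p q u v (fun r => c • (X + C (c * η)) ^ r)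
        (fun r => (-c) • (X + C (-c * η)) ^ r) f g r = (c * r) • d := by
  induction r with
  | zero => intro f _; simp [actCoeff, sbr_smul_left, sbr_smul_right]
  | succ r ih =>
    intro f hd
    rw [actCoeff_succ_pow, ih]
    · have := hd 0 r (by omega)
      rw [pow_zero, one_mul] at this
      rw [this]
      push_cast
      module
    · intro j t hjt
      have := hd (j + 1) t (by omega)
      rw [pow_succ, mul_assoc] at this
      exact this

end

namespace MinData

variable {R A : Type*} [CommRing R] [Ring A] [Algebra R A] {N : ℕ} (S : MinData R A N)

/-- `[x^+_{i,a}, x^-_{i,b}]` depends only on `a + b ≤ n`. -/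
def LevelUpTo (n : ℕ) : Prop := ∀ i a b, a + b ≤ n → S.Y i (X ^ a) (X ^ b) = S.h i (a + b)

theorem innerDer_h_zero_x (e : ℤˣ) (i j : Fin N) (f : R[X]) :
    innerDer R A (S.h i 0) (S.x e j f) = S.k e i j • S.x e j f := by
  rw [h_zero, innerDer_h₀_x]

/-- The action of the `h_{i,r}` on `x^±_j` through the powers of `X + c η`. -/
def ActsOn (M : ℕ) (e : ℤˣ) (i j : Fin N) : Prop :=
  LinActs (2 * S.η) M (S.h i) (S.x e j)
    (fun r => S.k e i j • (X + C (S.k e i j * S.η)) ^ r)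

theorem actsOn_of_shift {M : ℕ} {e : ℤˣ} {i j : Fin N} (hs : ∀ r f, r + 1 < M →
    innerDer R A (S.h i (r + 1)) (S.x e j f) - innerDer R A (S.h i r) (S.x e j (X * f))
      = (S.k e i j * S.η) • (S.h i r * S.x e j f + S.x e j f * S.h i r)) : S.ActsOn M e i j := by
  refine linActs_of_recurrence (S.innerDer_h_zero_x e i j) (fun r f hr => ?_)
  have := hs r f hr
  rw [sub_eq_iff_eq_add] at this
  rw [this, add_mul, map_add, ← smul_eq_C_mul, map_smul, map_add, map_smul, innerDer_apply,
    innerDer_apply]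
  module

theorem actsOn_pos_of_ne {i j : Fin N} (hij : i ≠ j) (M : ℕ) : S.ActsOn M 1 i j :=
  S.actsOn_of_shift fun r f _ => S.h_shift_pos hij r f

variable {S}

theorem LevelUpTo.mono {n n' : ℕ} (h : S.LevelUpTo n) (hn : n' ≤ n) : S.LevelUpTo n' :=
  fun i a b hab => h i a b (hab.trans hn)

theorem LevelUpTo.h'_eq {n : ℕ} (h : S.LevelUpTo n) (i : Fin N) {r : ℕ} (hr : r ≤ n) :
    S.h' i r = S.h i r := by
  have := h i 0 r (by omega)
  rwa [pow_zero, zero_add] at this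

theorem LevelUpTo.actsOn_neg_of_ne {n : ℕ} (h : S.LevelUpTo n) {i j : Fin N} (hij : i ≠ j) :
    S.ActsOn (n + 1) (-1) i j := S.actsOn_of_shift fun r f hr => by
  rw [← h.h'_eq i (by omega), ← h.h'_eq i (by omega)]
  exact S.h'_shift_neg hij r f

theorem LevelUpTo.innerDer_T_h {n : ℕ} (h : S.LevelUpTo (n + 1)) (i : Fin N) {a b : ℕ}
    (hab : a + b ≤ n) : innerDer R A (S.T i) (S.Y i (X ^ a) (X ^ b)) = 0 := by
  rw [innerDer_T_Y, ← pow_succ', ← pow_succ', h i _ _ (by omega), h i _ _ (by omega),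
    show a + 1 + b = a + (b + 1) by ring, sub_self]

/-- Bilinear expressions in polynomials of bounded degree are determined by leading terms. -/
theorem bilin_eq_of_degree {R A : Type*} [CommRing R] [AddCommGroup A] [Module R A]
    (B : R[X] →ₗ[R] R[X] →ₗ[R] A) {n : ℕ} {d : A} (h0 : ∀ a b, a + b ≤ n → B (X ^ a) (X ^ b) = 0)
    (hd : ∀ a b, a + b = n + 1 → B (X ^ a) (X ^ b) = d) {f g : R[X]} (hf : f.Monic) (hg : g.Monic)
    (hfg : f.natDegree + g.natDegree = n + 1) : B f g = d := by
  have expand : B f g = ∑ i ∈ Finset.range (f.natDegree + 1), ∑ j ∈ Finset.range (g.natDegree + 1),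
      (f.coeff i * g.coeff j) • B (X ^ i) (X ^ j) := by
    conv_lhs => rw [f.as_sum_range_C_mul_X_pow, g.as_sum_range_C_mul_X_pow]
    simp only [← smul_eq_C_mul, map_sum, map_smul, LinearMap.sum_apply, LinearMap.smul_apply,
      smul_smul, Finset.smul_sum]
    rw [Finset.sum_comm]
    simp only [mul_comm]
  rw [expand, Finset.sum_eq_single_of_mem f.natDegree (by simp), Finset.sum_eq_single_of_mem
    g.natDegree (by simp), hd _ _ hfg, hf.coeff_natDegree, hg.coeff_natDegree, one_mul, one_smul]
  · intro j hj hne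
    rw [h0 _ _ (by have := Finset.mem_range.mp hj; omega), smul_zero]
  · intro i hi hne
    refine Finset.sum_eq_zero fun j hj => ?_
    rw [h0 _ _ (by have := Finset.mem_range.mp hj; have := Finset.mem_range.mp hi; omega), smul_zero]

variable (S) in
/-- The commutators `[T_i, [x^+_i(f), x^-_i(g)]]` as a bilinear map. -/
noncomputable def bilinTY (i : Fin N) : R[X] →ₗ[R] R[X] →ₗ[R] A :=
  LinearMap.mk₂ R (fun f g => innerDer R A (S.T i) (S.Y i f g))
    (by intros; simp [Y, sbr_add_left]) (by intros; simp [Y, sbr_smul_left])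
    (by intros; simp [Y, sbr_add_right]) (by intros; simp [Y, sbr_smul_right])

/-- Two evaluations of the commutator of h_{l,n+1} with h_{i,1} = [x^+_{i,1}, x^-_{i,0}]. Acting on
the bracket, h_{l,n+1} collects n+1 equal defects [T_i, h_{i,n+1}]; acting from the other side,
h_{i,1} is c_{il} ad T_l. -/
theorem LevelUpTo.innerDer_T_h_symm [Nontrivial R] {n : ℕ} (h : S.LevelUpTo (n + 1)) {i l : Fin N}
    (hil : i ≠ l) (hc : S.c i l ≠ 0) :
    innerDer R A (S.T l) (S.h l (n + 1))
      = -(((n + 1 : ℤ) : R) • innerDer R A (S.T i) (S.h i (n + 1))) := by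
  set d := innerDer R A (S.T i) (S.h i (n + 1)) with hd
  have hl0 : ∀ a b, a + b ≤ n → S.bilinTY i (X ^ a) (X ^ b) = 0 := fun a b hab =>
    h.innerDer_T_h i hab
  have hld : ∀ a b, a + b = n + 1 → S.bilinTY i (X ^ a) (X ^ b) = d := fun a b hab => by
    rw [hd, ← hab, ← h i a b (by omega)]; rfl
  have hmon : ∀ (a : R) (j : ℕ), ((X + C a) ^ j : R[X]).Monic := fun a j => (monic_X_add_C a).pow j
  have hdeg : ∀ (a b : R) (j t : ℕ), (((X + C a) ^ j * X : R[X])).natDegree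
      + (((X + C b) ^ t * 1 : R[X])).natDegree = j + t + 1 := fun a b j t => by
    rw [(hmon a j).natDegree_mul monic_X, mul_one, natDegree_pow_X_add_C, natDegree_pow_X_add_C,
      natDegree_X]
    ring
  have key : innerDer R A (S.h l (n + 1)) (S.Y i X 1) = (S.k 1 l i * ((n + 1 : ℕ) : R)) • d := by
    have hneg : S.k (-1) l i = -S.k 1 l i := by simp [k_eq]
    have hact := h.actsOn_neg_of_ne hil.symm
    rw [ActsOn, hneg] at hact
    refine ((S.actsOn_pos_of_ne hil.symm (n + 2)).sbr_comm hact (S.p i) (S.p i) X 1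
      (r := n + 1) (by omega) ?_).trans (actCoeff_pow _ _ _ _ _ _ _ d _ X ?_)
    -- Below the top order the defects have total degree at most n, where the known levels already
    -- kill them.
    · intro j hj
      rw [actCoeff_pow _ _ _ _ _ _ _ 0 j X, smul_zero]
      intro a t hat
      refine (S.innerDer_T_Y i _ _).symm.trans (bilin_eq_of_degree (S.bilinTY i) (n := a + t)
        (fun _ _ _ => hl0 _ _ (by omega)) (fun _ _ _ => hl0 _ _ (by omega))
        ((hmon _ _).mul monic_X) ((hmon _ _).mul monic_one) (hdeg _ _ _ _))
    -- At the top order the degrees add up to n+1. The polynomials are monic, so only the product of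
    -- leading terms contributes, with coefficient 1.
    · intro a t hat
      refine (S.innerDer_T_Y i _ _).symm.trans (bilin_eq_of_degree (S.bilinTY i) hl0 hld
        ((hmon _ _).mul monic_X) ((hmon _ _).mul monic_one) ?_)
      rw [hdeg]; omega
  have h1 : S.Y i X 1 = S.h₁ i := by simpa [MinData.h] using S.h_one i
  have h2 := S.innerDer_h₁_Y i l (X ^ (n + 1)) 1
  have h3 : innerDer R A (S.h₁ i) (S.h l (n + 1)) = -innerDer R A (S.h l (n + 1)) (S.h₁ i) := by
    simp only [innerDer_apply]; abel
  rw [← MinData.h, h3, ← h1, key, k_eq, sgn_one, one_mul, S.c_symm] at h2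
  refine eq_of_sub_eq_zero (S.smul_cancel hc ?_)
  rw [smul_sub, ← h2]
  push_cast
  module

/-- ad T_i of a bracket in degree n is the difference of two adjacent brackets in degree n+1, so its
vanishing identifies all of them. -/
theorem LevelUpTo.succ {n : ℕ} (h : S.LevelUpTo n)
    (hT : ∀ i, innerDer R A (S.T i) (S.h i n) = 0) : S.LevelUpTo (n + 1) := by
  have step : ∀ i a b, a + b = n → S.Y i (X ^ (a + 1)) (X ^ b) = S.Y i (X ^ a) (X ^ (b + 1)) := by
    intro i a b hab
    have := S.innerDer_T_Y i (X ^ a) (X ^ b)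
    rw [h i a b hab.le, hab, hT, ← pow_succ', ← pow_succ', eq_comm, sub_eq_zero] at this
    exact this
  have top : ∀ i b a, a + b = n + 1 → S.Y i (X ^ a) (X ^ b) = S.h i (n + 1) := by
    intro i b
    induction b with
    | zero => rintro a rfl; rw [MinData.h, pow_zero]
    | succ b ih => intro a hab; rw [← step i a b (by omega), ih (a + 1) (by omega)]
  intro i a b hab
  rcases hab.lt_or_eq with hab | hab
  · exact h i a b (by omega)
  · rw [top i b a hab, hab]

variable (S) in
theorem exists_neighbour (i : Fin N) : ∃ l, i ≠ l ∧ S.c i l ≠ 0 := by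
  have h2 := S.two_le
  by_cases hi : i.val + 1 < N
  · exact ⟨⟨i.val + 1, hi⟩, fun h => by simpa using congrArg Fin.val h, S.c_succ i ⟨_, hi⟩ rfl⟩
  · refine ⟨⟨i.val - 1, by omega⟩, fun h => ?_, ?_⟩
    · have := congrArg Fin.val h
      simp only at this
      omega
    · rw [S.c_symm]
      exact S.c_succ _ i (by simp only; omega)

variable (S) in
theorem levelUpTo [Nontrivial R] (n : ℕ) : S.LevelUpTo n := by
  have h1 : S.LevelUpTo 1 := by
    intro i a b hab
    have : (a = 0 ∧ b = 0) ∨ (a = 1 ∧ b = 0) ∨ (a = 0 ∧ b = 1) := by omega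
    rcases this with ⟨rfl, rfl⟩ | ⟨rfl, rfl⟩ | ⟨rfl, rfl⟩
    · rw [MinData.h, pow_zero]
    · rw [MinData.h, pow_zero]
    · have := S.h'_one i
      rw [← S.h_one] at this
      simpa [h'] using this
  have h2 : S.LevelUpTo 2 := h1.succ fun i => by
    rw [h_one, innerDer_apply, S.T_h₁, sub_self]
  have : ∀ n, S.LevelUpTo (n + 2) := fun n => by
    induction n with
    | zero => exact h2
    | succ n ih =>
      refine ih.succ fun i => ?_
      obtain ⟨l, hil, hc⟩ := S.exists_neighbour i
      have e1 := LevelUpTo.innerDer_T_h_symm (n := n + 1) ih hil hc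
      have e2 := LevelUpTo.innerDer_T_h_symm (n := n + 1) ih hil.symm (S.c_symm i l ▸ hc)
      rw [e1] at e2
      -- Applying the symmetry twice between neighbours gives D = (n+2)² D, and (n+2)² - 1 =
      -- (n+1)(n+3). In degree one this factor would be 0, hence the separate start at level 2.
      refine S.smul_cancel (n := (n + 1) * (n + 3)) (by positivity) ?_
      have := sub_eq_zero.mpr e2
      rw [← neg_eq_zero, ← this]
      push_cast
      module
  exact (this n).mono (by omega)

variable (S) in
theorem Y_X_pow [Nontrivial R] (i : Fin N) (a b : ℕ) :
    S.Y i (X ^ a) (X ^ b) = S.h i (a + b) := S.levelUpTo (a + b) i a b le_rfl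

end MinData

end SuperYangian

/-! ### Power-sum shifts and the relations with a repeated node. -/

namespace SuperYangian

open Polynomial

section

variable {R A : Type*} [CommRing R] [Ring A] [Algebra R A]

theorem mul_eq_of_innerDer {u z w : A} (h : innerDer R A u z = w) : u * z = z * u + w := by
  rw [← h, innerDer_apply]; abel

theorem mul_mul_eq {a b c : A} (h : a * b = c) (w : A) : a * (b * w) = c * w := by
  rw [← mul_assoc, h]

/-- A combination of `h₂` and lower terms which shifts by two. -/
theorem innerDer_second {t η : R} {h0 h1 h2 u0 u1 u2 : A}
    (a0 : innerDer R A h0 u0 = t • u0) (a1 : innerDer R A h0 u1 = t • u1)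
    (b0 : innerDer R A h1 u0 = t • u1 + (t * η) • (h0 * u0 + u0 * h0))
    (b1 : innerDer R A h1 u1 = t • u2 + (t * η) • (h0 * u1 + u1 * h0))
    (c0 : innerDer R A h2 u0 = innerDer R A h1 u1 + (t * η) • (h1 * u0 + u0 * h1)) :
    innerDer R A ((3 : R) • h2 - (6 * η) • (h0 * h1) + (4 * η ^ 2) • (h0 * (h0 * h0))) u0
      = (3 * t) • u2 + (t * (t * η) ^ 2) • u0 := by
  rw [b1] at c0
  replace a0 := mul_eq_of_innerDer a0
  replace a1 := mul_eq_of_innerDer a1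
  replace b0 := mul_eq_of_innerDer b0
  replace c0 := mul_eq_of_innerDer c0
  rw [a0] at b0
  rw [a1, b0] at c0
  have a0' := mul_mul_eq a0
  rw [innerDer_apply]
  simp only [add_mul, mul_add, sub_mul, mul_sub, smul_mul_assoc, mul_smul_comm, mul_assoc, a0, a1,
    b0, c0, a0', smul_add]
  module

/-- A combination of `h₃` and lower terms which shifts by three. -/
theorem innerDer_third {t η : R} {h0 h1 h2 h3 u0 u1 u2 u3 : A} (h01 : h1 * h0 = h0 * h1)
    (a0 : innerDer R A h0 u0 = t • u0) (a1 : innerDer R A h0 u1 = t • u1)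
    (a2 : innerDer R A h0 u2 = t • u2)
    (b0 : innerDer R A h1 u0 = t • u1 + (t * η) • (h0 * u0 + u0 * h0))
    (b1 : innerDer R A h1 u1 = t • u2 + (t * η) • (h0 * u1 + u1 * h0))
    (b2 : innerDer R A h1 u2 = t • u3 + (t * η) • (h0 * u2 + u2 * h0))
    (c0 : innerDer R A h2 u0 = innerDer R A h1 u1 + (t * η) • (h1 * u0 + u0 * h1))
    (c1 : innerDer R A h2 u1 = innerDer R A h1 u2 + (t * η) • (h1 * u1 + u1 * h1))
    (d0 : innerDer R A h3 u0 = innerDer R A h2 u1 + (t * η) • (h2 * u0 + u0 * h2)) :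
    innerDer R A ((4 : R) • h3 - (8 * η) • (h0 * h2) - (4 * η) • (h1 * h1)
      + (16 * η ^ 2) • (h0 * (h0 * h1)) - (8 * η ^ 3) • (h0 * (h0 * (h0 * h0)))) u0
      = (4 * t) • u3 + (4 * t * (t * η) ^ 2) • u1 := by
  rw [c1] at d0
  rw [b1] at c0
  rw [b2] at d0
  replace a0 := mul_eq_of_innerDer a0
  replace a1 := mul_eq_of_innerDer a1
  replace a2 := mul_eq_of_innerDer a2
  replace b0 := mul_eq_of_innerDer b0
  replace b1 := mul_eq_of_innerDer b1
  replace c0 := mul_eq_of_innerDer c0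
  replace d0 := mul_eq_of_innerDer d0
  rw [a0] at b0
  rw [a1] at b1
  rw [a1, b0] at c0
  rw [b1, a2, c0] at d0
  have a0' := mul_mul_eq a0
  have a1' := mul_mul_eq a1
  have b0' := mul_mul_eq b0
  rw [innerDer_apply]
  simp only [add_mul, mul_add, sub_mul, mul_sub, smul_mul_assoc, mul_smul_comm, mul_assoc, a0, a1,
    a2, b0, b1, c0, d0, a0', a1', b0', h01, smul_add]
  module

/-- Commuting the same-node relation with y gives two copies of the h–x relation: one for the Cartan
elements of a and x against b and d, the other with the roles exchanged. If one is known, so is the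
other. -/
theorem shift_antisymm {t : R} {a b x d y : A} (h : (a * b - b * a) - (x * d - d * x)
      = t • (x * b + b * x)) :
    (((a * y - y * a) * b - b * (a * y - y * a)) - ((x * y - y * x) * d - d * (x * y - y * x))
      - t • ((x * y - y * x) * b + b * (x * y - y * x)))
    + (((d * y - y * d) * x - x * (d * y - y * d)) - ((b * y - y * b) * a - a * (b * y - y * b))
      - t • ((b * y - y * b) * x + x * (b * y - y * b))) = 0 := by
  have h1 := congrArg (· * y) h
  have h2 := congrArg (y * ·) h
  simp only [add_mul, mul_add, sub_mul, mul_sub, smul_mul_assoc, mul_smul_comm, mul_assoc,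
    smul_add, smul_sub] at h1 h2 ⊢
  linear_combination (norm := module) h1 - h2

theorem bracket_of_anticommute {x y z : A} (hxz : x * z = -(z * x)) :
    (x * y + y * x) * z - z * (x * y + y * x)
      = -((z * y + y * z) * x - x * (z * y + y * z)) := by
  have h1 : ∀ w, x * (z * w) = -(z * (x * w)) := fun w => by
    rw [← mul_assoc, hxz, neg_mul, mul_assoc]
  simp only [add_mul, mul_add, mul_assoc, hxz, h1, mul_neg]
  abel

end

/-- The power sums p₁ and p₂ generate the symmetric polynomials once 2 is invertible. Concretely, in
degree n+2, p₁ makes K alternate along the diagonal, so K(2,n) = K(0,n+2); p₂ makes their sum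
vanish. -/
theorem eq_zero_of_symm_shift {V : Type*} [AddCommGroup V] {K : ℕ → ℕ → V}
    (h2 : ∀ a : V, a + a = 0 → a = 0)
    (hK : ∀ a b, K a b = K b a) (h0 : K 0 0 = 0)
    (h1 : ∀ a b, K a b = 0 → K (a + 1) b + K a (b + 1) = 0)
    (hs : ∀ a b, K a b = 0 → K (a + 2) b + K a (b + 2) = 0) (a b : ℕ) : K a b = 0 := by
  have main : ∀ n a b, a + b = n → K a b = 0 := by
    intro n
    induction n using Nat.strong_induction_on with
    | _ n ih =>
      have step : ∀ a b, a + b + 1 = n → K (a + 1) b = -K a (b + 1) := fun a b hab =>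
        eq_neg_of_add_eq_zero_left (h1 a b (ih _ (by omega) a b rfl))
      have zero_all : K 0 n = 0 → ∀ a b, a + b = n → K a b = 0 := by
        intro hz a
        induction a with
        | zero => intro b hb; rw [← hz, ← hb, zero_add]
        | succ a iha =>
          intro b hab
          rw [step a b (by omega), iha _ (by omega), neg_zero]
      match n, ih, step, zero_all with
      | 0, _, _, za => exact za h0
      | 1, _, st, za =>
        refine za (h2 _ ?_)
        nth_rw 1 [hK]
        rw [st 0 0 rfl, neg_add_cancel]
      | n + 2, ih, st, za =>
        refine za (h2 _ ?_)
        have e1 := hs 0 n (ih n (by omega) 0 n (by omega))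
        rwa [zero_add, st 1 n (by omega), st 0 (n + 1) (by omega), neg_neg] at e1
  exact main _ a b rfl

theorem eq_zero_of_symm_shift₃ {V : Type*} [AddCommGroup V] {K : ℕ → ℕ → ℕ → V}
    (h2 : ∀ a : V, a + a = 0 → a = 0) (h3 : ∀ a : V, a + a + a = 0 → a = 0)
    (hK : ∀ a b c, K a b c = K b a c) (hK' : ∀ a b c, K a b c = K a c b) (h0 : K 0 0 0 = 0)
    (p1 : ∀ a b c, K a b c = 0 → K (a + 1) b c + K a (b + 1) c + K a b (c + 1) = 0)
    (p2 : ∀ a b c, K a b c = 0 → K (a + 2) b c + K a (b + 2) c + K a b (c + 2) = 0)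
    (p3 : ∀ a b c, K a b c = 0 → K (a + 3) b c + K a (b + 3) c + K a b (c + 3) = 0)
    (a b c : ℕ) : K a b c = 0 := by
  have main : ∀ n a b c, a + b + c = n → K a b c = 0 := by
    intro n
    induction n using Nat.strong_induction_on with
    | _ n ih =>
      have q1 : ∀ a b c, a + b + c + 1 = n →
          K (a + 1) b c + K a (b + 1) c + K a b (c + 1) = 0 :=
        fun a b c h => p1 a b c (ih (a + b + c) (by omega) a b c rfl)
      have q2 : ∀ a b c, a + b + c + 2 = n →
          K (a + 2) b c + K a (b + 2) c + K a b (c + 2) = 0 :=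
        fun a b c h => p2 a b c (ih (a + b + c) (by omega) a b c rfl)
      -- Newton's identity 2e₂ = p₁² - p₂.
      have e2 : ∀ a b c, a + b + c + 2 = n →
          K (a + 1) (b + 1) c + K (a + 1) b (c + 1) + K a (b + 1) (c + 1) = 0 := by
        intro a b c h
        refine h2 _ ?_
        have t1 := q1 (a + 1) b c (by omega)
        have t2 := q1 a (b + 1) c (by omega)
        have t3 := q1 a b (c + 1) (by omega)
        have t := q2 a b c h
        linear_combination (norm := (simp only [add_assoc, Nat.reduceAdd]; abel)) t1 + t2 + t3 - t
      -- Newton's identity in the form 3e₃ = p₁e₂ - p₁p₂ + p₃.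
      have e3 : ∀ a b c, a + b + c + 3 = n → K (a + 1) (b + 1) (c + 1) = 0 := by
        intro a b c h
        refine h3 _ ?_
        have t1 := q2 (a + 1) b c (by omega)
        have t2 := q2 a (b + 1) c (by omega)
        have t3 := q2 a b (c + 1) (by omega)
        have s1 := e2 (a + 1) b c (by omega)
        have s2 := e2 a (b + 1) c (by omega)
        have s3 := e2 a b (c + 1) (by omega)
        have t := p3 a b c (ih (a + b + c) (by omega) a b c rfl)
        linear_combination (norm := (simp only [add_assoc, Nat.reduceAdd]; abel))
          s1 + s2 + s3 + t - t1 - t2 - t3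
      have z1 : ∀ a, a + 1 + 1 = n → K (a + 1) 1 0 = 0 := by
        intro a h
        have t := e2 a 0 0 (by omega)
        rw [zero_add, hK' (a + 1) 0 1] at t
        cases a with
        | zero => rw [hK 0, zero_add, hK' 1 0 1] at t; exact h3 _ t
        | succ a => rw [show K (a + 1) 1 1 = 0 from e3 a 0 0 (by omega), add_zero] at t; exact h2 _ t
      have z0 : ∀ a, a + 1 = n → K (a + 1) 0 0 = 0 := by
        intro a h
        have t := q1 a 0 0 (by omega)
        rw [zero_add, hK' a 0 1] at t
        cases a with
        | zero => rw [hK 0, zero_add] at t; exact h3 _ t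
        | succ a => rw [z1 a (by omega), add_zero, add_zero] at t; exact t
      have z2 : ∀ a b, a + b = n → K a b 0 = 0 := by
        intro a b h
        match a, b, h with
        | 0, 0, _ => exact h0
        | a + 1, 1, h => exact z1 a h
        | 1, b + 1, h => rw [hK]; exact z1 b (by omega)
        | a + 2, b + 2, h =>
          have t := e2 (a + 1) (b + 1) 0 (by omega)
          rw [show K (a + 1 + 1) (b + 1) (0 + 1) = 0 from e3 (a + 1) b 0 (by omega),
            show K (a + 1) (b + 1 + 1) (0 + 1) = 0 from e3 a (b + 1) 0 (by omega), add_zero,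
            add_zero] at t
          exact t
        | a + 1, 0, h => exact z0 a h
        | 0, b + 1, h => rw [hK]; exact z0 b (by omega)
      intro a b c h
      match a, b, c, h with
      | a, b, 0, h => exact z2 a b h
      | a, 0, c, h => rw [hK']; exact z2 a c h
      | 0, b, c, h => rw [hK, hK']; exact z2 b c (by omega)
      | a + 1, b + 1, c + 1, h => exact e3 a b c (by omega)
  exact main _ a b c rfl

end SuperYangian

namespace SuperYangian

open Polynomial

namespace MinData

variable {R A : Type*} [CommRing R] [Ring A] [Algebra R A] {N : ℕ} (S : MinData R A N)

/-- The relation between the `h_{i,r}` and the `x^±_{j,s}`. -/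
def HShift (e : ℤˣ) (i j : Fin N) : Prop := ∀ r f,
  innerDer R A (S.h i (r + 1)) (S.x e j f) - innerDer R A (S.h i r) (S.x e j (X * f))
    = (S.k e i j * S.η) • (S.h i r * S.x e j f + S.x e j f * S.h i r)

/-- A combination of the `h_{i,r}`, `r ≤ 2`, that acts on the `x^±_j` through a polynomial of
degree two. -/
noncomputable def G₂ (i : Fin N) : A := (3 : R) • S.h i 2 - (6 * S.η) • (S.h i 0 * S.h i 1)
  + (4 * S.η ^ 2) • (S.h i 0 * (S.h i 0 * S.h i 0))

/-- A combination of the `h_{i,r}`, `r ≤ 3`, that acts on the `x^±_j` through a polynomial of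
degree three. -/
noncomputable def G₃ (i : Fin N) : A := (4 : R) • S.h i 3 - (8 * S.η) • (S.h i 0 * S.h i 2)
  - (4 * S.η) • (S.h i 1 * S.h i 1) + (16 * S.η ^ 2) • (S.h i 0 * (S.h i 0 * S.h i 1))
  - (8 * S.η ^ 3) • (S.h i 0 * (S.h i 0 * (S.h i 0 * S.h i 0)))

theorem h_one_mul_h_zero (i j : Fin N) : S.h i 1 * S.h j 0 = S.h j 0 * S.h i 1 := by
  rw [h_one, h_zero, S.h₀_h₁]

variable {S}

theorem HShift.one {e : ℤˣ} {i j : Fin N} (hs : S.HShift e i j) (f : R[X]) :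
    innerDer R A (S.h i 1) (S.x e j f) = S.k e i j • S.x e j (X * f)
      + (S.k e i j * S.η) • (S.h i 0 * S.x e j f + S.x e j f * S.h i 0) := by
  have := hs 0 f
  rwa [sub_eq_iff_eq_add', innerDer_h_zero_x] at this

theorem HShift.succ {e : ℤˣ} {i j : Fin N} (hs : S.HShift e i j) (r : ℕ) (f : R[X]) :
    innerDer R A (S.h i (r + 1)) (S.x e j f) = innerDer R A (S.h i r) (S.x e j (X * f))
      + (S.k e i j * S.η) • (S.h i r * S.x e j f + S.x e j f * S.h i r) :=
  sub_eq_iff_eq_add'.mp (hs r f)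

/-- Formally `G₂` is 3/(2η) times the z³-coefficient of log U. With b = kη the conjugation factor
has logarithm ∑ ((X+b)^n - (X-b)^n) zⁿ/n, whose term n = 3 yields 3kX² + kb². -/
theorem HShift.innerDer_G₂ {e : ℤˣ} {i j : Fin N} (hs : S.HShift e i j) (f : R[X]) :
    innerDer R A (S.G₂ i) (S.x e j f) = S.x e j
      (((3 * S.k e i j) • X ^ 2 + C (S.k e i j * (S.k e i j * S.η) ^ 2)) * f) := by
  have := innerDer_second (S.innerDer_h_zero_x e i j f) (S.innerDer_h_zero_x e i j (X * f))
    (hs.one f) (hs.one (X * f)) (hs.succ 1 f)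
  rw [G₂, this, add_mul, map_add, ← smul_eq_C_mul, smul_mul_assoc, map_smul, map_smul,
    pow_two X, mul_assoc X]

/-- Likewise `G₃` is 4/(2η) times the z⁴-coefficient of log U, and the term n = 4 yields 4kX³ +
4kb²X. -/
theorem HShift.innerDer_G₃ {e : ℤˣ} {i j : Fin N} (hs : S.HShift e i j) (f : R[X]) :
    innerDer R A (S.G₃ i) (S.x e j f) = S.x e j
      (((4 * S.k e i j) • X ^ 3 + (4 * S.k e i j * (S.k e i j * S.η) ^ 2) • X) * f) := by
  have := innerDer_third (S.h_one_mul_h_zero i i) (S.innerDer_h_zero_x e i j f)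
    (S.innerDer_h_zero_x e i j (X * f)) (S.innerDer_h_zero_x e i j (X * (X * f)))
    (hs.one f) (hs.one (X * f)) (hs.one (X * (X * f))) (hs.succ 1 f) (hs.succ 1 (X * f))
    (hs.succ 2 f)
  rw [G₃, this, add_mul, map_add, smul_mul_assoc, smul_mul_assoc, map_smul, map_smul,
    show X ^ 3 * f = X * (X * (X * f)) by ring]

variable (S)

include S in
theorem add_self_cancel {a : A} (h : a + a = 0) : a = 0 :=
  S.smul_cancel (n := 2) two_ne_zero (by push_cast; rw [two_smul, h])

/-- The case r = 0 of the h–x relation needs only the action of h̃₁, so it also holds at an odd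
non-isotropic node, where the general relation is not available. -/
theorem innerDer_h_one_x (e : ℤˣ) (i j : Fin N) (f : R[X]) :
    innerDer R A (S.h i 1) (S.x e j f) - innerDer R A (S.h i 0) (S.x e j (X * f))
      = (S.k e i j * S.η) • (S.h i 0 * S.x e j f + S.x e j f * S.h i 0) := by
  have h0 := S.innerDer_h₀_x e i j f
  have h1 := S.innerDer_g_x e i j f
  rw [h_one, h_zero, S.innerDer_h₀_x e i j (X * f)]
  have h2 : innerDer R A (S.h₁ i) (S.x e j f) = innerDer R A (S.g i) (S.x e j f)
      + S.η • (S.h₀ i * innerDer R A (S.h₀ i) (S.x e j f)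
        + innerDer R A (S.h₀ i) (S.x e j f) * S.h₀ i) := by
    simp only [innerDer_apply, g, sub_mul, mul_sub, smul_mul_assoc, mul_smul_comm, mul_assoc]
    module
  rw [h2, h1, h0]
  simp only [mul_smul_comm, smul_mul_assoc]
  module

section

variable [Nontrivial R]

theorem hShift_of_ne (e : ℤˣ) {i j : Fin N} (hij : i ≠ j) : S.HShift e i j := by
  rcases Int.units_eq_one_or e with rfl | rfl
  · exact S.h_shift_pos hij
  · intro r f
    have := S.levelUpTo (r + 1)
    rw [← this.h'_eq i (by omega), ← this.h'_eq i (by omega)]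
    exact S.h'_shift_neg hij r f

theorem innerDer_T_h (i j : Fin N) (r : ℕ) : innerDer R A (S.T i) (S.h j r) = 0 := by
  by_cases hij : i = j
  · subst hij
    exact (S.levelUpTo (r + 1)).innerDer_T_h i (b := 0) (by omega)
  · exact S.innerDer_T_Y_of_ne hij _ _

theorem Y_eq (i : Fin N) (f g : R[X]) : S.Y i f g = S.Y i (f * g) 1 := by
  induction f using Polynomial.induction_on' with
  | add f f' hf hf' => rw [add_mul]; simp only [Y, map_add, sbr_add_left] at *; rw [hf, hf']
  | monomial a t =>
    induction g using Polynomial.induction_on' with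
    | add g g' hg hg' =>
      rw [mul_add]; simp only [Y, map_add, sbr_add_left, sbr_add_right] at *; rw [hg, hg']
    | monomial b s =>
      have := S.Y_X_pow i a b
      rw [h, pow_add] at this
      rw [← C_mul_X_pow_eq_monomial, ← C_mul_X_pow_eq_monomial, ← smul_eq_C_mul, ← smul_eq_C_mul,
        smul_mul_smul_comm]
      simp only [Y, map_smul, sbr_smul_left, sbr_smul_right] at this ⊢
      rw [this, smul_smul, mul_comm]

/-- Two operators that shift a symmetric bilinear expression in the `x^±_i` by power sums. -/
theorem symm_bilin_eq_zero (e : ℤˣ) (i : Fin N) (F : R[X] → R[X] → A)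
    (hadd : ∀ f f' g, F (f + f') g = F f g + F f' g) (hsmul : ∀ (t : R) f g, F (t • f) g = t • F f g)
    (hsymm : ∀ f g, F f g = F g f) (h1 : F 1 1 = 0)
    (hD : ∀ u q, (∀ f, innerDer R A u (S.x e i f) = S.x e i (q * f)) →
      ∀ f g, innerDer R A u (F f g) = F (q * f) g + F f (q * g)) (f g : R[X]) : F f g = 0 := by
  have hadd' : ∀ f g g', F f (g + g') = F f g + F f g' := fun f g g' => by
    rw [hsymm, hadd, hsymm g, hsymm g']
  have hsmul' : ∀ (t : R) f g, F f (t • g) = t • F f g := fun t f g => by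
    rw [hsymm, hsmul, hsymm g]
  have hpow : ∀ a b, F (X ^ a) (X ^ b) = 0 := by
    obtain ⟨l, hil, hc⟩ := S.exists_neighbour i
    refine eq_zero_of_symm_shift (fun a => S.add_self_cancel) (fun a b => hsymm _ _)
      (by simpa using h1) (fun a b hab => ?_) (fun a b hab => ?_)
    · have := hD (S.T i) (sgn R e • X) (by simp [innerDer_T_x]) (X ^ a) (X ^ b)
      rw [hab, map_zero, smul_mul_assoc, smul_mul_assoc, hsmul, hsmul', ← smul_add, ← pow_succ',
        ← pow_succ'] at this
      simpa using sgn_smul_cancel this.symm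
    -- Taking `G₂` at a neighbour l avoids the h–x relation at i itself, which is not yet proved.
    -- Its constant term contributes multiples of the vanishing F(X^a, X^b).
    · have := hD (S.G₂ l) _ (S.hShift_of_ne e hil.symm).innerDer_G₂ (X ^ a) (X ^ b)
      rw [hab, map_zero, add_mul, add_mul, hadd, hadd', ← smul_eq_C_mul, ← smul_eq_C_mul,
        hsmul (S.k e l i * (S.k e l i * S.η) ^ 2), hsmul' (S.k e l i * (S.k e l i * S.η) ^ 2), hab,
        smul_zero, add_zero, add_zero, smul_mul_assoc, smul_mul_assoc, hsmul, hsmul', ← smul_add,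
        ← pow_add, ← pow_add, add_comm 2 a, add_comm 2 b] at this
      refine S.smul_cancel (n := 3 * ((e : ℤ) * S.c l i)) ?_ (by rw [← this.symm]; simp [k])
      simp [S.c_symm l i, hc]
  induction f using Polynomial.induction_on' with
  | add f f' hf hf' => rw [hadd, hf, hf', add_zero]
  | monomial a t =>
    induction g using Polynomial.induction_on' with
    | add g g' hg hg' => rw [hadd', hg, hg', add_zero]
    | monomial b s =>
      rw [← C_mul_X_pow_eq_monomial, ← C_mul_X_pow_eq_monomial, ← smul_eq_C_mul, ← smul_eq_C_mul,
        hsmul, hsmul', hpow, smul_zero, smul_zero]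

theorem shiftRel_self (e : ℤˣ) {i : Fin N} (hi : S.p i = 0) (f g : R[X]) :
    S.shiftRel e i i f g = 0 := by
  refine S.symm_bilin_eq_zero e i (S.shiftRel e i i) (S.shiftRel_add_left e i i)
    (S.shiftRel_smul_left e i i) (fun f g => ?_) (S.shiftRel_one_one e (.inr hi))
    (fun u q hu f g => S.innerDer_shiftRel e i i u q q hu hu f g) f g
  simp only [shiftRel, hi, sbr_even_left, superSign_zero_left, one_smul]
  rw [add_comm (S.x e i f * S.x e i g)]
  abel

theorem x_x_self (e : ℤˣ) {i : Fin N} (hi : S.c i i = 0) (f g : R[X]) :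
    sbr R (S.p i) (S.p i) (S.x e i f) (S.x e i g) = 0 := by
  refine S.symm_bilin_eq_zero e i (fun f g => sbr R (S.p i) (S.p i) (S.x e i f) (S.x e i g))
    (by intros; simp [sbr_add_left]) (by intros; simp [sbr_smul_left]) (fun f g => ?_)
    (by simp [S.x_x_zero e i i hi]) (fun u q hu f g => by rw [innerDer_sbr, hu, hu]) f g
  simp only [sbr, S.p_eq_one i hi, superSign_one_one, neg_smul, one_smul, sub_neg_eq_add]
  rw [add_comm]

theorem x_x_zero' (e : ℤˣ) {i j : Fin N} (hc : S.c i j = 0) (f g : R[X]) :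
    sbr R (S.p i) (S.p j) (S.x e i f) (S.x e j g) = 0 := by
  by_cases hij : i = j
  · subst hij
    exact S.x_x_self e hc f g
  · exact S.x_x_of_ne e hij hc f g

theorem h_of_odd (e : ℤˣ) {i : Fin N} (hi : S.p i = 1) (f g : R[X]) :
    S.x e i f * S.x (-e) i g + S.x (-e) i g * S.x e i f = S.Y i (f * g) 1 := by
  have key : ∀ f g, S.x 1 i f * S.x (-1) i g + S.x (-1) i g * S.x 1 i f = S.Y i (f * g) 1 :=
    fun f g => by
      rw [← Y_eq, Y, sbr, hi, superSign_one_one]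
      simp
  rcases Int.units_eq_one_or e with rfl | rfl
  · exact key f g
  · rw [neg_neg, mul_comm f, ← key, add_comm]

theorem h_of_even (e : ℤˣ) {i : Fin N} (hi : S.p i = 0) (f g : R[X]) :
    S.x e i f * S.x (-e) i g - S.x (-e) i g * S.x e i f = sgn R e • S.Y i (f * g) 1 := by
  have key : ∀ f g, S.x 1 i f * S.x (-1) i g - S.x (-1) i g * S.x 1 i f = S.Y i (f * g) 1 :=
    fun f g => by
      rw [← Y_eq, Y, sbr, hi, superSign_zero_left, one_smul]
  rcases Int.units_eq_one_or e with rfl | rfl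
  · rw [sgn_one, one_smul]; exact key f g
  · rw [neg_neg, mul_comm f, ← key, sgn_neg_one, neg_one_smul, neg_sub]

/-- Since x_{i,r} and x_{i,0} anticommute, the index r can be moved off the Cartan element:
[h_{i,r}, x_{i,0}] = -[h_{i,0}, x_{i,r}] = 0. Then T_i spreads this to all f. -/
theorem innerDer_h_x_isotropic (e : ℤˣ) {i : Fin N} (hi : S.c i i = 0) (r : ℕ) (f : R[X]) :
    innerDer R A (S.h i r) (S.x e i f) = 0 := by
  have hp := S.p_eq_one i hi
  refine eq_zero_of_shift (F := fun f => innerDer R A (S.h i r) (S.x e i f))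
    (by intros; simp) (by intros; simp) ?_ (fun f hf => ?_) f
  · have hx := S.x_x_self e hi (X ^ r) 1
    rw [sbr, hp, superSign_one_one, neg_one_smul, sub_neg_eq_add] at hx
    have h1 := S.h_of_odd e hp (X ^ r) 1
    have h2 := S.h_of_odd e hp 1 1
    have h3 := S.innerDer_h_zero_x e i i (X ^ r)
    rw [k, hi, mul_zero, Int.cast_zero, zero_smul] at h3
    rw [mul_one] at h1 h2
    have h4 := bracket_of_anticommute (y := S.x (-e) i 1) (eq_neg_of_add_eq_zero_left hx)
    rw [h1, h2] at h4
    rw [h, innerDer_apply, h4, neg_eq_zero, ← h3, innerDer_apply, h, pow_zero]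
  · rw [x_X_mul, map_smul, ← Module.End.mul_apply,
      (innerDer_comm (sub_eq_zero.mp (S.innerDer_T_h i i r)).symm).eq, Module.End.mul_apply, hf,
      map_zero, smul_zero]

theorem hShift_self_of_isotropic (e : ℤˣ) {i : Fin N} (hi : S.c i i = 0) : S.HShift e i i := by
  intro r f
  rw [S.innerDer_h_x_isotropic e hi, S.innerDer_h_x_isotropic e hi, k, hi]
  simp

/-- Let W(r,f) be the defect. Bracketing the x–x relation with an opposite generator gives W(r,1) =
-W(0,X^r), and W(0,·) = 0 is the h₁ relation; T_i, which commutes with every h_{i,r}, then shifts f.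
-/
theorem hShift_self_of_even (e : ℤˣ) {i : Fin N} (hi : S.p i = 0) : S.HShift e i i := by
  set W : ℕ → R[X] → A := fun r f => innerDer R A (S.h i (r + 1)) (S.x e i f)
    - innerDer R A (S.h i r) (S.x e i (X * f))
    - (S.k e i i * S.η) • (S.h i r * S.x e i f + S.x e i f * S.h i r) with hW
  have h0 : ∀ f, W 0 f = 0 := fun f => sub_eq_zero.mpr (S.innerDer_h_one_x e i i f)
  have hh : ∀ r, S.h i r = sgn R e • (S.x e i (X ^ r) * S.x (-e) i 1
      - S.x (-e) i 1 * S.x e i (X ^ r)) := fun r => by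
    rw [S.h_of_even e hi, smul_smul, sgn_mul_self, one_smul, mul_one, h]
  have hanti : ∀ r, W r 1 + W 0 (X ^ r) = 0 := fun r => by
    have key := S.shiftRel_self e hi (X ^ r) 1
    rw [shiftRel, sub_eq_zero, hi] at key
    simp only [sbr_even_left, superSign_zero_left, one_smul, ← pow_succ', mul_one] at key
    have := congrArg (sgn R e • ·) (shift_antisymm (y := S.x (-e) i 1) key)
    simp only [hW, hh, innerDer_apply, mul_one, ← pow_succ', pow_zero, zero_add, pow_one,
      smul_mul_assoc, mul_smul_comm]
    simp only [smul_zero] at this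
    rw [← this]
    module
  intro r f
  refine sub_eq_zero.mp (eq_zero_of_shift (F := W r) (fun f g => ?_) (fun t f => ?_) ?_
    (fun f hf => ?_) f)
  · simp only [hW, mul_add, map_add, add_mul, smul_add]; abel
  · simp only [hW, mul_smul_comm, map_smul, smul_mul_assoc]; module
  · have := hanti r
    rwa [h0, add_zero] at this
  · have := congrArg (innerDer R A (S.T i)) hf
    have hc : ∀ r z, innerDer R A (S.T i) (innerDer R A (S.h i r) z)
        = innerDer R A (S.h i r) (innerDer R A (S.T i) z) := fun r z => by
      rw [← Module.End.mul_apply, (innerDer_comm (sub_eq_zero.mp (S.innerDer_T_h i i r))).eq,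
        Module.End.mul_apply]
    simp only [hW, map_sub, map_smul, map_add, map_zero, innerDer_mul, S.innerDer_T_h, hc,
      innerDer_T_x, zero_mul, mul_zero, zero_add, add_zero, smul_mul_assoc, mul_smul_comm] at this
    have h3 := congrArg (sgn R e • ·) this
    simp only [smul_sub, smul_add, smul_smul, smul_zero, mul_left_comm (sgn R e), sgn_mul_self,
      one_smul, mul_one] at h3
    rw [← h3]
    simp only [hW, smul_add]

/-- All nodes but an odd non-isotropic one are good. -/
theorem hShift (e : ℤˣ) (i j : Fin N) (hij : i = j → S.p i = 0 ∨ S.c i i = 0) :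
    S.HShift e i j := by
  by_cases h : i = j
  · subst h
    rcases hij rfl with h | h
    · exact S.hShift_self_of_even e h
    · exact S.hShift_self_of_isotropic e h
  · exact S.hShift_of_ne e h

end

end MinData

end SuperYangian

/-! ### Higher Serre relations. -/

namespace SuperYangian

open Polynomial

namespace MinData

variable {R A : Type*} [CommRing R] [Ring A] [Algebra R A] {N : ℕ} (S : MinData R A N)

theorem HShift.actsOn {S : MinData R A N} {e : ℤˣ} {i j : Fin N} (hs : S.HShift e i j) (M : ℕ) :
    S.ActsOn M e i j := S.actsOn_of_shift fun r f _ => hs r f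

theorem innerDer_T_x_self (e : ℤˣ) (i : Fin N) (f : R[X]) :
    innerDer R A (S.T i) (S.x e i f) = S.x e i ((sgn R e • X) * f) := by simp [innerDer_T_x]

theorem innerDer_T_x_ne (e : ℤˣ) {i j : Fin N} (hij : i ≠ j) (f : R[X]) :
    innerDer R A (S.T i) (S.x e j f) = S.x e j (0 * f) := by simp [S.innerDer_T_x_of_ne e hij]

/-- The triple bracket of the cubic Serre relation. -/
noncomputable def br₃ (e : ℤˣ) (i j : Fin N) (f f' g : R[X]) : A :=
  sbr R (S.p i) (S.p i + S.p j) (S.x e i f) (sbr R (S.p i) (S.p j) (S.x e i f') (S.x e j g))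

/-- The quadruple bracket of the Serre relation of the last node. -/
noncomputable def br₄ (e : ℤˣ) (i j : Fin N) (f f' f'' g : R[X]) : A :=
  sbr R (S.p i) (S.p i + (S.p i + S.p j)) (S.x e i f) (S.br₃ e i j f' f'' g)

section

variable {S} {e : ℤˣ} {i j : Fin N} {u : A} {q q' : R[X]}

theorem innerDer_br₃ (hf : ∀ f, innerDer R A u (S.x e i f) = S.x e i (q * f))
    (hg : ∀ g, innerDer R A u (S.x e j g) = S.x e j (q' * g)) (f f' g : R[X]) :
    innerDer R A u (S.br₃ e i j f f' g)
      = S.br₃ e i j (q * f) f' g + S.br₃ e i j f (q * f') g + S.br₃ e i j f f' (q' * g) := by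
  simp only [br₃, innerDer_sbr, hf, hg, sbr_add_right]
  abel

theorem innerDer_br₄ (hf : ∀ f, innerDer R A u (S.x e i f) = S.x e i (q * f))
    (hg : ∀ g, innerDer R A u (S.x e j g) = S.x e j (q' * g)) (f f' f'' g : R[X]) :
    innerDer R A u (S.br₄ e i j f f' f'' g)
      = S.br₄ e i j (q * f) f' f'' g + S.br₄ e i j f (q * f') f'' g
        + S.br₄ e i j f f' (q * f'') g + S.br₄ e i j f f' f'' (q' * g) := by
  simp only [br₄, innerDer_sbr, hf, innerDer_br₃ hf hg, sbr_add_right]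
  abel

end

/-- The symmetrized triple bracket. -/
noncomputable def symBr₃ (e : ℤˣ) (i j : Fin N) (f f' g : R[X]) : A :=
  S.br₃ e i j f f' g + S.br₃ e i j f' f g

theorem innerDer_symBr₃ {S : MinData R A N} {e : ℤˣ} {i j : Fin N} {u : A} {q q' : R[X]}
    (hf : ∀ f, innerDer R A u (S.x e i f) = S.x e i (q * f))
    (hg : ∀ g, innerDer R A u (S.x e j g) = S.x e j (q' * g)) (f f' g : R[X]) :
    innerDer R A u (S.symBr₃ e i j f f' g) = S.symBr₃ e i j (q * f) f' g
      + S.symBr₃ e i j f (q * f') g + S.symBr₃ e i j f f' (q' * g) := by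
  simp only [symBr₃, map_add, innerDer_br₃ hf hg]
  abel

theorem symBr₃_swap (e : ℤˣ) (i j : Fin N) (f f' g : R[X]) :
    S.symBr₃ e i j f f' g = S.symBr₃ e i j f' f g := add_comm _ _

theorem symBr₃_add (e : ℤˣ) (i j : Fin N) (f f₁ f' g : R[X]) :
    S.symBr₃ e i j (f + f₁) f' g = S.symBr₃ e i j f f' g + S.symBr₃ e i j f₁ f' g := by
  simp only [symBr₃, br₃, map_add, sbr_add_left, sbr_add_right]; abel

theorem symBr₃_smul (e : ℤˣ) (i j : Fin N) (t : R) (f f' g : R[X]) :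
    S.symBr₃ e i j (t • f) f' g = t • S.symBr₃ e i j f f' g := by
  simp only [symBr₃, br₃, map_smul, sbr_smul_left, sbr_smul_right, smul_add]

theorem symBr₃_add_right (e : ℤˣ) (i j : Fin N) (f f' g g' : R[X]) :
    S.symBr₃ e i j f f' (g + g') = S.symBr₃ e i j f f' g + S.symBr₃ e i j f f' g' := by
  simp only [symBr₃, br₃, map_add, sbr_add_right]; abel

theorem symBr₃_smul_right (e : ℤˣ) (i j : Fin N) (t : R) (f f' g : R[X]) :
    S.symBr₃ e i j f f' (t • g) = t • S.symBr₃ e i j f f' g := by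
  simp only [symBr₃, br₃, map_smul, sbr_smul_right, smul_add]

/-- The symmetrized quadruple bracket. -/
noncomputable def symBr₄ (e : ℤˣ) (i j : Fin N) (f f' f'' g : R[X]) : A :=
  S.br₄ e i j f f' f'' g + S.br₄ e i j f f'' f' g + S.br₄ e i j f' f f'' g
    + S.br₄ e i j f' f'' f g + S.br₄ e i j f'' f f' g + S.br₄ e i j f'' f' f g

theorem innerDer_symBr₄ {S : MinData R A N} {e : ℤˣ} {i j : Fin N} {u : A} {q q' : R[X]}
    (hf : ∀ f, innerDer R A u (S.x e i f) = S.x e i (q * f))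
    (hg : ∀ g, innerDer R A u (S.x e j g) = S.x e j (q' * g)) (f f' f'' g : R[X]) :
    innerDer R A u (S.symBr₄ e i j f f' f'' g)
      = S.symBr₄ e i j (q * f) f' f'' g + S.symBr₄ e i j f (q * f') f'' g
        + S.symBr₄ e i j f f' (q * f'') g + S.symBr₄ e i j f f' f'' (q' * g) := by
  simp only [symBr₄, map_add, innerDer_br₄ hf hg]
  abel

theorem symBr₄_swap₁ (e : ℤˣ) (i j : Fin N) (f f' f'' g : R[X]) :
    S.symBr₄ e i j f f' f'' g = S.symBr₄ e i j f' f f'' g := by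
  simp only [symBr₄]; abel

theorem symBr₄_swap₂ (e : ℤˣ) (i j : Fin N) (f f' f'' g : R[X]) :
    S.symBr₄ e i j f f' f'' g = S.symBr₄ e i j f f'' f' g := by
  simp only [symBr₄]; abel

theorem symBr₄_add (e : ℤˣ) (i j : Fin N) (f f₁ f' f'' g : R[X]) : S.symBr₄ e i j (f + f₁) f' f'' g
    = S.symBr₄ e i j f f' f'' g + S.symBr₄ e i j f₁ f' f'' g := by
  simp only [symBr₄, br₄, br₃, map_add, sbr_add_left, sbr_add_right]; abel

theorem symBr₄_smul (e : ℤˣ) (i j : Fin N) (t : R) (f f' f'' g : R[X]) :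
    S.symBr₄ e i j (t • f) f' f'' g = t • S.symBr₄ e i j f f' f'' g := by
  simp only [symBr₄, br₄, br₃, map_smul, sbr_smul_left, sbr_smul_right, smul_add]

theorem symBr₄_add_right (e : ℤˣ) (i j : Fin N) (f f' f'' g g' : R[X]) :
    S.symBr₄ e i j f f' f'' (g + g') = S.symBr₄ e i j f f' f'' g + S.symBr₄ e i j f f' f'' g' := by
  simp only [symBr₄, br₄, br₃, map_add, sbr_add_right]; abel

theorem symBr₄_smul_right (e : ℤˣ) (i j : Fin N) (t : R) (f f' f'' g : R[X]) :
    S.symBr₄ e i j f f' f'' (t • g) = t • S.symBr₄ e i j f f' f'' g := by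
  simp only [symBr₄, br₄, br₃, map_smul, sbr_smul_right, smul_add]

/-- Only the outer generators carry indices, and T_{j'}, T_{j''} shift them separately while fixing
the middle ones. -/
theorem quartic_eq_zero (e : ℤˣ) (j' j j'' : Fin N) (h1 : j'.val + 1 = j.val)
    (h2 : j.val + 1 = j''.val) (hj : S.c j j = 0) (f g : R[X]) :
    sbr R (S.p j' + S.p j) (S.p j + S.p j'') (sbr R (S.p j') (S.p j) (S.x e j' f) (S.x₀ e j))
      (sbr R (S.p j) (S.p j'') (S.x₀ e j) (S.x e j'' g)) = 0 := by
  have n1 : j' ≠ j := by rintro rfl; omega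
  have n2 : j'' ≠ j := by rintro rfl; omega
  have n3 : j' ≠ j'' := by rintro rfl; omega
  refine eq_zero_of_shift₂ (F := fun f g => sbr R (S.p j' + S.p j) (S.p j + S.p j'')
    (sbr R (S.p j') (S.p j) (S.x e j' f) (S.x₀ e j))
      (sbr R (S.p j) (S.p j'') (S.x₀ e j) (S.x e j'' g)))
    (by intros; simp [sbr_add_left]) (by intros; simp [sbr_smul_left])
    (by intros; simp [sbr_add_right]) (by intros; simp [sbr_smul_right]) ?_
    (fun f g h => ?_) (fun f g h => ?_) f g
  · simp [S.quartic e j' j j'' h1 h2 hj]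
  · have := congrArg (innerDer R A (S.T j')) h
    rw [← x_one] at this ⊢
    simp only [innerDer_sbr, innerDer_T_x, S.innerDer_T_x_of_ne _ n1, S.innerDer_T_x_of_ne _ n3,
      sbr_smul_left, sbr_zero_right, sbr_zero_left, add_zero, map_zero] at this
    simpa using sgn_smul_cancel this
  · have := congrArg (innerDer R A (S.T j'')) h
    rw [← x_one] at this ⊢
    simp only [innerDer_sbr, innerDer_T_x, S.innerDer_T_x_of_ne _ n2, S.innerDer_T_x_of_ne _ n3.symm,
      sbr_smul_right, sbr_zero_right, sbr_zero_left, add_zero, zero_add, map_zero] at this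
    simpa using sgn_smul_cancel this

section

variable [Nontrivial R]

/-- The bracket depends on the product of its arguments, so every defect is zero and the factors on
x^+_j and x^-_j cancel. -/
theorem innerDer_h_Y (i j : Fin N) (hij : i = j → S.p i = 0 ∨ S.c i i = 0) (r : ℕ) (f g : R[X]) :
    innerDer R A (S.h i r) (S.Y j f g) = 0 := by
  have hd : ∀ f g, S.Y j (X * f) g - S.Y j f (X * g) = 0 := fun f g => by
    rw [S.Y_eq j f, S.Y_eq j (X * f), mul_assoc, mul_left_comm, sub_self]
  have hneg := (S.hShift (-1) i j hij).actsOn (r + 1)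
  rw [ActsOn, show S.k (-1) i j = -S.k 1 i j by simp [k_eq]] at hneg
  have hE : ∀ m, actCoeff (2 * S.η) (S.p j) (S.p j) (S.x 1 j) (S.x (-1) j)
      (fun r => S.k 1 i j • (X + C (S.k 1 i j * S.η)) ^ r)
      (fun r => -S.k 1 i j • (X + C (-S.k 1 i j * S.η)) ^ r) f g m = 0 := fun m => by
    rw [actCoeff_pow _ _ _ _ _ _ _ 0 m f (fun a t _ => hd _ _), smul_zero]
  exact (((S.hShift 1 i j hij).actsOn (r + 1)).sbr_comm hneg _ _ f g (by omega)
    fun m _ => hE m).trans (hE r)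

/-- T_j first spreads the relation to all g. The two symmetric slots are then treated by T_i and `G₂
i`, with values viewed as functions of g. -/
theorem cubic_eq_zero (e : ℤˣ) (i j : Fin N) (hi : i.val + 1 ≠ N)
    (hij : j.val + 1 = i.val ∨ j.val = i.val + 1) (hc : S.c i i ≠ 0) (a b : ℕ) (g : R[X]) :
    S.symBr₃ e i j (X ^ a) (X ^ b) g = 0 := by
  have hne : i ≠ j := by rintro rfl; omega
  have smul' : ∀ (t : R) f f' g, S.symBr₃ e i j f (t • f') g = t • S.symBr₃ e i j f f' g :=
    fun t f f' g => by rw [symBr₃_swap, symBr₃_smul, symBr₃_swap]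
  have add' : ∀ f f' f₁ g, S.symBr₃ e i j f (f' + f₁) g
      = S.symBr₃ e i j f f' g + S.symBr₃ e i j f f₁ g :=
    fun f f' f₁ g => by rw [symBr₃_swap, symBr₃_add, symBr₃_swap, symBr₃_swap _ _ _ _ f₁]
  have zero_right : ∀ f f', S.symBr₃ e i j f f' 0 = 0 := fun f f' => by simp [symBr₃, br₃]
  have zero_left : ∀ f f', S.symBr₃ e i j 0 f f' = 0 := fun f f' => by simp [symBr₃, br₃]
  have main : ∀ a b, S.symBr₃ e i j (X ^ a) (X ^ b) = 0 := by
    refine eq_zero_of_symm_shift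
      (K := fun a b => S.symBr₃ e i j (X ^ a) (X ^ b))
      (fun v hv => funext fun g => S.add_self_cancel (congrFun hv g))
      (fun a b => funext fun g => S.symBr₃_swap e i j _ _ g) (funext fun g => ?_)
      (fun a b hab => funext fun g => ?_) (fun a b hab => funext fun g => ?_)
    · refine eq_zero_of_shift (F := S.symBr₃ e i j (X ^ 0) (X ^ 0))
        (S.symBr₃_add_right e i j _ _) (fun t => S.symBr₃_smul_right e i j t _ _) ?_
        (fun g hg => ?_) g
      · simp [symBr₃, br₃, S.cubic e i j hi hij hc]
      · have := innerDer_symBr₃ (S.innerDer_T_x_ne e hne.symm) (S.innerDer_T_x_self e j) (X ^ 0) (X ^ 0) g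
        rw [hg, map_zero, zero_mul, S.symBr₃_swap e i j (X ^ 0) 0, zero_left, zero_add, zero_add,
          smul_mul_assoc, symBr₃_smul_right] at this
        rw [sgn_smul_cancel this.symm, smul_zero]
    · have := innerDer_symBr₃ (S.innerDer_T_x_self e i) (S.innerDer_T_x_ne e hne) (X ^ a) (X ^ b) g
      rw [congrFun hab g, Pi.zero_apply, map_zero, zero_mul, zero_right, add_zero, smul_mul_assoc,
        smul_mul_assoc, symBr₃_smul, smul', ← pow_succ', ← pow_succ', ← smul_add] at this
      exact (sgn_smul_cancel this.symm).trans (smul_zero _)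
    · have hz : ∀ g, S.symBr₃ e i j (X ^ a) (X ^ b) g = 0 := congrFun hab
      have := innerDer_symBr₃ (S.hShift e i i fun _ => .inl (S.p_eq_zero i hc hi)).innerDer_G₂
        (S.hShift_of_ne e hne).innerDer_G₂ (X ^ a) (X ^ b) g
      -- The hypothesis holds for every g, so the action on x_j and the constant term both drop out,
      -- leaving the square shifts in the symmetric slots.
      rw [hz, hz, map_zero, add_zero, add_mul, add_mul, symBr₃_add, add', ← smul_eq_C_mul,
        ← smul_eq_C_mul, symBr₃_smul _ e i j (S.k e i i * (S.k e i i * S.η) ^ 2),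
        smul' (S.k e i i * (S.k e i i * S.η) ^ 2), hz, smul_zero, add_zero, add_zero,
        smul_mul_assoc, smul_mul_assoc, symBr₃_smul, smul', ← smul_add,
        ← pow_add, ← pow_add, add_comm 2 a, add_comm 2 b] at this
      refine S.smul_cancel (n := 3 * ((e : ℤ) * S.c i i)) ?_ ?_
      · simp [hc]
      · refine Eq.trans ?_ this.symm
        simp [k]
  exact congrFun (main a b) g

/-- Three symmetric slots need p₁, p₂ and p₃. The last two come from the node j, whose Cartan
elements obey the h–x relation on both nodes; the last node itself may be odd non-isotropic. -/
theorem lastCubic_eq_zero (e : ℤˣ) (i j : Fin N) (hi : i.val + 1 = N) (hij : j.val + 1 = i.val)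
    (a b c : ℕ) (g : R[X]) : S.symBr₄ e i j (X ^ a) (X ^ b) (X ^ c) g = 0 := by
  have hne : i ≠ j := by rintro rfl; omega
  have hc : S.c j i ≠ 0 := S.c_succ j i hij
  have hj : S.p j = 0 ∨ S.c j j = 0 := by
    by_cases h : S.c j j = 0
    · exact .inr h
    · exact .inl (S.p_eq_zero j h (by omega))
  have smul₂ : ∀ (t : R) f f' f'' g, S.symBr₄ e i j f (t • f') f'' g = t • S.symBr₄ e i j f f' f'' g :=
    fun t f f' f'' g => by rw [symBr₄_swap₁, symBr₄_smul, symBr₄_swap₁]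
  have smul₃ : ∀ (t : R) f f' f'' g, S.symBr₄ e i j f f' (t • f'') g = t • S.symBr₄ e i j f f' f'' g :=
    fun t f f' f'' g => by rw [symBr₄_swap₂, smul₂, symBr₄_swap₂]
  have add₂ : ∀ f f' f₁ f'' g, S.symBr₄ e i j f (f' + f₁) f'' g
      = S.symBr₄ e i j f f' f'' g + S.symBr₄ e i j f f₁ f'' g := fun f f' f₁ f'' g => by
    rw [symBr₄_swap₁, symBr₄_add, symBr₄_swap₁, symBr₄_swap₁ _ _ _ _ f₁]
  have add₃ : ∀ f f' f'' f₁ g, S.symBr₄ e i j f f' (f'' + f₁) g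
      = S.symBr₄ e i j f f' f'' g + S.symBr₄ e i j f f' f₁ g := fun f f' f'' f₁ g => by
    rw [symBr₄_swap₂, add₂, symBr₄_swap₂, symBr₄_swap₂ _ _ _ _ _ f₁]
  have zero_left : ∀ f f' g, S.symBr₄ e i j 0 f f' g = 0 := fun f f' g => by simp [symBr₄, br₄, br₃]
  have zero_right : ∀ f f' f'', S.symBr₄ e i j f f' f'' 0 = 0 := fun f f' f'' => by
    simp [symBr₄, br₄, br₃]
  have main : ∀ a b c, S.symBr₄ e i j (X ^ a) (X ^ b) (X ^ c) = 0 := by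
    have shift₁ : ∀ a b c, S.symBr₄ e i j (X ^ a) (X ^ b) (X ^ c) = 0 →
        S.symBr₄ e i j (X ^ (a + 1)) (X ^ b) (X ^ c) + S.symBr₄ e i j (X ^ a) (X ^ (b + 1)) (X ^ c)
          + S.symBr₄ e i j (X ^ a) (X ^ b) (X ^ (c + 1)) = 0 := by
      refine fun a b c habc => funext fun g => ?_
      have := innerDer_symBr₄ (S.innerDer_T_x_self e i) (S.innerDer_T_x_ne e hne)
        (X ^ a) (X ^ b) (X ^ c) g
      rw [congrFun habc g, Pi.zero_apply, map_zero, zero_mul, zero_right, add_zero, smul_mul_assoc,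
        smul_mul_assoc, smul_mul_assoc, symBr₄_smul, smul₂, smul₃, ← pow_succ', ← pow_succ',
        ← pow_succ', ← smul_add, ← smul_add] at this
      exact (sgn_smul_cancel this.symm).trans (smul_zero _)
    refine eq_zero_of_symm_shift₃ (K := fun a b c => S.symBr₄ e i j (X ^ a) (X ^ b) (X ^ c))
      (fun v hv => funext fun g => S.add_self_cancel (congrFun hv g))
      (fun v hv => funext fun g => S.smul_cancel (n := 3) three_ne_zero ?_)
      (fun a b c => funext fun g => S.symBr₄_swap₁ e i j _ _ _ g)
      (fun a b c => funext fun g => S.symBr₄_swap₂ e i j _ _ _ g)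
      (funext fun g => ?_) shift₁ (fun a b c habc => funext fun g => ?_)
      (fun a b c habc => funext fun g => ?_)
    · have := congrFun hv g
      simp only [Pi.add_apply, Pi.zero_apply] at this ⊢
      rw [← this]
      push_cast
      module
    · refine eq_zero_of_shift (F := S.symBr₄ e i j (X ^ 0) (X ^ 0) (X ^ 0))
        (S.symBr₄_add_right e i j _ _ _) (fun t => S.symBr₄_smul_right e i j t _ _ _) ?_
        (fun g hg => ?_) g
      · simp [symBr₄, br₄, br₃, S.lastCubic e i j hi hij]
      · have := innerDer_symBr₄ (S.innerDer_T_x_ne e hne.symm) (S.innerDer_T_x_self e j)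
          (X ^ 0) (X ^ 0) (X ^ 0) g
        rw [hg, map_zero, zero_mul, S.symBr₄_swap₂ e i j (X ^ 0) (X ^ 0) 0,
          S.symBr₄_swap₁ e i j (X ^ 0) 0, zero_left, zero_add, zero_add, zero_add, smul_mul_assoc,
          symBr₄_smul_right] at this
        rw [sgn_smul_cancel this.symm, smul_zero]
    · have hz : ∀ g, S.symBr₄ e i j (X ^ a) (X ^ b) (X ^ c) g = 0 := congrFun habc
      have := innerDer_symBr₄ (S.hShift_of_ne e hne.symm).innerDer_G₂
        (S.hShift e j j fun _ => hj).innerDer_G₂ (X ^ a) (X ^ b) (X ^ c) g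
      rw [hz, hz, map_zero, add_zero] at this
      simp only [add_mul, symBr₄_add, add₂, add₃, ← smul_eq_C_mul, smul_mul_assoc, symBr₄_smul,
        smul₂, smul₃, hz, smul_zero, add_zero, ← smul_add, ← pow_add, add_comm 2] at this
      refine S.smul_cancel (n := 3 * ((e : ℤ) * S.c j i)) ?_ ?_
      · simp [hc]
      · refine Eq.trans ?_ this.symm
        simp [k]
    · have hz : ∀ g, S.symBr₄ e i j (X ^ a) (X ^ b) (X ^ c) g = 0 := congrFun habc
      have hz₁ := congrFun (shift₁ a b c habc) g
      have := innerDer_symBr₄ (S.hShift_of_ne e hne.symm).innerDer_G₃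
        (S.hShift e j j fun _ => hj).innerDer_G₃ (X ^ a) (X ^ b) (X ^ c) g
      rw [hz, hz, map_zero, add_zero] at this
      simp only [add_mul, symBr₄_add, add₂, add₃, smul_mul_assoc, symBr₄_smul,
        smul₂, smul₃, ← pow_succ', ← pow_add, add_comm 3] at this
      refine S.smul_cancel (n := 4 * ((e : ℤ) * S.c j i)) ?_ ?_
      · simp [hc]
      -- The linear term in the polynomial of `G₃` contributes a multiple of the p₁ relation, which
      -- is known.
      · have h2 := congrArg ((4 * S.k e j i * (S.k e j i * S.η) ^ 2) • ·) hz₁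
        simp only [Pi.add_apply, Pi.zero_apply, smul_zero, smul_add] at h2 ⊢
        rw [show (((4 * ((e : ℤ) * S.c j i) : ℤ)) : R) = 4 * S.k e j i by simp [k]]
        linear_combination (norm := module) -this - h2
  exact congrFun (main a b c) g

end

end MinData

end SuperYangian

/-! ### Second-order actions for an odd non-isotropic node. -/

namespace SuperYangian

open Polynomial

section

variable {R A : Type*} [CommRing R] [Ring A] [Algebra R A]

/-- The coefficients of the action of the Cartan elements of an odd non-isotropic node, given by a
second-order recurrence. -/
noncomputable def oddCoeff (ν η : R) : ℕ → R[X]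
  | 0 => C ν
  | 1 => C ν * (X + C (ν * η))
  | r + 2 => (2 * X + C (ν * η)) * oddCoeff ν η (r + 1)
      - (X ^ 2 + C (ν * η) * X - 2 * C (ν * η) ^ 2) * oddCoeff ν η r

theorem mk_mul_of_recurrence {κ : ℕ → R} {s q : R}
    (hκ : ∀ r, κ (r + 2) = s * κ (r + 1) - q * κ r) :
    PowerSeries.mk κ * (1 - PowerSeries.C s * PowerSeries.X
        + PowerSeries.C q * PowerSeries.X ^ 2)
      = PowerSeries.C (κ 0) + PowerSeries.X * PowerSeries.C (κ 1 - s * κ 0) := by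
  have e1 : PowerSeries.mk κ * (1 - PowerSeries.C s * PowerSeries.X
      + PowerSeries.C q * PowerSeries.X ^ 2) = PowerSeries.mk κ
      - PowerSeries.X * (PowerSeries.C s * PowerSeries.mk κ)
      + PowerSeries.X * (PowerSeries.X * (PowerSeries.C q * PowerSeries.mk κ)) := by
    ring
  rw [e1]
  ext1 n
  match n with
  | 0 => simp
  | 1 =>
    simp only [map_add (PowerSeries.coeff 1), map_sub (PowerSeries.coeff 1)]
    rw [← zero_add 1]
    simp only [PowerSeries.coeff_succ_X_mul, PowerSeries.coeff_C_mul, PowerSeries.coeff_mk,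
      PowerSeries.coeff_zero_X_mul, PowerSeries.coeff_C]
    simp
  | n + 2 =>
    simp only [map_add (PowerSeries.coeff (n + 2)), map_sub (PowerSeries.coeff (n + 2)),
      PowerSeries.coeff_succ_X_mul, PowerSeries.coeff_C_mul, PowerSeries.coeff_mk,
      PowerSeries.coeff_C, hκ]
    simp

/-- With b = νη the denominator is (1-(X+2b)z)(1-(X-b)z); the initial values are chosen so that the
numerator is ν(1-Xz). -/
theorem mk_oddCoeff_mul (ν η : R) :
    PowerSeries.mk (oddCoeff ν η)
        * (1 - PowerSeries.C (2 * X + C (ν * η) : R[X]) * PowerSeries.X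
          + PowerSeries.C (X ^ 2 + C (ν * η) * X - 2 * C (ν * η) ^ 2 : R[X]) * PowerSeries.X ^ 2)
      = PowerSeries.C (C ν : R[X]) * (1 - PowerSeries.C (X : R[X]) * PowerSeries.X) := by
  rw [mk_mul_of_recurrence fun r => by rw [oddCoeff]]
  simp only [oddCoeff, map_sub, map_mul, map_add, map_ofNat]
  ring

/-- Let Q be the denominator for ν and Q' the one for -ν. The conjugation factors are Q'/Q and Q/Q',
so their product is 1. The identity is this fact with 2ηz divided out. -/
theorem oddCoeff_inverse (ν η : R) :
    PowerSeries.mk (oddCoeff ν η) + PowerSeries.mk (oddCoeff (-ν) η)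
      + PowerSeries.C (C (2 * η) : R[X]) * (PowerSeries.X * (PowerSeries.mk (oddCoeff ν η)
        * PowerSeries.mk (oddCoeff (-ν) η))) = 0 := by
  have h1 := mk_oddCoeff_mul ν η
  have h2 := mk_oddCoeff_mul (-ν) η
  set Q : R[X]⟦X⟧ := 1 - PowerSeries.C (2 * X + C (ν * η) : R[X]) * PowerSeries.X
          + PowerSeries.C (X ^ 2 + C (ν * η) * X - 2 * C (ν * η) ^ 2 : R[X]) * PowerSeries.X ^ 2
    with hQ
  set Q' : R[X]⟦X⟧ := 1 - PowerSeries.C (2 * X + C (-ν * η) : R[X]) * PowerSeries.X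
          + PowerSeries.C (X ^ 2 + C (-ν * η) * X - 2 * C (-ν * η) ^ 2 : R[X]) * PowerSeries.X ^ 2
    with hQ'
  have hu : IsUnit (Q * Q') := by
    rw [PowerSeries.isUnit_iff_constantCoeff]
    simp [hQ, hQ']
  refine hu.mul_left_cancel ?_
  rw [mul_zero]
  have h3 : Q' - Q = PowerSeries.C (C (2 * η) : R[X]) * PowerSeries.X
      * (PowerSeries.C (C ν : R[X]) * (1 - PowerSeries.C (X : R[X]) * PowerSeries.X)) := by
    simp only [hQ, hQ', map_add, map_mul, map_sub, map_neg, map_pow, map_ofNat]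
    ring
  have h4 : PowerSeries.C (C (-ν) : R[X]) = -PowerSeries.C (C ν : R[X]) := by simp
  rw [h4] at h2
  set K := PowerSeries.mk (oddCoeff ν η)
  set K' := PowerSeries.mk (oddCoeff (-ν) η)
  set n := PowerSeries.C (C ν : R[X]) * (1 - PowerSeries.C (X : R[X]) * PowerSeries.X)
  linear_combination (Q' + PowerSeries.C (C (2 * η) : R[X]) * PowerSeries.X * K' * Q') * h1
    + (Q + PowerSeries.C (C (2 * η) : R[X]) * PowerSeries.X * n) * h2 + n * h3

theorem linActs_of_recurrence₂ {ν η : R} {M : ℕ} {h : ℕ → A} {u : R[X] →ₗ[R] A}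
    (h0 : ∀ f, innerDer R A (h 0) (u f) = ν • u f)
    (h1 : ∀ f, innerDer R A (h 1) (u f) = ν • u (X * f) + (ν * (ν * η)) • u f
      + (2 * (ν * η)) • (u f * h 0))
    (hs : ∀ r f, innerDer R A (h (r + 2)) (u f)
      = innerDer R A (h (r + 1)) (u ((2 * X + C (ν * η)) * f))
        - innerDer R A (h r) (u ((X ^ 2 + C (ν * η) * X - 2 * C (ν * η) ^ 2) * f))
        + (2 * (ν * η)) • (u f * h (r + 1) - u (X * f) * h r)) :
    LinActs (2 * η) M h u (oddCoeff ν η) := by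
  have key : ∀ r f, innerDer R A (h (r + 1)) (u f) = u (oddCoeff ν η (r + 1) * f)
      + (2 * η) • ∑ x ∈ Finset.HasAntidiagonal.antidiagonal r, u (oddCoeff ν η x.1 * f) * h x.2 := by
    have z0 : ∀ f, u (oddCoeff ν η 0 * f) = ν • u f := fun f => by
      rw [oddCoeff, ← smul_eq_C_mul, map_smul]
    have z1 : ∀ f, u (oddCoeff ν η 1 * f) = ν • u (X * f) + (ν * (ν * η)) • u f := fun f => by
      rw [oddCoeff, ← map_smul, ← map_smul, ← map_add]
      simp only [smul_eq_C_mul, map_mul]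
      congr 1; ring
    -- The recurrence has order two, so the induction carries two consecutive cases.
    have main : ∀ r, (∀ f, innerDer R A (h (r + 1)) (u f) = u (oddCoeff ν η (r + 1) * f)
        + (2 * η) • ∑ x ∈ Finset.HasAntidiagonal.antidiagonal r, u (oddCoeff ν η x.1 * f) * h x.2)
        ∧ (∀ f, innerDer R A (h (r + 2)) (u f) = u (oddCoeff ν η (r + 2) * f) + (2 * η) •
          ∑ x ∈ Finset.HasAntidiagonal.antidiagonal (r + 1), u (oddCoeff ν η x.1 * f) * h x.2) := by
      set s : R[X] := 2 * X + C (ν * η) with hsd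
      set q : R[X] := X ^ 2 + C (ν * η) * X - 2 * C (ν * η) ^ 2 with hqd
      have hrec : ∀ j f, u (oddCoeff ν η (j + 2) * f)
          = u (oddCoeff ν η (j + 1) * (s * f)) - u (oddCoeff ν η j * (q * f)) := fun j f => by
        rw [oddCoeff, ← map_sub]; congr 1; ring
      have b0 : ∀ f, innerDer R A (h 1) (u f) = u (oddCoeff ν η 1 * f)
          + (2 * η) • (u (oddCoeff ν η 0 * f) * h 0) := fun f => by
        rw [h1, z1, z0, smul_mul_assoc, smul_smul]; congr 2; ring
      have hsX : ∀ f, u (s * f) = (2 : R) • u (X * f) + (ν * η) • u f := fun f => by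
        rw [← map_smul, ← map_smul, ← map_add]; congr 1
        rw [smul_eq_C_mul, smul_eq_C_mul, map_ofNat]; ring
      intro r
      induction r with
      | zero =>
        refine ⟨fun f => by simpa using b0 f, fun f => ?_⟩
        rw [hs, h0, b0, hrec, z0 (q * f)]
        simp only [zero_add, Finset.Nat.sum_antidiagonal_succ, Finset.Nat.antidiagonal_zero,
          Finset.sum_singleton, z0, z1]
        rw [hsX f]
        simp only [add_mul, smul_mul_assoc]
        module
      | succ r ih =>
        refine ⟨ih.2, fun f => ?_⟩
        rw [hs, ih.1, ih.2, hrec]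
        rw [Finset.Nat.sum_antidiagonal_succ (n := r), Finset.Nat.sum_antidiagonal_succ (n := r + 1),
          Finset.Nat.sum_antidiagonal_succ (n := r)]
        simp only [zero_add, hrec, z0, z1, sub_mul, Finset.sum_sub_distrib]
        rw [hsX f]
        simp only [add_mul, smul_mul_assoc]
        module
    exact fun r => (main r).1
  intro f
  refine actsBy_of_coeff (fun _ => ?_) (fun r _ => ?_)
  · have := h0 f
    rw [innerDer_apply, sub_eq_iff_eq_add', ← map_smul, smul_eq_C_mul] at this
    simpa [oddCoeff] using this
  · have := key r f
    rw [innerDer_apply, sub_eq_iff_eq_add'] at this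
    rw [this, add_assoc]

/-- The action on a bracket that depends only on the product of its arguments. -/
theorem actCoeff_of_mul {ħ : R} {p q : ZMod 2} {u v : R[X] →ₗ[R] A} {κ κ' : ℕ → R[X]}
    (L : R[X] →ₗ[R] A) (hL : ∀ f g, sbr R p q (u f) (v g) = L (f * g))
    (hκ : PowerSeries.mk κ + PowerSeries.mk κ'
      + PowerSeries.C (C ħ : R[X]) * (PowerSeries.X * (PowerSeries.mk κ * PowerSeries.mk κ')) = 0)
    (f g : R[X]) (r : ℕ) : actCoeff ħ p q u v κ κ' f g r = 0 := by
  have hr := congrArg (PowerSeries.coeff r) hκ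
  cases r with
  | zero =>
    simp only [map_add, PowerSeries.coeff_mk, PowerSeries.coeff_C_mul,
      PowerSeries.coeff_zero_X_mul, mul_zero, add_zero, map_zero] at hr
    simp only [actCoeff, hL]
    rw [← map_add, show κ 0 * f * g + f * (κ' 0 * g) = (κ 0 + κ' 0) * (f * g) by ring, hr, zero_mul,
      map_zero]
  | succ r =>
    simp only [map_add, PowerSeries.coeff_mk, PowerSeries.coeff_C_mul,
      PowerSeries.coeff_succ_X_mul, map_zero] at hr
    simp only [PowerSeries.coeff_mul, PowerSeries.coeff_mk] at hr
    simp only [actCoeff, hL]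
    rw [← map_sum, ← map_smul, ← map_add, ← map_add]
    have e1 : ∑ x ∈ Finset.HasAntidiagonal.antidiagonal r, κ x.1 * f * (κ' x.2 * g)
        = (∑ x ∈ Finset.HasAntidiagonal.antidiagonal r, κ x.1 * κ' x.2) * (f * g) := by
      rw [Finset.sum_mul]
      exact Finset.sum_congr rfl fun x _ => by ring
    rw [e1, smul_eq_C_mul]
    convert map_zero L
    linear_combination (f * g) * hr

end

end SuperYangian

/-! ### Noncommutative consequences of the Serre relation at an odd last node. -/

namespace SuperYangian

open Polynomial

section

variable {R A : Type*} [CommRing R] [Ring A] [Algebra R A]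

/-- The bracket of the quadruple Serre element with the opposite generator `w`. -/
theorem serre_bracket {s s' : R} (hs : s = 1 ∨ s = -1) {x z w : A} (hxw : x * w = s • (w * x))
    (hB : x * (x * (x * z)) - x * (z * (x * x)) - s • (x * (x * (z * x)))
      + s • (z * (x * (x * x))) = 0) {H : A} (hH : z * w - s' • (w * z) = H) :
    x * (x * (x * H)) - x * (H * (x * x)) - x * (x * (H * x)) + H * (x * (x * x)) = 0 := by
  have hxw' : ∀ a, x * (w * a) = s • (w * (x * a)) := fun a => by
    rw [← mul_assoc, hxw, smul_mul_assoc, mul_assoc]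
  have h1 := congrArg (· * w) hB
  have h2 := congrArg (fun a => s' • s • (w * a)) hB
  subst hH
  rcases hs with rfl | rfl <;>
  · simp only [mul_add, add_mul, mul_sub, sub_mul, mul_assoc, hxw, hxw', mul_smul_comm,
      smul_mul_assoc, zero_mul, mul_zero, smul_zero] at h1 h2 ⊢
    linear_combination (norm := module) h1 - h2

/-- Here H_r comes from the adjacent node. Moving H₁ through the cubes of x₀ leaves a relation in x₀
and x₁ alone. -/
theorem serre_first {ν η : R} {x0 x1 H0 H1 : A} (a0 : innerDer R A H0 x0 = (-ν) • x0)
    (b0 : innerDer R A H1 x0 = (-ν) • x1 + (-ν * η) • (H0 * x0 + x0 * H0))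
    (h : x0 * (x0 * (x0 * H1)) - x0 * (H1 * (x0 * x0)) - x0 * (x0 * (H1 * x0))
      + H1 * (x0 * (x0 * x0)) = 0) :
    ν • (x0 * (x0 * x1) - x1 * (x0 * x0) + (4 * (ν * η)) • (x0 * (x0 * x0))) = 0 := by
  have r0 := mul_eq_of_innerDer a0
  have r0' := fun w => mul_mul_eq r0 w
  have r1 := mul_eq_of_innerDer b0
  rw [r0] at r1
  have r1' := fun w => mul_mul_eq r1 w
  rw [← h]
  simp only [r1, r1', r0, r0', mul_add, add_mul, mul_assoc, mul_smul_comm,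
    smul_mul_assoc, smul_add, smul_sub]
  module

/-- The same elimination for H₂. The terms that still contain H₀ are the first relation times H₀,
and so vanish. -/
theorem serre_second {ν η : R} {x0 x1 x2 H0 H1 H2 : A} (a0 : innerDer R A H0 x0 = (-ν) • x0)
    (a1 : innerDer R A H0 x1 = (-ν) • x1)
    (b0 : innerDer R A H1 x0 = (-ν) • x1 + (-ν * η) • (H0 * x0 + x0 * H0))
    (b1 : innerDer R A H1 x1 = (-ν) • x2 + (-ν * η) • (H0 * x1 + x1 * H0))
    (c0 : innerDer R A H2 x0 = innerDer R A H1 x1 + (-ν * η) • (H1 * x0 + x0 * H1))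
    (hZ : x0 * (x0 * x1) - x1 * (x0 * x0) + (4 * (ν * η)) • (x0 * (x0 * x0)) = 0)
    (h : x0 * (x0 * (x0 * H2)) - x0 * (H2 * (x0 * x0)) - x0 * (x0 * (H2 * x0))
      + H2 * (x0 * (x0 * x0)) = 0) :
    ν • (x0 * (x0 * x2) - x2 * (x0 * x0) + (2 * (ν * η)) • (x0 * (x1 * x0))
      + (6 * (ν * η)) • (x1 * (x0 * x0)) - (12 * (ν * η) ^ 2) • (x0 * (x0 * x0))) = 0 := by
  have r0 := mul_eq_of_innerDer a0
  have r0' := fun w => mul_mul_eq r0 w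
  have s0 := mul_eq_of_innerDer a1
  have s0' := fun w => mul_mul_eq s0 w
  rw [b1] at c0
  have r1 := mul_eq_of_innerDer b0
  rw [r0] at r1
  have r1' := fun w => mul_mul_eq r1 w
  have r2 := mul_eq_of_innerDer c0
  rw [r1, s0] at r2
  have r2' := fun w => mul_mul_eq r2 w
  have hZ' := congrArg (· * H0) hZ
  simp only [add_mul, sub_mul, mul_assoc, smul_mul_assoc, zero_mul] at hZ'
  have key : ν • (x0 * (x0 * x2) - x2 * (x0 * x0) + (2 * (ν * η)) • (x0 * (x1 * x0))
      + (6 * (ν * η)) • (x1 * (x0 * x0)) - (12 * (ν * η) ^ 2) • (x0 * (x0 * x0)))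
      + (ν * (2 * η)) • (x0 * (x0 * (x1 * H0)) - x1 * (x0 * (x0 * H0))
        + (4 * (ν * η)) • (x0 * (x0 * (x0 * H0)))) = 0 := by
    rw [← h]
    simp only [r2, r2', r1, r1', r0, r0', mul_add, add_mul, mul_assoc, mul_smul_comm,
      smul_mul_assoc, smul_add, smul_sub]
    module
  rwa [hZ', smul_zero, add_zero] at key

/-- The bracket with the opposite generator of the quadruple relation at degree two. -/
theorem serre_quadratic {ν η : R} {x0 x1 x2 y h0 h1 : A} (e0 : x0 * y + y * x0 = h0)
    (e1 : x1 * y + y * x1 = h1)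
    (a0 : innerDer R A h0 x0 = ν • x0) (a1 : innerDer R A h0 x1 = ν • x1)
    (b0 : innerDer R A h1 x0 = ν • x1 + (ν * η) • (h0 * x0 + x0 * h0))
    (b1 : innerDer R A h1 x1 = ν • x2 + (ν * η) • (h0 * x1 + x1 * h0))
    (hF : x0 * (x1 * x1) - x1 * (x1 * x0) + (2 * (ν * η)) • (x1 * (x0 * x0) + x0 * (x1 * x0))
      - (4 * (ν * η) ^ 2) • (x0 * (x0 * x0)) = 0) :
    ν • (x0 * x2 + x2 * x0 - (2 : R) • (x1 * x1) + (ν * η) • (x0 * x1 - x1 * x0)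
      - (2 * (ν * η) ^ 2) • (x0 * x0)) = 0 := by
  have r0 := mul_eq_of_innerDer a0
  have r0' := fun w => mul_mul_eq r0 w
  have s0 := mul_eq_of_innerDer a1
  have s0' := fun w => mul_mul_eq s0 w
  have r1 := mul_eq_of_innerDer b0
  rw [r0] at r1
  have r1' := fun w => mul_mul_eq r1 w
  have s1 := mul_eq_of_innerDer b1
  rw [s0] at s1
  have s1' := fun w => mul_mul_eq s1 w
  have y0 : y * x0 = h0 - x0 * y := eq_sub_of_add_eq' e0
  have y0' := fun w => mul_mul_eq y0 w
  have y1 : y * x1 = h1 - x1 * y := eq_sub_of_add_eq' e1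
  have y1' := fun w => mul_mul_eq y1 w
  have k1 := congrArg (· * y) hF
  have k2 := congrArg (y * ·) hF
  simp only [y0, y0', y1, y1', r1, r1', s1, s1', r0, r0', s0, s0', mul_add, add_mul, mul_sub,
    sub_mul, mul_assoc, mul_smul_comm, smul_mul_assoc, smul_add, smul_sub, zero_mul,
    mul_zero] at k1 k2
  linear_combination (norm := module) -k1 - k2

/-- This is the commutator of the quadratic relation with y. For y an opposite generator of index r,
the elements h0, h1, h2 are h_{i,r}, h_{i,r+1}, h_{i,r+2}. -/
theorem odd_recurrence {b : R} {x0 x1 x2 y h0 h1 h2 : A} (e0 : x0 * y + y * x0 = h0)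
    (e1 : x1 * y + y * x1 = h1) (e2 : x2 * y + y * x2 = h2)
    (hq : x0 * x2 + x2 * x0 - (2 : R) • (x1 * x1) + b • (x0 * x1 - x1 * x0)
      - (2 * b ^ 2) • (x0 * x0) = 0) :
    innerDer R A h2 x0 = (2 : R) • innerDer R A h1 x1 + b • innerDer R A h1 x0
      - (innerDer R A h0 x2 + b • innerDer R A h0 x1 - (2 * b ^ 2) • innerDer R A h0 x0)
      + (2 * b) • (x0 * h1 - x1 * h0) := by
  have k1 := congrArg (· * y) hq
  have k2 := congrArg (y * ·) hq
  simp only [innerDer_apply, ← e0, ← e1, ← e2, mul_add, add_mul, mul_sub,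
    sub_mul, mul_assoc, mul_smul_comm, smul_mul_assoc, smul_add, smul_sub, zero_mul,
    mul_zero] at k1 k2 ⊢
  linear_combination (norm := module) k2 - k1

end

end SuperYangian

/-! ### The odd last node, and commutativity of all Cartan elements. -/

namespace SuperYangian

open Polynomial

namespace MinData

variable {R A : Type*} [CommRing R] [Ring A] [Algebra R A] {N : ℕ} (S : MinData R A N)

theorem x_mul_x_neg_of_ne (e : ℤˣ) {i j : Fin N} (hij : i ≠ j) (f g : R[X]) :
    S.x e i f * S.x (-e) j g = superSign R (S.p i) (S.p j) • (S.x (-e) j g * S.x e i f) := by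
  rcases Int.units_eq_one_or e with rfl | rfl
  · have := S.x_pos_x_neg_of_ne hij f g
    rwa [sbr, sub_eq_zero] at this
  · have := S.x_pos_x_neg_of_ne hij.symm g f
    rw [sbr, sub_eq_zero, superSign_comm] at this
    rw [neg_neg, this, smul_smul, superSign_mul_self, one_smul]

theorem k_neg (e : ℤˣ) (i j : Fin N) : S.k (-e) i j = -S.k e i j := by simp [k]

section

variable [Nontrivial R]

theorem exists_sign_smul_h (e : ℤˣ) (j : Fin N) (r : ℕ) : ∃ t : R, t * t = 1 ∧
    S.x e j 1 * S.x (-e) j (X ^ r)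
      - superSign R (S.p j) (S.p j) • (S.x (-e) j (X ^ r) * S.x e j 1) = t • S.h j r := by
  rcases Int.units_eq_one_or e with rfl | rfl
  · refine ⟨1, by simp, ?_⟩
    have := S.Y_X_pow j 0 r
    rw [pow_zero, zero_add] at this
    rw [one_smul, ← this]; rfl
  · refine ⟨-superSign R (S.p j) (S.p j), by simp [superSign_mul_self], ?_⟩
    rw [h, Y, neg_neg]
    simp only [sbr, smul_sub, smul_smul, neg_mul, superSign_mul_self, neg_smul, one_smul]
    abel

variable {i j : Fin N} (hi : i.val + 1 = N) (hij : j.val + 1 = i.val) (hp : S.p i = 1) (e : ℤˣ)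

include hi hij hp

theorem last_serre_h (r : ℕ) :
    S.x e i 1 * (S.x e i 1 * (S.x e i 1 * S.h j r))
      - S.x e i 1 * (S.h j r * (S.x e i 1 * S.x e i 1))
      - S.x e i 1 * (S.x e i 1 * (S.h j r * S.x e i 1))
      + S.h j r * (S.x e i 1 * (S.x e i 1 * S.x e i 1)) = 0 := by
  have hne : i ≠ j := by rintro rfl; omega
  obtain ⟨t, ht, hH⟩ := S.exists_sign_smul_h e j r
  have hxw := S.x_mul_x_neg_of_ne e hne 1 (X ^ r)
  have hB := S.lastCubic e i j hi hij
  rw [← x_one, ← x_one] at hB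
  simp only [sbr, hp, superSign_add_right, superSign_one_one] at hB hxw
  have := serre_bracket (superSign_cases _ _) hxw (z := S.x e j 1) (by
    rw [← hB]
    rcases superSign_cases (R := R) 1 (S.p j) with h | h <;> rw [h] <;>
    · simp only [mul_sub, sub_mul, mul_smul_comm, smul_mul_assoc, mul_assoc, smul_sub]
      module) hH
  have := congrArg (t • ·) this
  simpa only [mul_smul_comm, smul_mul_assoc, smul_sub, smul_add, smul_smul, ht, one_smul,
    smul_zero] using this

theorem last_relations :
    S.x e i 1 * (S.x e i 1 * S.x e i X) - S.x e i X * (S.x e i 1 * S.x e i 1)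
      + (4 * (S.k e i i * S.η)) • (S.x e i 1 * (S.x e i 1 * S.x e i 1)) = 0 ∧
    S.x e i 1 * (S.x e i 1 * S.x e i (X * X)) - S.x e i (X * X) * (S.x e i 1 * S.x e i 1)
      + (2 * (S.k e i i * S.η)) • (S.x e i 1 * (S.x e i X * S.x e i 1))
      + (6 * (S.k e i i * S.η)) • (S.x e i X * (S.x e i 1 * S.x e i 1))
      - (12 * (S.k e i i * S.η) ^ 2) • (S.x e i 1 * (S.x e i 1 * S.x e i 1)) = 0 := by
  have hne : i ≠ j := by rintro rfl; omega
  have hk : S.k e j i = -S.k e i i := by simp [k, S.c_last i j hij hi]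
  have hc : (e : ℤ) * S.c i i ≠ 0 := by simp [S.c_last_ne i hi]
  have hs := S.hShift_of_ne e hne.symm
  have a0 := S.innerDer_h_zero_x e j i 1
  have a1 := S.innerDer_h_zero_x e j i X
  have b0 := hs.one 1
  have b1 := hs.one X
  have c0 := hs.succ 1 1
  rw [hk] at a0 a1 b0 b1 c0
  rw [mul_one] at b0 c0
  have hZ := S.smul_cancel hc (serre_first a0 b0 (S.last_serre_h hi hij hp e 1))
  exact ⟨hZ, S.smul_cancel hc (serre_second a0 a1 b0 b1 c0 hZ (S.last_serre_h hi hij hp e 2))⟩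

theorem last_quadratic :
    S.x e i 1 * S.x e i (X * X) + S.x e i (X * X) * S.x e i 1
      - (2 : R) • (S.x e i X * S.x e i X)
      + (S.k e i i * S.η) • (S.x e i 1 * S.x e i X - S.x e i X * S.x e i 1)
      - (2 * (S.k e i i * S.η) ^ 2) • (S.x e i 1 * S.x e i 1) = 0 := by
  obtain ⟨hZ, hZ'⟩ := S.last_relations hi hij hp e
  have hD := congrArg (innerDer R A (S.T i)) hZ
  have hc : (e : ℤ) * S.c i i ≠ 0 := by simp [S.c_last_ne i hi]
  simp only [map_sub, map_add, map_smul, map_zero, innerDer_mul, innerDer_T_x, mul_one,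
    smul_mul_assoc, mul_smul_comm, ← smul_add, ← smul_sub, smul_comm _ (sgn R e)] at hD
  have hD := sgn_smul_cancel hD
  rw [smul_zero] at hD
  -- The T_i-derivative of the first relation and the second relation share the commutator [x₀²,
  -- x₂]; subtracting eliminates x₂, which reappears only after bracketing with the opposite
  -- generator.
  have hF : S.x e i 1 * (S.x e i X * S.x e i X) - S.x e i X * (S.x e i X * S.x e i 1)
      + (2 * (S.k e i i * S.η)) • (S.x e i X * (S.x e i 1 * S.x e i 1)
        + S.x e i 1 * (S.x e i X * S.x e i 1))
      - (4 * (S.k e i i * S.η) ^ 2) • (S.x e i 1 * (S.x e i 1 * S.x e i 1)) = 0 := by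
    simp only [mul_add] at hD
    linear_combination (norm := module) hD - hZ' - (4 * (S.k e i i * S.η)) • hZ
  have e0 := S.h_of_odd e hp (X ^ 0) 1
  have e1 := S.h_of_odd e hp (X ^ 1) 1
  rw [mul_one, ← h] at e0 e1
  rw [pow_zero] at e0
  rw [pow_one] at e1
  have b0 := S.innerDer_h_one_x e i i 1
  have b1 := S.innerDer_h_one_x e i i X
  rw [sub_eq_iff_eq_add', innerDer_h_zero_x] at b0 b1
  rw [mul_one] at b0
  exact S.smul_cancel hc (serre_quadratic e0 e1 (S.innerDer_h_zero_x e i i 1)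
    (S.innerDer_h_zero_x e i i X) b0 b1 hF)

/-- Bracketing `last_quadratic` with the opposite generator of index r gives f = 1; T_i commutes
with the h_{i,r} and supplies the other f. -/
theorem last_recurrence (r : ℕ) (f : R[X]) :
    innerDer R A (S.h i (r + 2)) (S.x e i f)
      = innerDer R A (S.h i (r + 1)) (S.x e i ((2 * X + C (S.k e i i * S.η)) * f))
        - innerDer R A (S.h i r) (S.x e i ((X ^ 2 + C (S.k e i i * S.η) * X
          - 2 * C (S.k e i i * S.η) ^ 2) * f))
        + (2 * (S.k e i i * S.η)) • (S.x e i f * S.h i (r + 1) - S.x e i (X * f) * S.h i r) := by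
  set b := S.k e i i * S.η with hb
  have e1 : ∀ f, S.x e i ((2 * X + C b) * f) = (2 : R) • S.x e i (X * f) + b • S.x e i f :=
    fun f => by
      rw [← map_smul, ← map_smul, ← map_add]
      simp only [smul_eq_C_mul, map_ofNat]
      congr 1; ring
  have e2 : ∀ f, S.x e i ((X ^ 2 + C b * X - 2 * C b ^ 2) * f)
      = S.x e i (X * (X * f)) + b • S.x e i (X * f) - (2 * b ^ 2) • S.x e i f := fun f => by
    rw [← map_smul, ← map_smul, ← map_add, ← map_sub]
    simp only [smul_eq_C_mul, map_mul, map_ofNat, map_pow]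
    congr 1; ring
  rw [e1, e2]
  refine sub_eq_zero.mp (eq_zero_of_shift (F := fun f => innerDer R A (S.h i (r + 2)) (S.x e i f)
    - (innerDer R A (S.h i (r + 1)) ((2 : R) • S.x e i (X * f) + b • S.x e i f)
      - innerDer R A (S.h i r) (S.x e i (X * (X * f)) + b • S.x e i (X * f)
        - (2 * b ^ 2) • S.x e i f)
      + (2 * b) • (S.x e i f * S.h i (r + 1) - S.x e i (X * f) * S.h i r))) (fun f g => ?_)
      (fun t f => ?_) ?_ (fun f hf => ?_) f)
  · simp only [mul_add, map_add, map_sub, map_smul, smul_add, add_mul]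
    module
  · simp only [mul_smul_comm, map_add, map_sub, map_smul, smul_mul_assoc]
    module
  · have k0 := S.h_of_odd e hp 1 (X ^ r)
    have k1 := S.h_of_odd e hp X (X ^ r)
    have k2 := S.h_of_odd e hp (X * X) (X ^ r)
    rw [one_mul, ← h] at k0
    rw [← pow_succ', ← h] at k1
    rw [mul_assoc, ← pow_succ', ← pow_succ', ← h] at k2
    have := odd_recurrence k0 k1 k2 (S.last_quadratic hi hij hp e)
    simp only [mul_one, map_add, map_sub, map_smul]
    rw [this, sub_self]
  · have := congrArg (innerDer R A (S.T i)) hf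
    have hc : ∀ r z, innerDer R A (S.T i) (innerDer R A (S.h i r) z)
        = innerDer R A (S.h i r) (innerDer R A (S.T i) z) := fun r z => by
      rw [← Module.End.mul_apply, (innerDer_comm (sub_eq_zero.mp (S.innerDer_T_h i i r))).eq,
        Module.End.mul_apply]
    simp only [map_sub, map_smul, map_add, map_zero, innerDer_mul, S.innerDer_T_h, hc,
      innerDer_T_x, mul_zero, add_zero, smul_mul_assoc] at this
    refine (sgn_smul_cancel (e := e) (Eq.trans ?_ this)).trans (smul_zero (sgn R e))
    simp only [map_sub, map_smul, map_add]
    module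

/-- The signs ± give opposite parameters ν, whose factors are inverse; as the bracket depends on fg
only, they cancel. -/
theorem innerDer_h_Y_last (r : ℕ) (f g : R[X]) : innerDer R A (S.h i r) (S.Y i f g) = 0 := by
  have hL : ∀ e, LinActs (2 * S.η) (r + 1) (S.h i) (S.x e i) (oddCoeff (S.k e i i) S.η) :=
    fun e => linActs_of_recurrence₂ (S.innerDer_h_zero_x e i i) (fun f => by
      have h0 := S.innerDer_h_zero_x e i i f
      have h1 := S.innerDer_h_one_x e i i f
      rw [sub_eq_iff_eq_add', innerDer_h_zero_x, mul_eq_of_innerDer h0] at h1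
      rw [h1]
      module) (S.last_recurrence hi hij hp e)
  have hz : ∀ r, actCoeff (2 * S.η) (S.p i) (S.p i) (S.x 1 i) (S.x (-1) i)
      (oddCoeff (S.k 1 i i) S.η) (oddCoeff (S.k (-1) i i) S.η) f g r = 0 := by
    refine actCoeff_of_mul
      { toFun := fun f => S.Y i f 1
        map_add' := by intros; simp [Y, sbr_add_left]
        map_smul' := by intros; simp [Y, sbr_smul_left] } (S.Y_eq i) ?_ f g
    rw [k_neg]
    exact oddCoeff_inverse _ _
  rw [Y, (hL 1).sbr_comm (hL (-1)) (S.p i) (S.p i) f g (Nat.lt_succ_self r) fun j _ => hz j, hz]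

end

section

variable [Nontrivial R]

theorem h_h (i j : Fin N) (r s : ℕ) : S.h i r * S.h j s = S.h j s * S.h i r := by
  have hgood : ∀ i j r s, (i = j → S.p i = 0 ∨ S.c i i = 0) → S.h i r * S.h j s = S.h j s * S.h i r :=
    fun i j r s hij => sub_eq_zero.mp (S.innerDer_h_Y i j hij r (X ^ s) 1)
  by_cases h : i = j → S.p i = 0 ∨ S.c i i = 0
  · exact hgood i j r s h
  · obtain ⟨rfl, hp, hc⟩ : i = j ∧ S.p i ≠ 0 ∧ S.c i i ≠ 0 := by tauto
    -- A node outside the first-order case is odd and non-isotropic, hence the last one.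
    have hi : i.val + 1 = N := by
      by_contra hi
      exact hp (S.p_eq_zero i hc hi)
    have h2 := S.two_le
    have hp' : ∀ a : ZMod 2, a ≠ 0 → a = 1 := by decide
    exact sub_eq_zero.mp (S.innerDer_h_Y_last (j := ⟨i.val - 1, by omega⟩) hi
      (by simp only; omega) (hp' _ hp) r (X ^ s) 1)

end

end MinData

end SuperYangian

/-! ### Cartan matrix and parities of the simple root systems. -/

namespace SuperYangian

section Form

variable {m n : ℕ}

/-- The form as a bilinear map. -/
def formBilin : Weight m n →ₗ[ℤ] Weight m n →ₗ[ℤ] ℤ :=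
  LinearMap.mk₂ ℤ form
    (fun a a' b => by simp [form, add_mul, Finset.sum_add_distrib]; ring)
    (fun t a b => by simp [form, mul_assoc, ← Finset.mul_sum]; ring)
    (fun a b b' => by simp [form, mul_add, Finset.sum_add_distrib]; ring)
    (fun t a b => by simp [form, mul_left_comm _ t, ← Finset.mul_sum]; ring)

theorem formBilin_apply (a b : Weight m n) : formBilin a b = form a b := rfl

theorem weightParity_sub (a b : Weight m n) :
    weightParity (a - b) = weightParity a - weightParity b := by
  simp [weightParity]

end Form

namespace BorelChoice

variable {m n : ℕ} (b : BorelChoice m n)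

/-- The square length of `v_l`. -/
def sq (l : Fin (m + n)) : ℤ := form (b.vec l) (b.vec l)

theorem form_vec_vec (i j : Fin (m + n)) :
    form (b.vec i) (b.vec j) = if i = j then b.sq i else 0 := by
  split_ifs with h
  · rw [h, sq]
  · have h' : b.order i ≠ b.order j := fun h' => h (b.order.injective h')
    have hz : ∀ x, b.vec i x * b.vec j x = 0 := fun x => by
      by_cases hx : x = b.order i
      · subst hx; simp [vec, h']
      · simp [vec, Pi.single_apply, hx]
    simp [form, hz]

theorem sq_parity (l : Fin (m + n)) : (b.sq l = 1 ∧ weightParity (b.vec l) = 0) ∨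
    (b.sq l = -1 ∧ weightParity (b.vec l) = 1) := by
  rcases h : b.order l with i | j <;>
  rcases Int.units_eq_one_or (b.sign l) with h' | h' <;>
  simp [sq, form, weightParity, vec, h, h', Pi.single_apply]

theorem sq_mul_self (l : Fin (m + n)) : b.sq l * b.sq l = 1 := by
  rcases b.sq_parity l with ⟨h, -⟩ | ⟨h, -⟩ <;> simp [h]

theorem sq_ne_zero (l : Fin (m + n)) : b.sq l ≠ 0 := fun h => by
  simpa [h] using b.sq_mul_self l

theorem simpleRoot_last {i : Fin (m + n)} (hi : i.val + 1 = m + n) : b.simpleRoot i = b.vec i := by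
  rw [simpleRoot, dif_neg (by omega)]

theorem simpleRoot_of_succ {i j : Fin (m + n)} (hij : i.val + 1 = j.val) :
    b.simpleRoot i = b.vec i - b.vec j := by
  rw [simpleRoot, dif_pos (by omega)]
  congr 2
  exact Fin.ext hij

theorem form_vec_simpleRoot (l i : Fin (m + n)) : form (b.vec l) (b.simpleRoot i)
    = (if l = i then b.sq l else 0) - if l.val = i.val + 1 then b.sq l else 0 := by
  by_cases hi : i.val + 1 < m + n
  · rw [b.simpleRoot_of_succ (j := ⟨i.val + 1, hi⟩) rfl, ← formBilin_apply, map_sub,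
      formBilin_apply, formBilin_apply, form_vec_vec, form_vec_vec]
    simp [Fin.ext_iff]
  · rw [b.simpleRoot_last (by omega), form_vec_vec, if_neg (c := l.val = i.val + 1) (by omega),
      sub_zero]

theorem cartan_last {i : Fin (m + n)} (hi : i.val + 1 = m + n) (j : Fin (m + n)) :
    b.cartan i j = (if i = j then b.sq i else 0) - if i.val = j.val + 1 then b.sq i else 0 := by
  rw [cartan, b.simpleRoot_last hi, form_vec_simpleRoot]

theorem cartan_of_succ {i i' : Fin (m + n)} (hi : i.val + 1 = i'.val) (j : Fin (m + n)) :
    b.cartan i j = (if i = j then b.sq i else 0) - (if i.val = j.val + 1 then b.sq i else 0)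
      - ((if i' = j then b.sq i' else 0) - if i'.val = j.val + 1 then b.sq i' else 0) := by
  rw [cartan, b.simpleRoot_of_succ hi, ← formBilin_apply, map_sub, LinearMap.sub_apply,
    formBilin_apply, formBilin_apply, form_vec_simpleRoot, form_vec_simpleRoot]

theorem cartan_symm (i j : Fin (m + n)) : b.cartan i j = b.cartan j i := by
  simp only [cartan, form, mul_comm]

theorem cartan_succ {i j : Fin (m + n)} (hij : i.val + 1 = j.val) : b.cartan i j = -b.sq j := by
  rw [b.cartan_of_succ hij, if_neg (by rintro rfl; omega), if_neg (by omega), if_pos rfl,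
    if_neg (by omega)]
  ring

theorem cartan_self_last {i : Fin (m + n)} (hi : i.val + 1 = m + n) : b.cartan i i = b.sq i := by
  rw [b.cartan_last hi, if_pos rfl, if_neg (by omega), sub_zero]

theorem cartan_self_of_succ {i j : Fin (m + n)} (hij : i.val + 1 = j.val) :
    b.cartan i i = b.sq i + b.sq j := by
  rw [b.cartan_of_succ hij, if_pos rfl, if_neg (by omega), if_neg (by rintro rfl; omega),
    if_pos hij.symm]
  ring

theorem parity_of_succ {i j : Fin (m + n)} (hij : i.val + 1 = j.val) :
    b.parity i = weightParity (b.vec i) - weightParity (b.vec j) := by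
  rw [parity, b.simpleRoot_of_succ hij, weightParity_sub]

theorem parity_eq_zero {i : Fin (m + n)} (hc : b.cartan i i ≠ 0) (hi : i.val + 1 ≠ m + n) :
    b.parity i = 0 := by
  obtain ⟨j, hij⟩ : ∃ j : Fin (m + n), i.val + 1 = j.val := ⟨⟨i.val + 1, by omega⟩, rfl⟩
  rw [b.cartan_self_of_succ hij] at hc
  rw [b.parity_of_succ hij]
  rcases b.sq_parity i with ⟨h, h'⟩ | ⟨h, h'⟩ <;>
  rcases b.sq_parity j with ⟨g, g'⟩ | ⟨g, g'⟩ <;>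
  simp_all

theorem parity_eq_one {i : Fin (m + n)} (hc : b.cartan i i = 0) : b.parity i = 1 := by
  have hi : i.val + 1 < m + n := by
    by_contra hi
    rw [b.cartan_self_last (by omega)] at hc
    exact b.sq_ne_zero i hc
  obtain ⟨j, hij⟩ : ∃ j : Fin (m + n), i.val + 1 = j.val := ⟨⟨i.val + 1, hi⟩, rfl⟩
  rw [b.cartan_self_of_succ hij] at hc
  rw [b.parity_of_succ hij]
  rcases b.sq_parity i with ⟨h, h'⟩ | ⟨h, h'⟩ <;>
  rcases b.sq_parity j with ⟨g, g'⟩ | ⟨g, g'⟩ <;>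
  simp_all

theorem vec_mem_span (i : Fin (m + n)) : b.vec i ∈ Submodule.span ℤ (Set.range b.simpleRoot) := by
  obtain ⟨d, hd⟩ : ∃ d, d = m + n - i.val := ⟨_, rfl⟩
  induction d generalizing i with
  | zero => omega
  | succ d ih =>
    by_cases hi : i.val + 1 < m + n
    · have := Submodule.add_mem _ (Submodule.subset_span (Set.mem_range_self i))
        (ih ⟨i.val + 1, hi⟩ (by simp only; omega))
      rwa [b.simpleRoot_of_succ (j := ⟨i.val + 1, hi⟩) rfl, sub_add_cancel] at this
    · exact b.simpleRoot_last (i := i) (by omega) ▸ Submodule.subset_span (Set.mem_range_self i)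

/-- The Cartan matrix is unimodular. -/
theorem exists_dual (i : Fin (m + n)) : ∃ t : Fin (m + n) → ℤ,
    ∀ j, ∑ l, t l * b.cartan l j = if i = j then 1 else 0 := by
  -- ω is the fundamental weight: (ω, α_j) counts j ≤ i minus j+1 ≤ i. It lies in the root lattice
  -- because every v_l is a sum of simple roots, so its coordinates there are integral.
  set ω : Weight m n := ∑ l ∈ Finset.Iic i, b.sq l • b.vec l with hω
  have hmem : ω ∈ Submodule.span ℤ (Set.range b.simpleRoot) :=
    Submodule.sum_mem _ fun l _ => Submodule.smul_mem _ _ (b.vec_mem_span l)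
  obtain ⟨t, ht⟩ := (Submodule.mem_span_range_iff_exists_fun ℤ).mp hmem
  refine ⟨t, fun j => ?_⟩
  have h1 : ∑ l, t l * b.cartan l j = formBilin ω (b.simpleRoot j) := by
    rw [← ht]
    simp only [map_sum, map_smul, LinearMap.sum_apply, LinearMap.smul_apply, formBilin_apply,
      cartan, smul_eq_mul]
  have h2 : formBilin ω (b.simpleRoot j) = ∑ l ∈ Finset.Iic i, ((if l = j then 1 else 0)
      - if l.val = j.val + 1 then (1 : ℤ) else 0) := by
    rw [hω]
    simp only [map_sum, map_smul, LinearMap.sum_apply, LinearMap.smul_apply, formBilin_apply,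
      form_vec_simpleRoot, smul_eq_mul, mul_sub, mul_ite, sq_mul_self, mul_zero]
  rw [h1, h2, Finset.sum_sub_distrib, Finset.sum_ite_eq']
  by_cases hj : j.val + 1 < m + n
  · have : ∀ l : Fin (m + n), (l.val = j.val + 1) ↔ l = ⟨j.val + 1, hj⟩ := fun l => by
      rw [Fin.ext_iff]
    simp only [this, Finset.sum_ite_eq']
    simp only [Finset.mem_Iic, Fin.le_def, Fin.ext_iff]
    split_ifs <;> omega
  · rw [Finset.sum_eq_zero fun l _ => if_neg (by omega)]
    simp only [Finset.mem_Iic, Fin.le_def, Fin.ext_iff]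
    split_ifs <;> omega

end BorelChoice

end SuperYangian

/-! ### From presentations by generators to the abstract data. -/

namespace SuperYangian

section Translation

variable {R : Type*} [CommRing R] {X Z : Type*} {par : X → ZMod 2} {par' : Z → ZMod 2}
  {A B : Type*} [Ring A] [Algebra R A] [Ring B] [Algebra R B]

theorem neg_one_pow_mul_eq (p q : ZMod 2) (a : A) :
    (-1) ^ (p.val * q.val) * a = superSign R p q • a := by
  rw [superSign]
  rcases Nat.even_or_odd (p.val * q.val) with h | h <;> simp [h.neg_one_pow]

theorem map_bracket (F : FreeAlgebra R X →ₐ[R] A) (x y : Homog R par) :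
    F (x.bracket y).val = sbr R x.deg y.deg (F x.val) (F y.val) := by
  have : (x.bracket y).val = sbr R x.deg y.deg x.val y.val := by
    rw [sbr, ← neg_one_pow_mul_eq (R := R)]; rfl
  rw [this, sbr, map_sub, map_smul, map_mul, map_mul, sbr]

theorem map_anti (F : FreeAlgebra R X →ₐ[R] A) (x y : Homog R par) :
    F (x.anti y).val = F x.val * F y.val + superSign R x.deg y.deg • (F y.val * F x.val) := by
  have : (x.anti y).val = x.val * y.val + superSign R x.deg y.deg • (y.val * x.val) := by
    rw [← neg_one_pow_mul_eq (R := R)]; rfl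
  rw [this, map_add, map_smul, map_mul, map_mul]

theorem parityPart_sbr_mem (g : X → A) {p q : ZMod 2} {a c : A}
    (ha : a ∈ parityPart (R := R) par g p) (hc : c ∈ parityPart (R := R) par g q) :
    sbr R p q a c ∈ parityPart (R := R) par g (p + q) :=
  Submodule.sub_mem _ (parityPart_mul_mem par g ha hc)
    (Submodule.smul_mem _ _ (add_comm q p ▸ parityPart_mul_mem par g hc ha))

theorem map_parityPart_le (F : A →ₐ[R] B) {g : X → A} {g' : Z → B}
    (h : ∀ x, F (g x) ∈ parityPart (R := R) par' g' (par x)) (d : ZMod 2) :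
    (parityPart (R := R) par g d).map F.toLinearMap ≤ parityPart (R := R) par' g' d := by
  rw [parityPart, Submodule.map_span_le]
  rintro _ ⟨w, rfl, rfl⟩
  induction w with
  | nil => simpa using parityPart_one_mem par' g'
  | cons x w ih => simpa using parityPart_mul_mem par' g' (h x) ih

end Translation

section Scalars

variable (k : Type*) [Field k] {m n : ℕ} (b : BorelChoice m n)

/-- The scalar `ħ / 2`. -/
noncomputable def halfHbar : k⟦X⟧ := PowerSeries.C (1 / 2 : k) * PowerSeries.X

theorem coefHbar_eq (e : ℤˣ) (i j : Fin (m + n)) :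
    coefHbar k b e i j = coef k b e i j * halfHbar k := by
  rw [coefHbar, coef, halfHbar, ← mul_assoc, ← map_intCast (PowerSeries.C (R := k)), ← map_mul,
    mul_one_div]

theorem isUnit_intCast_powerSeries [CharZero k] (z : ℤ) (hz : z ≠ 0) : IsUnit (z : k⟦X⟧) := by
  rw [PowerSeries.isUnit_iff_constantCoeff, map_intCast]
  exact (Int.cast_ne_zero.mpr hz).isUnit

end Scalars

section Dual

variable {m n : ℕ} (b : BorelChoice m n)

/-- Coefficients of the elements that shift a single node. -/
noncomputable def dualCoeff (i l : Fin (m + n)) : ℤ := (b.exists_dual i).choose l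

theorem sum_dualCoeff (i j : Fin (m + n)) :
    ∑ l, dualCoeff b i l * b.cartan l j = if i = j then 1 else 0 :=
  (b.exists_dual i).choose_spec j

theorem sum_dualCoeff_smul {R A : Type*} [CommRing R] [Ring A] [Algebra R A] (e : ℤˣ)
    (i j : Fin (m + n)) (F : Fin (m + n) → A) {y z : A}
    (hF : ∀ l, F l * y - y * F l = ((((e : ℤ) * b.cartan l j : ℤ)) : R) • z) :
    (∑ l, (dualCoeff b i l : R) • F l) * y - y * ∑ l, (dualCoeff b i l : R) • F l
      = if i = j then ((e : ℤ) : R) • z else 0 := by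
  rw [Finset.sum_mul, Finset.mul_sum, ← Finset.sum_sub_distrib]
  simp only [smul_mul_assoc, mul_smul_comm, ← smul_sub, hF, smul_smul]
  rw [← Finset.sum_smul]
  have := congrArg (fun z : ℤ => (((e : ℤ) * z : ℤ) : R)) (sum_dualCoeff b i j)
  simp only [Finset.mul_sum, Int.cast_sum, mul_left_comm (e : ℤ)] at this
  simp only [← Int.cast_mul, this]
  split_ifs <;> simp

theorem commute_dualCoeff_sum {R A : Type*} [CommRing R] [Ring A] [Algebra R A]
    (i : Fin (m + n)) (F : Fin (m + n) → A) {y : A} (hF : ∀ l, F l * y = y * F l) :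
    (∑ l, (dualCoeff b i l : R) • F l) * y = y * ∑ l, (dualCoeff b i l : R) • F l := by
  simp only [Finset.sum_mul, Finset.mul_sum, smul_mul_assoc, mul_smul_comm, hF]

end Dual

theorem bracket_of_sub_smul_sq {R A : Type*} [CommRing R] [Ring A] [Algebra R A] {c η : R}
    {h0 h1 x y : A}
    (h : (h1 - η • (h0 * h0)) * x - x * (h1 - η • (h0 * h0)) = c • y)
    (h' : h0 * x - x * h0 = c • x) :
    h1 * x - x * h1 = c • (y + η • (h0 * x + x * h0)) := by
  have e1 := congrArg (h0 * ·) h'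
  have e2 := congrArg (· * h0) h'
  simp only [mul_sub, sub_mul, mul_smul_comm, smul_mul_assoc, ← mul_assoc] at e1 e2 h
  linear_combination (norm := module) h + η • (e1 + e2)

noncomputable section MinRelations

variable {k : Type*} [Field k] {m n : ℕ} {b : BorelChoice m n} {A : Type*} [Ring A]
  [Algebra (k⟦X⟧) A]

/-- A map from the free superalgebra that satisfies the minimalistic relations. -/
structure MinRep (k : Type*) [Field k] {m n : ℕ} (b : BorelChoice m n) (A : Type*) [Ring A]
    [Algebra (k⟦X⟧) A] where
  /-- the map -/
  map : FreeAlgebra (k⟦X⟧) (Gen (Fin (m + n)) (Fin 2)) →ₐ[k⟦X⟧] A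
  rel : ∀ a c, MYRel k b a c → map a = map c

namespace MinRep

variable (F : MinRep k b A)

/-- The image of the generator `h_{i,r}`. -/
def H (i : Fin (m + n)) (r : Fin 2) : A := F.map (gh k b i r).val

/-- The image of the generator `x^±_{i,r}`. -/
def E (e : ℤˣ) (i : Fin (m + n)) (r : Fin 2) : A := F.map (gx k b e i r).val

/-- The image of `h̃_{i,1}`. -/
def Ht (i : Fin (m + n)) : A := F.H i 1 - halfHbar k • (F.H i 0 * F.H i 0)

theorem map_htilde (i : Fin (m + n)) : F.map (htilde k b i).val = F.Ht i := by
  rw [htilde, map_sub, map_smul, map_mul]; rfl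

theorem H_H (i j : Fin (m + n)) (r s : Fin 2) :
    F.H i r * F.H j s = F.H j s * F.H i r := by
  have := F.rel _ _ (.hh i j r s)
  rw [map_bracket, map_zero, gh_deg, gh_deg, sbr_even_left, sub_eq_zero] at this
  exact this

theorem H_E (e : ℤˣ) (i j : Fin (m + n)) (s : Fin 2) :
    F.H i 0 * F.E e j s - F.E e j s * F.H i 0 = coef k b e i j • F.E e j s := by
  have := F.rel _ _ (.h0x e i j s)
  rwa [map_bracket, map_smul, gh_deg, sbr_even_left] at this

theorem E_E (i j : Fin (m + n)) (r s t : Fin 2) (ht : r.val + s.val = t.val) :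
    sbr (k⟦X⟧) (b.parity i) (b.parity j) (F.E 1 i r) (F.E (-1) j s)
      = if i = j then F.H i t else 0 := by
  have := F.rel _ _ (.xx i j r s t ht)
  rw [map_bracket, apply_ite F.map, map_zero] at this
  exact this

/-- The isotropic diagonal case, excluded from (MY4), holds as 0 = 0: both h_{i,1} and h_{i,0} then
commute with x_{i,0}. A uniform rule is needed to form the T_i. -/
theorem Ht_E (e : ℤˣ) (i j : Fin (m + n)) :
    F.Ht i * F.E e j 0 - F.E e j 0 * F.Ht i = coef k b e i j • F.E e j 1 := by
  by_cases hij : i = j ∧ b.cartan i i = 0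
  · obtain ⟨rfl, hi⟩ := hij
    have h1 := F.rel _ _ (.hxIsotropic e i 0 hi)
    have h0 := F.H_E e i i 0
    rw [map_bracket, map_zero, gh_deg, sbr_even_left, ← H, ← E] at h1
    rw [coef, hi, mul_zero, Int.cast_zero, zero_smul] at h0 ⊢
    rw [sub_eq_zero] at h0 h1
    rw [Ht, sub_mul, mul_sub, h1, smul_mul_assoc, mul_smul_comm, mul_assoc, h0, ← mul_assoc, h0,
      mul_assoc, sub_self]
  · have := F.rel _ _ (.hx e i j hij)
    rwa [map_bracket, map_smul, map_htilde, show (htilde k b i).deg = 0 from rfl, sbr_even_left]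
      at this

theorem H_one_E (e : ℤˣ) (i j : Fin (m + n)) :
    F.H i 1 * F.E e j 0 - F.E e j 0 * F.H i 1 = coef k b e i j •
      (F.E e j 1 + halfHbar k • (F.H i 0 * F.E e j 0 + F.E e j 0 * F.H i 0)) :=
  bracket_of_sub_smul_sq (F.Ht_E e i j) (F.H_E e i j 0)


theorem Ht_H (l j : Fin (m + n)) (s : Fin 2) : F.Ht l * F.H j s = F.H j s * F.Ht l := by
  rw [Ht, sub_mul, mul_sub, smul_mul_assoc, mul_smul_comm, mul_assoc, F.H_H l j 0 s,
    ← mul_assoc, F.H_H l j 0 s, F.H_H l j 1 s, mul_assoc]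

theorem Ht_Ht (l l' : Fin (m + n)) : F.Ht l * F.Ht l' = F.Ht l' * F.Ht l := by
  have h : F.Ht l' = F.H l' 1 - halfHbar k • (F.H l' 0 * F.H l' 0) := rfl
  rw [h, mul_sub, sub_mul, F.Ht_H, mul_smul_comm, smul_mul_assoc, ← mul_assoc, F.Ht_H, mul_assoc,
    F.Ht_H, mul_assoc]

/-- The element that shifts the node `i`. -/
def shiftElt (i : Fin (m + n)) : A := ∑ l, (dualCoeff b i l : k⟦X⟧) • F.Ht l

/-- The minimalistic relations in the form used above. -/
def minData [CharZero k] (hmn : 2 ≤ m + n) : MinData (k⟦X⟧) (A) (m + n) where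
  η := halfHbar k
  isUnit_intCast := isUnit_intCast_powerSeries k
  c := b.cartan
  p := b.parity
  two_le := hmn
  c_symm := b.cartan_symm
  c_succ i j hij := by rw [b.cartan_succ hij]; exact neg_ne_zero.mpr (b.sq_ne_zero j)
  c_last i j hij hi := by rw [b.cartan_succ hij, b.cartan_self_last hi]
  c_last_ne i hi := by rw [b.cartan_self_last hi]; exact b.sq_ne_zero i
  p_eq_zero i := b.parity_eq_zero
  p_eq_one i := b.parity_eq_one
  T := F.shiftElt
  h₀ i := F.H i 0
  h₁ i := F.H i 1
  x₀ e i := F.E e i 0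
  x₁ e i := F.E e i 1
  T_T i j := commute_dualCoeff_sum b i _ fun l =>
    (commute_dualCoeff_sum b j _ fun l' => F.Ht_Ht l' l).symm
  T_h₀ i j := commute_dualCoeff_sum b i _ fun l => F.Ht_H l j 0
  T_h₁ i j := commute_dualCoeff_sum b i _ fun l => F.Ht_H l j 1
  h₀_h₁ i j := F.H_H i j 0 1
  T_x₀ e i j hij := by
    have := sum_dualCoeff_smul b e i j F.Ht fun l => F.Ht_E e l j
    rwa [if_neg hij, sub_eq_zero] at this
  T_x₀_self e i := by
    have := sum_dualCoeff_smul b e i i F.Ht fun l => F.Ht_E e l i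
    rwa [if_pos rfl] at this
  h₀_x₀ e i j := F.H_E e i j 0
  h₁_x₀ e i j := F.H_one_E e i j
  x_x i j := F.E_E i j 0 0 0 rfl
  x₁_x i := (F.E_E i i 1 0 1 rfl).trans (if_pos rfl)
  x_x₁ i := (F.E_E i i 0 1 1 rfl).trans (if_pos rfl)
  x_shift e i j hij := by
    have := F.rel _ _ (.xxShift e i j (by
      rintro ⟨rfl, h1⟩
      rcases hij with hij | hij
      · exact hij rfl
      · simp [hij] at h1))
    rw [map_sub, map_smul, map_bracket, map_bracket, map_anti, coefHbar_eq] at this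
    exact this
  x_x_zero e i j hc := by
    have := F.rel _ _ (.xxZero e i j hc)
    rwa [map_bracket, map_zero] at this
  cubic e i j hi hij hc := by
    have := F.rel _ _ (.cubic e i j hi hij hc)
    rwa [map_bracket, map_bracket, map_zero] at this
  lastCubic e i j hi hij := by
    have := F.rel _ _ (.lastCubic e i j hi hij)
    rwa [map_bracket, map_bracket, map_bracket, map_zero] at this
  quartic e j' j j'' h1 h2 hc := by
    have := F.rel _ _ (.quartic e j' j j'' h1 h2 hc)
    rwa [map_bracket, map_bracket, map_bracket, map_zero] at this

end MinRep

end MinRelations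

end SuperYangian

/-! ### Verification of the relations in both directions. -/

namespace SuperYangian

theorem bracket_sub_smul_sq {R A : Type*} [CommRing R] [Ring A] [Algebra R A] {c η : R}
    {h0 h1 x y : A}
    (h : h1 * x - x * h1 - (h0 * y - y * h0) = (c * η) • (h0 * x + x * h0))
    (h' : h0 * x - x * h0 = c • x) (h'' : h0 * y - y * h0 = c • y) :
    (h1 - η • (h0 * h0)) * x - x * (h1 - η • (h0 * h0)) = c • y := by
  have e1 := congrArg (h0 * ·) h'
  have e2 := congrArg (· * h0) h'
  simp only [mul_sub, sub_mul, mul_smul_comm, smul_mul_assoc, ← mul_assoc] at e1 e2 ⊢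
  linear_combination (norm := module) h + h'' - η • (e1 + e2)

theorem sum_perm_fin_three {V : Type*} [AddCommMonoid V] (f : Fin 3 → Fin 3 → Fin 3 → V) :
    ∑ σ : Equiv.Perm (Fin 3), f (σ 0) (σ 1) (σ 2)
      = f 0 1 2 + f 0 2 1 + f 1 0 2 + f 1 2 0 + f 2 0 1 + f 2 1 0 := by
  have h : (Finset.univ : Finset (Equiv.Perm (Fin 3))) = {1, Equiv.swap 1 2, Equiv.swap 0 1,
    Equiv.swap 0 1 * Equiv.swap 1 2, Equiv.swap 1 2 * Equiv.swap 0 1, Equiv.swap 0 2} := by decide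
  rw [h]
  repeat rw [Finset.sum_insert (by decide)]
  rw [Finset.sum_singleton]
  simp only [add_assoc]
  rfl

noncomputable section Relations

open Polynomial (X)

variable {k : Type*} [Field k] {m n : ℕ} {b : BorelChoice m n} {A : Type*} [Ring A]
  [Algebra (k⟦X⟧) A]

/-- A map from the free superalgebra that satisfies the relations of the super Yangian. -/
structure YRep (k : Type*) [Field k] {m n : ℕ} (b : BorelChoice m n) (A : Type*) [Ring A]
    [Algebra (k⟦X⟧) A] where
  /-- the map -/
  map : FreeAlgebra (k⟦X⟧) (Gen (Fin (m + n)) ℕ) →ₐ[k⟦X⟧] A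
  rel : ∀ a c, YRel k b a c → map a = map c

namespace MinData

variable {N : ℕ} (S : MinData (k⟦X⟧) A N)

/-- The images of the generators of the super Yangian. -/
def genImage : Gen (Fin N) ℕ → A
  | .h i r => S.h i r
  | .x e i r => S.x e i (X ^ r)

end MinData

namespace MinRep

variable (F : MinRep k b A) [CharZero k] (hmn : 2 ≤ m + n)

/-- The extension of a map that satisfies the minimalistic relations to all generators. -/
def extendMap : FreeAlgebra (k⟦X⟧) (Gen (Fin (m + n)) ℕ) →ₐ[k⟦X⟧] A :=
  FreeAlgebra.lift (k⟦X⟧) (F.minData hmn).genImage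

theorem extendMap_gh (i : Fin (m + n)) (r : ℕ) :
    F.extendMap hmn (gh k b i r).val = (F.minData hmn).h i r :=
  FreeAlgebra.lift_ι_apply _ _

theorem extendMap_gx (e : ℤˣ) (i : Fin (m + n)) (r : ℕ) :
    F.extendMap hmn (gx k b e i r).val = (F.minData hmn).x e i (X ^ r) :=
  FreeAlgebra.lift_ι_apply _ _

theorem coef_eq (e : ℤˣ) (i j : Fin (m + n)) : coef k b e i j = (F.minData hmn).k e i j := rfl

theorem coefHbar_eq' (e : ℤˣ) (i j : Fin (m + n)) :
    coefHbar k b e i j = (F.minData hmn).k e i j * (F.minData hmn).η := coefHbar_eq k b e i j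

theorem extendMap_rel (a c) (h : YRel k b a c) : F.extendMap hmn a = F.extendMap hmn c := by
  set S := F.minData hmn with hS
  cases h with
  | hh i j r s =>
    rw [map_bracket, map_zero, gh_deg, gh_deg, sbr_even_left, extendMap_gh, extendMap_gh,
      MinData.h_h, sub_self]
  | h0x e i j s =>
    rw [map_bracket, map_smul, gh_deg, sbr_even_left, extendMap_gh, extendMap_gx, coef_eq F hmn]
    exact S.innerDer_h_zero_x e i j _
  | xx i j r s =>
    rw [map_bracket, apply_ite (F.extendMap hmn), map_zero, extendMap_gh, extendMap_gx,
      extendMap_gx]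
    split_ifs with hij
    · subst hij
      exact S.Y_X_pow i r s
    · exact S.x_pos_x_neg_of_ne hij _ _
  | hx e i j r s hij =>
    have key : innerDer (k⟦X⟧) A (S.h i (r + 1)) (S.x e j (X ^ s))
        - innerDer (k⟦X⟧) A (S.h i r) (S.x e j (X * X ^ s))
        = (S.k e i j * S.η) • (S.h i r * S.x e j (X ^ s) + S.x e j (X ^ s) * S.h i r) := by
      by_cases h : i = j → S.p i = 0 ∨ S.c i i = 0
      · exact S.hShift e i j h r _
      -- At an odd non-isotropic node (Y4) is imposed for r = 0 only.
      · obtain ⟨h1, h2, h3⟩ : i = j ∧ S.p i ≠ 0 ∧ S.c i i ≠ 0 := by tauto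
        obtain ⟨-, -, rfl⟩ := (hij h1).resolve_left h2
        exact S.innerDer_h_one_x e i j _
    rw [map_sub, map_bracket, map_bracket, map_smul, map_anti, gh_deg, gh_deg, sbr_even_left,
      sbr_even_left, superSign_zero_left, one_smul, extendMap_gh, extendMap_gh, extendMap_gx,
      extendMap_gx, coefHbar_eq' F hmn, pow_succ']
    exact key
  | xxShift e i j r s hij =>
    have key : S.shiftRel e i j (X ^ r) (X ^ s) = 0 := by
      by_cases h : i = j
      · subst h
        have : ∀ a : ZMod 2, a ≠ 1 → a = 0 := by decide
        exact S.shiftRel_self e (this _ fun h' => hij ⟨rfl, h'⟩) _ _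
      · exact S.shiftRel_of_ne e h _ _
    rw [map_sub, map_bracket, map_bracket, map_smul, map_anti, extendMap_gx, extendMap_gx,
      extendMap_gx, extendMap_gx, coefHbar_eq' F hmn, pow_succ', pow_succ']
    exact sub_eq_zero.mp key
  | hxIsotropic e i r s hi =>
    rw [map_bracket, map_zero, gh_deg, sbr_even_left, extendMap_gh, extendMap_gx]
    exact S.innerDer_h_x_isotropic e hi r _
  | xxZero e i j r s hij =>
    rw [map_bracket, map_zero, extendMap_gx, extendMap_gx]
    exact S.x_x_zero' e hij _ _
  | cubic e i j r s t hlast hij hi =>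
    rw [map_add, map_bracket, map_bracket, map_bracket, map_bracket, map_zero, extendMap_gx,
      extendMap_gx, extendMap_gx]
    exact S.cubic_eq_zero e i j hlast hij hi r s (X ^ t)
  | lastCubic e i j r t hlast hij =>
    rw [map_sum, map_zero]
    refine Eq.trans ?_ (S.lastCubic_eq_zero e i j hlast hij (r 0) (r 1) (r 2) (X ^ t))
    simp only [map_bracket, extendMap_gx]
    exact sum_perm_fin_three fun a b' c => S.br₄ e i j (X ^ r a) (X ^ r b') (X ^ r c) (X ^ t)
  | quartic e j' j j'' r s h1 h2 hj =>
    rw [map_bracket, map_bracket, map_bracket, map_zero, extendMap_gx, extendMap_gx,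
      extendMap_gx, pow_zero, MinData.x_one]
    exact S.quartic_eq_zero e j' j j'' h1 h2 hj _ _

end MinRep

namespace YRep

variable (G : YRep k b A)

/-- The image of the generator `h_{i,r}`. -/
def H (i : Fin (m + n)) (r : ℕ) : A := G.map (gh k b i r).val

/-- The image of the generator `x^±_{i,r}`. -/
def E (e : ℤˣ) (i : Fin (m + n)) (r : ℕ) : A := G.map (gx k b e i r).val

theorem H_E (e : ℤˣ) (i j : Fin (m + n)) (s : ℕ) :
    G.H i 0 * G.E e j s - G.E e j s * G.H i 0 = coef k b e i j • G.E e j s := by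
  have := G.rel _ _ (.h0x e i j s)
  rwa [map_bracket, map_smul, gh_deg, sbr_even_left] at this

theorem E_E (i j : Fin (m + n)) (r s : ℕ) :
    sbr (k⟦X⟧) (b.parity i) (b.parity j) (G.E 1 i r) (G.E (-1) j s)
      = if i = j then G.H i (r + s) else 0 := by
  have := G.rel _ _ (.xx i j r s)
  rw [map_bracket, apply_ite G.map, map_zero] at this
  exact this

/-- The image of `h̃_{i,1}`. -/
def Ht (i : Fin (m + n)) : A := G.H i 1 - halfHbar k • (G.H i 0 * G.H i 0)

theorem Ht_E (e : ℤˣ) (i j : Fin (m + n)) (s : ℕ) :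
    G.Ht i * G.E e j s - G.E e j s * G.Ht i = coef k b e i j • G.E e j (s + 1) := by
  by_cases hij : i = j ∧ b.cartan i i = 0
  · obtain ⟨rfl, hi⟩ := hij
    have h1 := G.rel _ _ (.hxIsotropic e i 1 s hi)
    have h0 := G.H_E e i i s
    rw [map_bracket, map_zero, gh_deg, sbr_even_left, ← H, ← E] at h1
    rw [coef, hi, mul_zero, Int.cast_zero, zero_smul] at h0 ⊢
    rw [sub_eq_zero] at h0 h1
    rw [Ht, sub_mul, mul_sub, h1, smul_mul_assoc, mul_smul_comm, mul_assoc, h0, ← mul_assoc, h0,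
      mul_assoc, sub_self]
  · have := G.rel _ _ (.hx e i j 0 s fun h => by
      have : ∀ a : ZMod 2, a = 0 ∨ a = 1 := by decide
      have := this (b.parity i)
      tauto)
    rw [map_sub, map_bracket, map_bracket, map_smul, map_anti, gh_deg, gh_deg, sbr_even_left,
      sbr_even_left, superSign_zero_left, one_smul, coefHbar_eq] at this
    exact bracket_sub_smul_sq this (G.H_E e i j s) (G.H_E e i j (s + 1))

end YRep

/-- The inclusion of the generators with `r ∈ {0, 1}`. -/
def Gen.toNat {I : Type} : Gen I (Fin 2) → Gen I ℕ
  | .h i r => .h i r.val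
  | .x e i r => .x e i r.val

namespace YRep

variable (G : YRep k b A)

/-- The restriction to the generators with `r ∈ {0, 1}`. -/
def restrictMap : FreeAlgebra (k⟦X⟧) (Gen (Fin (m + n)) (Fin 2)) →ₐ[k⟦X⟧] A :=
  G.map.comp (FreeAlgebra.lift (k⟦X⟧) fun g => FreeAlgebra.ι (k⟦X⟧) g.toNat)

theorem restrictMap_gh (i : Fin (m + n)) (r : Fin 2) :
    G.restrictMap (gh k b i r).val = G.H i r.val :=
  congrArg G.map (FreeAlgebra.lift_ι_apply _ _)

theorem restrictMap_gx (e : ℤˣ) (i : Fin (m + n)) (r : Fin 2) :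
    G.restrictMap (gx k b e i r).val = G.E e i r.val :=
  congrArg G.map (FreeAlgebra.lift_ι_apply _ _)

theorem restrictMap_htilde (i : Fin (m + n)) : G.restrictMap (htilde k b i).val = G.Ht i := by
  rw [htilde, map_sub, map_smul, map_mul, restrictMap_gh, restrictMap_gh]; rfl

theorem restrictMap_rel [CharZero k] (a c) (h : MYRel k b a c) :
    G.restrictMap a = G.restrictMap c := by
  -- At zero indices the symmetrised Serre relations are 2 and 3! times the minimalistic ones.
  have cancel : ∀ (N : ℕ) (_ : N ≠ 0) (y : A), N • y = 0 → y = 0 := fun N hN y hy => by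
    obtain ⟨u, hu⟩ := isUnit_intCast_powerSeries k N (by exact_mod_cast hN)
    rw [← Nat.cast_smul_eq_nsmul (k⟦X⟧), ← Int.cast_natCast, ← hu] at hy
    simpa using congrArg (fun z => (↑u⁻¹ : k⟦X⟧) • z) hy
  cases h with
  | hh i j r s =>
    have := G.rel _ _ (.hh i j r s)
    rw [map_bracket, map_zero] at this ⊢
    rw [restrictMap_gh, restrictMap_gh]
    exact this
  | h0x e i j s =>
    rw [map_bracket, map_smul, gh_deg, sbr_even_left, restrictMap_gh, restrictMap_gx]
    exact G.H_E e i j s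
  | xx i j r s t ht =>
    rw [map_bracket, apply_ite G.restrictMap, map_zero, restrictMap_gh, restrictMap_gx,
      restrictMap_gx, ← ht]
    exact G.E_E i j r s
  | hx e i j hij =>
    rw [map_bracket, map_smul, restrictMap_htilde, show (htilde k b i).deg = 0 from rfl,
      sbr_even_left, restrictMap_gx, restrictMap_gx]
    exact G.Ht_E e i j 0
  | xxShift e i j hij =>
    have := G.rel _ _ (.xxShift e i j 0 0 hij)
    rw [map_sub, map_bracket, map_bracket, map_smul, map_anti] at this ⊢
    simp only [restrictMap_gx]
    exact this
  | hxIsotropic e i s hi =>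
    have := G.rel _ _ (.hxIsotropic e i 1 s hi)
    rw [map_bracket, map_zero] at this ⊢
    rw [restrictMap_gh, restrictMap_gx]
    exact this
  | xxZero e i j hij =>
    have := G.rel _ _ (.xxZero e i j 0 0 hij)
    rw [map_bracket, map_zero] at this ⊢
    rw [restrictMap_gx, restrictMap_gx]
    exact this
  | cubic e i j hlast hij hi =>
    have := G.rel _ _ (.cubic e i j 0 0 0 hlast hij hi)
    rw [map_add, map_zero, ← two_nsmul] at this
    have := cancel 2 two_ne_zero _ this
    rw [map_bracket, map_bracket] at this
    rw [map_zero, map_bracket, map_bracket, restrictMap_gx, restrictMap_gx]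
    exact this
  | lastCubic e i j hlast hij =>
    have := G.rel _ _ (.lastCubic e i j (fun _ => 0) 0 hlast hij)
    rw [map_sum, map_zero, Finset.sum_const] at this
    have := cancel _ (by simp) _ this
    rw [map_bracket, map_bracket, map_bracket] at this
    rw [map_zero, map_bracket, map_bracket, map_bracket, restrictMap_gx, restrictMap_gx]
    exact this
  | quartic e j' j j'' h1 h2 hj =>
    have := G.rel _ _ (.quartic e j' j j'' 0 0 h1 h2 hj)
    rw [map_bracket, map_bracket, map_bracket, map_zero] at this ⊢
    rw [restrictMap_gx, restrictMap_gx, restrictMap_gx]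
    exact this

end YRep

end Relations

end SuperYangian

/-! ### The isomorphism and its compatibility with parities. -/

namespace SuperYangian

noncomputable section Isomorphism

open Polynomial (X)

variable {k : Type*} [Field k] {m n : ℕ} {b : BorelChoice m n} {A B : Type*} [Ring A]
  [Algebra (k⟦X⟧) A] [Ring B] [Algebra (k⟦X⟧) B]

namespace MinRep

variable (F : MinRep k b A)

/-- The grading generated by the images of the generators. -/
abbrev part (d : ZMod 2) : Submodule (k⟦X⟧) A :=
  parityPart (Gen.par b.parity) (fun g => F.map (FreeAlgebra.ι (k⟦X⟧) g)) d

theorem H_mem (i : Fin (m + n)) (r : Fin 2) : F.H i r ∈ F.part 0 :=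
  parityPart_gen_mem (Gen.par b.parity) _ (Gen.h i r)

theorem shiftElt_mem (i : Fin (m + n)) : F.shiftElt i ∈ F.part 0 := by
  refine Submodule.sum_mem _ fun l _ => Submodule.smul_mem _ _ (Submodule.sub_mem _ (F.H_mem l 1)
    (Submodule.smul_mem _ _ ?_))
  have := parityPart_mul_mem _ _ (F.H_mem l 0) (F.H_mem l 0)
  rwa [add_zero] at this

variable [CharZero k] (hmn : 2 ≤ m + n)

section

variable (G : YRep k b B) (P : A →ₐ[k⟦X⟧] B)
  (hH : ∀ (i : Fin (m + n)) (r : Fin 2), P (F.H i r) = G.H i r.val)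
  (hE : ∀ (e : ℤˣ) (i : Fin (m + n)) (r : Fin 2), P (F.E e i r) = G.E e i r.val)

include hH hE

/-- The image of T_i is the same combination of h̃_{l,1} in the target, where it also raises the
index of x_i by one. -/
theorem map_x_pow (e : ℤˣ) (i : Fin (m + n)) (r : ℕ) :
    P ((F.minData hmn).x e i (X ^ r)) = G.E e i r := by
  have hT : P ((F.minData hmn).T i) = ∑ l, (dualCoeff b i l : k⟦X⟧) • G.Ht l := by
    have h : (F.minData hmn).T i = ∑ l, (dualCoeff b i l : k⟦X⟧) • F.Ht l := rfl
    rw [h, map_sum]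
    refine Finset.sum_congr rfl fun l _ => ?_
    rw [map_smul, Ht, map_sub, map_smul, map_mul, hH, hH]
    rfl
  induction r with
  | zero => rw [pow_zero, MinData.x_one]; exact hE e i 0
  | succ r ih =>
    have := sum_dualCoeff_smul b e i i G.Ht fun l => G.Ht_E e l i r
    rw [if_pos rfl] at this
    rw [pow_succ', MinData.x_X_mul, map_smul, innerDer_apply, map_sub, map_mul, map_mul, ih, hT,
      this, ← MinData.sgn, smul_smul, MinData.sgn_mul_self, one_smul]

theorem map_h (i : Fin (m + n)) (r : ℕ) : P ((F.minData hmn).h i r) = G.H i r := by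
  have := G.E_E i i r 0
  rw [if_pos rfl] at this
  rw [MinData.h, MinData.Y, sbr, map_sub, map_smul, map_mul, map_mul,
    F.map_x_pow hmn G P hH hE, ← pow_zero (X : Polynomial (k⟦X⟧)), F.map_x_pow hmn G P hH hE]
  exact this

end

theorem x_pow_mem (e : ℤˣ) (i : Fin (m + n)) (r : ℕ) :
    (F.minData hmn).x e i (X ^ r) ∈ F.part (b.parity i) := by
  induction r with
  | zero =>
    rw [pow_zero, MinData.x_one]
    exact parityPart_gen_mem (Gen.par b.parity) _ (Gen.x e i 0)
  | succ r ih =>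
    have := parityPart_sbr_mem _ (F.shiftElt_mem i) ih
    rw [zero_add, sbr_even_left] at this
    rw [pow_succ', MinData.x_X_mul]
    exact Submodule.smul_mem _ _ this

theorem h_mem (i : Fin (m + n)) (r : ℕ) : (F.minData hmn).h i r ∈ F.part 0 := by
  have := parityPart_sbr_mem _ (F.x_pow_mem hmn 1 i r) (F.x_pow_mem hmn (-1) i 0)
  rwa [CharTwo.add_self_eq_zero, pow_zero] at this

theorem genImage_mem (g : Gen (Fin (m + n)) ℕ) :
    (F.minData hmn).genImage g ∈ F.part (Gen.par b.parity g) := by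
  cases g with
  | h i r => exact F.h_mem hmn i r
  | x e i r => exact F.x_pow_mem hmn e i r

end MinRep

variable (k b)

/-- The tautological map to the algebra of the minimalistic presentation. -/
def MinYangian.rep : MinRep k b (MinYangian k b) :=
  ⟨RingQuot.mkAlgHom (k⟦X⟧) (MYRel k b), fun _ _ h => RingQuot.mkAlgHom_rel _ h⟩

/-- The tautological map to the super Yangian. -/
def Yangian.rep : YRep k b (Yangian k b) :=
  ⟨RingQuot.mkAlgHom (k⟦X⟧) (YRel k b), fun _ _ h => RingQuot.mkAlgHom_rel _ h⟩

variable [CharZero k] (hmn : 2 ≤ m + n)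

/-- The map from the minimalistic presentation to the super Yangian. -/
def MinYangian.toYangian : MinYangian k b →ₐ[k⟦X⟧] Yangian k b :=
  RingQuot.liftAlgHom (k⟦X⟧) ⟨(Yangian.rep k b).restrictMap, (Yangian.rep k b).restrictMap_rel⟩

/-- The map from the super Yangian to the minimalistic presentation. -/
def Yangian.toMinYangian : Yangian k b →ₐ[k⟦X⟧] MinYangian k b :=
  RingQuot.liftAlgHom (k⟦X⟧)
    ⟨(MinYangian.rep k b).extendMap hmn, (MinYangian.rep k b).extendMap_rel hmn⟩

theorem MinYangian.toYangian_gen (g : Gen (Fin (m + n)) (Fin 2)) :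
    MinYangian.toYangian k b (MinYangian.gen k b g) = Yangian.gen k b g.toNat :=
  (RingQuot.liftAlgHom_mkAlgHom_apply _ _ _ _).trans
    (congrArg (Yangian.rep k b).map (FreeAlgebra.lift_ι_apply _ _))

theorem Yangian.toMinYangian_gen (g : Gen (Fin (m + n)) ℕ) :
    Yangian.toMinYangian k b hmn (Yangian.gen k b g)
      = ((MinYangian.rep k b).minData hmn).genImage g :=
  (RingQuot.liftAlgHom_mkAlgHom_apply _ _ _ _).trans (FreeAlgebra.lift_ι_apply _ _)

theorem MinYangian.toYangian_genImage (g : Gen (Fin (m + n)) ℕ) :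
    MinYangian.toYangian k b (((MinYangian.rep k b).minData hmn).genImage g)
      = Yangian.gen k b g := by
  have hH : ∀ (i : Fin (m + n)) (r : Fin 2),
      MinYangian.toYangian k b ((MinYangian.rep k b).H i r) = (Yangian.rep k b).H i r.val :=
    fun i r => MinYangian.toYangian_gen k b (.h i r)
  have hE : ∀ (e : ℤˣ) (i : Fin (m + n)) (r : Fin 2),
      MinYangian.toYangian k b ((MinYangian.rep k b).E e i r) = (Yangian.rep k b).E e i r.val :=
    fun e i r => MinYangian.toYangian_gen k b (.x e i r)
  cases g with
  | h i r => exact MinRep.map_h (rep k b) hmn (Yangian.rep k b) (toYangian k b) hH hE i r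
  | x e i r => exact MinRep.map_x_pow (rep k b) hmn (Yangian.rep k b) (toYangian k b) hH hE e i r

theorem MinYangian.genImage_toNat (g : Gen (Fin (m + n)) (Fin 2)) :
    ((MinYangian.rep k b).minData hmn).genImage g.toNat = MinYangian.gen k b g := by
  cases g with
  | h i r =>
    fin_cases r
    · exact MinData.h_zero _ i
    · exact MinData.h_one _ i
  | x e i r =>
    fin_cases r
    · exact (congrArg _ (pow_zero X)).trans (MinData.x_one _ e i)
    · exact (congrArg _ (pow_one X)).trans (MinData.x_X _ e i)

/-- The isomorphism of the minimalistic presentation with the super Yangian. -/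
def MinYangian.equivYangian : MinYangian k b ≃ₐ[k⟦X⟧] Yangian k b :=
  AlgEquiv.ofAlgHom (MinYangian.toYangian k b) (Yangian.toMinYangian k b hmn)
    (RingQuot.ringQuot_ext' _ _ _ (FreeAlgebra.hom_ext (funext fun g =>
      (congrArg _ (Yangian.toMinYangian_gen k b hmn g)).trans
        (MinYangian.toYangian_genImage k b hmn g))))
    (RingQuot.ringQuot_ext' _ _ _ (FreeAlgebra.hom_ext (funext fun g =>
      (congrArg _ (MinYangian.toYangian_gen k b g)).trans
        ((Yangian.toMinYangian_gen k b hmn _).trans (MinYangian.genImage_toNat k b hmn g)))))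

theorem MinYangian.map_grading (d : ZMod 2) :
    (MinYangian.grading k b d).map (MinYangian.equivYangian k b hmn).toLinearMap
      = Yangian.grading k b d := by
  apply le_antisymm
  · refine map_parityPart_le (A := MinYangian k b) (B := Yangian k b) (MinYangian.toYangian k b)
      (fun g => ?_) d
    rw [MinYangian.toYangian_gen]
    convert parityPart_gen_mem (R := k⟦X⟧) (Gen.par b.parity) (Yangian.gen k b) g.toNat using 2
    cases g <;> rfl
  -- The reverse inclusion comes from the inverse map, since the constructed generators are
  -- homogeneous of the expected parity.
  · have h : (Yangian.grading k b d).map (Yangian.toMinYangian k b hmn).toLinearMap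
        ≤ MinYangian.grading k b d := by
      refine map_parityPart_le (A := Yangian k b) (B := MinYangian k b)
        (Yangian.toMinYangian k b hmn) (fun g => ?_) d
      rw [Yangian.toMinYangian_gen]
      exact MinRep.genImage_mem (MinYangian.rep k b) hmn g
    intro y hy
    exact ⟨Yangian.toMinYangian k b hmn y, h ⟨y, hy, rfl⟩,
      (MinYangian.equivYangian k b hmn).apply_symm_apply y⟩

end Isomorphism

end SuperYangian

theorem mainTheorem2 {k : Type*} [Field k] [IsAlgClosed k] [CharZero k]
    (m n : ℕ) (hn : 1 ≤ n) (hmn : 2 ≤ m + n) (b : SuperYangian.BorelChoice m n) :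
    ∃ φ : SuperYangian.MinYangian k b ≃ₐ[PowerSeries k] SuperYangian.Yangian k b,
      (∀ (i : Fin (m + n)) (r : Fin 2),
        φ (SuperYangian.MinYangian.gen k b (.h i r)) =
          SuperYangian.Yangian.gen k b (.h i r.val)) ∧
      (∀ (e : ℤˣ) (i : Fin (m + n)) (r : Fin 2),
        φ (SuperYangian.MinYangian.gen k b (.x e i r)) =
          SuperYangian.Yangian.gen k b (.x e i r.val)) ∧
      (∀ d : ZMod 2,
        (SuperYangian.MinYangian.grading k b d).map φ.toLinearMap =
          SuperYangian.Yangian.grading k b d) :=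
  ⟨SuperYangian.MinYangian.equivYangian k b hmn,
    fun i r => SuperYangian.MinYangian.toYangian_gen k b (.h i r),
    fun e i r => SuperYangian.MinYangian.toYangian_gen k b (.x e i r),
    SuperYangian.MinYangian.map_grading k b hmn⟩
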